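/- Setting. Let $\mathcal Q$ be a bipartite quiver with vertex set $V_{\rm source}\sqcup V_{\rm target}$ and arrows $h_1,\dots,h_r$, where $h_k$ goes from $s(h_k)\in V_{\rm source}$ to $t(h_k)\in V_{\rm target}$, and let $\mathbf m=(m_\gamma)$, $\mathbf u=(u_\gamma)$ be tuples of nonnegative integers indexed by the vertices. Page $k$ is the rectangle of lattice points $(i,j)$, $1\le i\le m_{t(h_k)}$, $1\le j\le m_{s(h_k)}$ ($i$ is the row, numbered downwards, and $j$ the column, numbered to the right), and $L$ is the set of all $(i,j,k)$ with $(i,j)$ on page $k$. For a target $\alpha$, let $A_\alpha$ be the array obtained by putting the pages of the arrows with target $\alpha$ side by side, from left to right in increasing order of $k$; for a source $\beta$, let $A_\beta$ be obtained by stacking the pages of the arrows with source $\beta$ from top to bottom in increasing order of $k$. Let $a_\gamma\times b_\gamma$ be the size of $A_\gamma$, and identify the positions of $A_\gamma$ with the corresponding elements of $L$. Put $v_\alpha=\sum_{t(h)=\alpha}u_{s(h)}$ and $v_\beta=\sum_{s(h)=\beta}u_{t(h)}$, and assume $0<u_\gamma\le\min(a_\gamma,b_\gamma)$ and $u_\gamma\le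 v_\gamma$ for every vertex $\gamma$. Road maps. Paths are lattice paths from a SW endpoint to a NE endpoint with unit steps to the east (next column) or to the north (previous row). A point $R$ of a path is a NW corner of it if the points immediately south and east of $R$ also lie on the path, and a SE corner if the points immediately north and west of $R$ also lie on the path. A road map consists, for every target $\alpha$, of pairwise disjoint paths $H^\alpha_1,\dots,H^\alpha_{u_\alpha}$ in $A_\alpha$, where $H^\alpha_p$ joins $(a_\alpha-u_\alpha+p,1)$ and $(p,b_\alpha)$ (horizontal paths), and, for every source $\beta$, of pairwise disjoint paths $V^\beta_1,\dots,V^\beta_{u_\beta}$ in $A_\beta$, where $V^\beta_q$ joins $(a_\beta,q)$ and $(1,b_\beta-u_\beta+q)$ (vertical paths). It is straight if each corner of a horizontal path lies on a vertical path and each corner of a vertical path lies on a horizontal path. A concurrent vertex map is a set $C\subseteq L$ that is, for some straight road map, the set of all points lying on both a horizontal and a vertical path; that road map is then said to correspond to $C$. Essential corners. Fix a straight road map corresponding to $C$. A horizontal (vertical) NW or SE corner of $C$ is an element of $L$ that is such a corner of a horizontal (vertical) path. For a target $\alpha$, renumber the vertical paths crossing $A_\alpha$, taken page by page from left to right and on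 each page in the order of their indices, as $V^\alpha_1,\dots,V^\alpha_{v_\alpha}$, and let $P^\alpha_{pq}$ and $Q^\alpha_{pq}$ be the SW and the NE endpoint of $H^\alpha_p\cap V^\alpha_q$, taken on the page to which $V^\alpha_q$ belongs. For a source $\beta$, renumber likewise the horizontal paths crossing $A_\beta$, taken page by page from top to bottom, as $H^\beta_1,\dots,H^\beta_{v_\beta}$, and let $P^\beta_{pq}$ and $Q^\beta_{pq}$ be the SW and the NE endpoint of $H^\beta_p\cap V^\beta_q$, taken on the page to which $H^\beta_p$ belongs. A horizontal NW corner in $A_\alpha$ is essential unless it equals $Q^\alpha_{p,\,p+v_\alpha-u_\alpha}$ for some $1\le p\le u_\alpha$; a vertical NW corner in $A_\beta$ is essential unless it equals $P^\beta_{q+v_\beta-u_\beta,\,q}$ for some $1\le q\le u_\beta$; a horizontal SE corner in $A_\alpha$ is essential unless it equals $P^\alpha_{p,p}$ for some $1\le p\le u_\alpha$; a vertical SE corner in $A_\beta$ is essential unless it equals $Q^\beta_{q,q}$ for some $1\le q\le u_\beta$. Orders, $C_{\max}$ and $C_{\min}$. Order $L$ by $(i,j,k)<_T(i',j',k')$ if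 $(k,i,j)$ precedes $(k',i',j')$ lexicographically. For concurrent vertex maps $C=\{P_1<_T\dots<_TP_N\}$ and $C'=\{P'_1<_T\dots<_TP'_N\}$ (all concurrent vertex maps have the same cardinality $N$), put $C<_TC'$ if there is an index $t$ with $P_t<_TP'_t$ and $P_s=P'_s$ for all $s>t$, and $C\le_TC'$ if $C<_TC'$ or $C=C'$. A subset of $L$ is $\mathbf u$-compatible if, for every vertex $\gamma$, its positions in $A_\gamma$ contain no $u_\gamma+1$ points $(i_1,j_1),\dots,(i_{u_\gamma+1},j_{u_\gamma+1})$ with $i_1<\dots<i_{u_\gamma+1}$ and $j_1<\dots<j_{u_\gamma+1}$. For a $\mathbf u$-compatible $S\subseteq L$, $C_{\max}(S)$ (respectively $C_{\min}(S)$) is obtained from $S$ by running through the points of $L$ from the largest to the smallest (respectively from the smallest to the largest) under $<_T$ and adding each point that keeps the current set $\mathbf u$-compatible. Proposition. Let $C$ be a concurrent vertex map and let $S\subseteq C$. Then $C_{\max}(S)\ge_TC$, and equality holds if and only if $S$ contains all essential horizontal and vertical NW corners of $C$. Similarly, $C_{\min}(S)\le_TC$, and equality holds if and only if $S$ contains all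 essential horizontal and vertical SE corners of $C$. -/

import Mathlib

/-- A bipartite quiver with set of target vertices `T`, set of source vertices `S` and arrows
`h_0, …, h_{r-1}`, `h_k : s k ⟶ t k`, together with the two tuples `m` and `u` of nonnegative
integers indexed by the vertices (`mT, uT` on `T` and `mS, uS` on `S`). -/
structure BipartiteData (T S : Type*) where
  r : ℕ
  t : Fin r → T
  s : Fin r → S
  mT : T → ℕ
  mS : S → ℕ
  uT : T → ℕ
  uS : S → ℕ

namespace BipartiteData

section Sizes

variable {T S : Type*} [DecidableEq T] [DecidableEq S] (Q : BipartiteData T S)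

/-- Number of rows of `A_α = [X^(r₁) | X^(r₂) | ⋯]`, `α` a target vertex. -/
def aT (α : T) : ℕ := Q.mT α

/-- Number of columns of `A_α`. -/
def bT (α : T) : ℕ := ∑ k ∈ Finset.univ.filter (fun k => Q.t k = α), Q.mS (Q.s k)

/-- Number of rows of `A_β` (the `X^(k)` with `s k = β`, stacked), `β` a source vertex. -/
def aS (β : S) : ℕ := ∑ k ∈ Finset.univ.filter (fun k => Q.s k = β), Q.mT (Q.t k)

/-- Number of columns of `A_β`. -/
def bS (β : S) : ℕ := Q.mS β

/-- `v_α`, the sum of `u_{s(h)}` over the arrows `h` with target `α`. -/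
def vT (α : T) : ℕ := ∑ k ∈ Finset.univ.filter (fun k => Q.t k = α), Q.uS (Q.s k)

/-- `v_β`, the sum of `u_{t(h)}` over the arrows `h` with source `β`. -/
def vS (β : S) : ℕ := ∑ k ∈ Finset.univ.filter (fun k => Q.s k = β), Q.uT (Q.t k)

/-- The standing assumption: `0 < u_γ ≤ min (a_γ, b_γ)` and `u_γ ≤ v_γ` for every vertex `γ`. -/
structure Admissible : Prop where
  target : ∀ α : T, 0 < Q.uT α ∧ Q.uT α ≤ min (Q.aT α) (Q.bT α) ∧ Q.uT α ≤ Q.vT α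
  source : ∀ β : S, 0 < Q.uS β ∧ Q.uS β ≤ min (Q.aS β) (Q.bS β) ∧ Q.uS β ≤ Q.vS β

/-- Number of columns of `A_{t k}` to the left of the block `X^(k)`. -/
def colOffset (k : Fin Q.r) : ℕ :=
  ∑ l ∈ Finset.univ.filter (fun l => l < k ∧ Q.t l = Q.t k), Q.mS (Q.s l)

/-- Number of rows of `A_{s k}` above the block `X^(k)`. -/
def rowOffset (k : Fin Q.r) : ℕ :=
  ∑ l ∈ Finset.univ.filter (fun l => l < k ∧ Q.s l = Q.s k), Q.mT (Q.t l)

/-- Number of vertical paths that cross the blocks of `A_{t k}` to the left of `X^(k)`. -/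
def vertOffset (k : Fin Q.r) : ℕ :=
  ∑ l ∈ Finset.univ.filter (fun l => l < k ∧ Q.t l = Q.t k), Q.uS (Q.s l)

/-- Number of horizontal paths that cross the blocks of `A_{s k}` above `X^(k)`. -/
def horizOffset (k : Fin Q.r) : ℕ :=
  ∑ l ∈ Finset.univ.filter (fun l => l < k ∧ Q.s l = Q.s k), Q.uT (Q.t l)

end Sizes

/-- The set `L` of all `(i, j, k)` with `1 ≤ i ≤ m_{t(h_k)}` and `1 ≤ j ≤ m_{s(h_k)}`: the lattice
point in row `i` and column `j` of page `k`. -/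
@[ext]
structure Vertex {T S : Type*} (Q : BipartiteData T S) where
  k : Fin Q.r
  i : ℕ
  j : ℕ
  hi : i ∈ Finset.Icc 1 (Q.mT (Q.t k))
  hj : j ∈ Finset.Icc 1 (Q.mS (Q.s k))

section Order

variable {T S : Type*} {Q : BipartiteData T S}

/-- `L` as a disjoint union of rectangles. -/
def vertexEquiv (Q : BipartiteData T S) :
    (Σ k : Fin Q.r, {i // i ∈ Finset.Icc 1 (Q.mT (Q.t k))} ×
      {j // j ∈ Finset.Icc 1 (Q.mS (Q.s k))}) ≃ Q.Vertex where
  toFun x := ⟨x.1, x.2.1.1, x.2.2.1, x.2.1.2, x.2.2.2⟩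
  invFun x := ⟨x.k, ⟨x.i, x.hi⟩, ⟨x.j, x.hj⟩⟩
  left_inv _ := rfl
  right_inv _ := rfl

instance : Fintype Q.Vertex := Fintype.ofEquiv _ (vertexEquiv Q)

/-- The key whose lexicographic order is the order `<_T` on `L`. -/
def Vertex.key (x : Q.Vertex) : Fin Q.r ×ₗ (ℕ ×ₗ ℕ) := toLex (x.k, toLex (x.i, x.j))

theorem Vertex.key_injective : Function.Injective (Vertex.key (Q := Q)) := by
  intro x y h
  have h1 : (x.k, toLex (x.i, x.j)) = (y.k, toLex (y.i, y.j)) := toLex.injective h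
  have h2 : x.k = y.k := congrArg Prod.fst h1
  have h3 : (x.i, x.j) = (y.i, y.j) := toLex.injective (congrArg Prod.snd h1)
  exact Vertex.ext h2 (congrArg Prod.fst h3) (congrArg Prod.snd h3)

/-- The total order `<_T` on `L`. -/
instance : LinearOrder Q.Vertex := LinearOrder.lift' Vertex.key Vertex.key_injective

theorem Vertex.lt_iff (x y : Q.Vertex) :
    x < y ↔ x.k < y.k ∨ (x.k = y.k ∧ x.i < y.i) ∨ (x.k = y.k ∧ x.i = y.i ∧ x.j < y.j) := by
  have h : x < y ↔ Vertex.key x < Vertex.key y := Iff.rfl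
  rw [h, Vertex.key, Vertex.key, Prod.Lex.toLex_lt_toLex, Prod.Lex.toLex_lt_toLex]
  tauto

end Order

section Compatible

variable {T S : Type*} [DecidableEq T] [DecidableEq S] (Q : BipartiteData T S)

/-- `φ_α⁻¹(i, j, k)` for `α = t k`: the (row, column) position of the vertex in `A_α`. -/
def posT (x : Q.Vertex) : ℤ × ℤ := ((x.i : ℤ), (Q.colOffset x.k : ℤ) + x.j)

/-- `φ_β⁻¹(i, j, k)` for `β = s k`: the (row, column) position of the vertex in `A_β`. -/
def posS (x : Q.Vertex) : ℤ × ℤ := ((Q.rowOffset x.k : ℤ) + x.i, (x.j : ℤ))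

/-- `C^α = φ_α⁻¹(C)`. -/
def preT (C : Finset Q.Vertex) (α : T) : Set (ℤ × ℤ) :=
  {p | ∃ x ∈ C, Q.t x.k = α ∧ Q.posT x = p}

/-- `C^β = φ_β⁻¹(C)`. -/
def preS (C : Finset Q.Vertex) (β : S) : Set (ℤ × ℤ) :=
  {p | ∃ x ∈ C, Q.s x.k = β ∧ Q.posS x = p}

/-- `X` contains a diagonal chain of size `n`. -/
def HasDiagonalChain (X : Set (ℤ × ℤ)) (n : ℕ) : Prop :=
  ∃ f : Fin n → ℤ × ℤ, (∀ a, f a ∈ X) ∧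
    ∀ a b, a < b → (f a).1 < (f b).1 ∧ (f a).2 < (f b).2

/-- `C` is `u`-compatible. -/
def Compatible (C : Finset Q.Vertex) : Prop :=
  (∀ α : T, ¬ HasDiagonalChain (Q.preT C α) (Q.uT α + 1)) ∧
    ∀ β : S, ¬ HasDiagonalChain (Q.preS C β) (Q.uS β + 1)

open Classical in
/-- One greedy step: add the vertex `x` to `A` if the result is `u`-compatible. -/
noncomputable def greedyStep (A : Finset Q.Vertex) (x : Q.Vertex) : Finset Q.Vertex :=
  if Q.Compatible (insert x A) then insert x A else A

/-- `C_max(A)`: run through `L` from the largest vertex to the smallest. -/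
noncomputable def cMax (A : Finset Q.Vertex) : Finset Q.Vertex :=
  ((Finset.univ : Finset Q.Vertex).sort (· ≥ ·)).foldl Q.greedyStep A

/-- `C_min(A)`: run through `L` from the smallest vertex to the largest. -/
noncomputable def cMin (A : Finset Q.Vertex) : Finset Q.Vertex :=
  ((Finset.univ : Finset Q.Vertex).sort (· ≤ ·)).foldl Q.greedyStep A

end Compatible

section Paths

/-- A step of length one to the east or to the north (first coordinate: row, growing southwards;
second coordinate: column, growing eastwards). -/
def Step (p q : ℤ × ℤ) : Prop := q = (p.1, p.2 + 1) ∨ q = (p.1 - 1, p.2)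

/-- `l` lists the vertices, from SW to NE, of a lattice path with SW endpoint `p` and NE endpoint
`q`. Reading `l` backwards gives the NE-SW path from `q` to `p`. -/
def IsPath (p q : ℤ × ℤ) (l : List (ℤ × ℤ)) : Prop :=
  l.head? = some p ∧ l.getLast? = some q ∧ l.IsChain Step

/-- `p` is a NW corner of the path `l`. -/
def IsNWCorner (l : List (ℤ × ℤ)) (p : ℤ × ℤ) : Prop :=
  p ∈ l ∧ (p.1 + 1, p.2) ∈ l ∧ (p.1, p.2 + 1) ∈ l

/-- `p` is a SE corner of the path `l`. -/
def IsSECorner (l : List (ℤ × ℤ)) (p : ℤ × ℤ) : Prop :=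
  p ∈ l ∧ (p.1 - 1, p.2) ∈ l ∧ (p.1, p.2 - 1) ∈ l

end Paths

/-- A road map of rank `u`. Only the paths `H α p` with `1 ≤ p ≤ u_α` and `V β q` with
`1 ≤ q ≤ u_β` belong to the road map; all notions below look only at these. -/
structure RoadMap {T S : Type*} [DecidableEq T] [DecidableEq S] (Q : BipartiteData T S) where
  H : T → ℕ → List (ℤ × ℤ)
  V : S → ℕ → List (ℤ × ℤ)
  H_path : ∀ α, ∀ p ∈ Finset.Icc 1 (Q.uT α),
    IsPath ((Q.aT α : ℤ) - Q.uT α + p, 1) ((p : ℤ), (Q.bT α : ℤ)) (H α p)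
  V_path : ∀ β, ∀ q ∈ Finset.Icc 1 (Q.uS β),
    IsPath ((Q.aS β : ℤ), (q : ℤ)) (1, (Q.bS β : ℤ) - Q.uS β + q) (V β q)
  H_disjoint : ∀ α, ∀ p ∈ Finset.Icc 1 (Q.uT α), ∀ p' ∈ Finset.Icc 1 (Q.uT α),
    p ≠ p' → (H α p).Disjoint (H α p')
  V_disjoint : ∀ β, ∀ q ∈ Finset.Icc 1 (Q.uS β), ∀ q' ∈ Finset.Icc 1 (Q.uS β),
    q ≠ q' → (V β q).Disjoint (V β q')

namespace RoadMap

variable {T S : Type*} [DecidableEq T] [DecidableEq S] {Q : BipartiteData T S} (R : Q.RoadMap)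

/-- The vertex `x` (on page `k`, say) lies on a horizontal path of `A_{t k}`. -/
def OnHorizontal (x : Q.Vertex) : Prop :=
  ∃ p ∈ Finset.Icc 1 (Q.uT (Q.t x.k)), Q.posT x ∈ R.H (Q.t x.k) p

/-- The vertex `x` (on page `k`, say) lies on a vertical path of `A_{s k}`. -/
def OnVertical (x : Q.Vertex) : Prop :=
  ∃ q ∈ Finset.Icc 1 (Q.uS (Q.s x.k)), Q.posS x ∈ R.V (Q.s x.k) q

/-- `x = φ_α(P)` with `P` a NW corner of a horizontal path of `A_α`. -/
def IsHorizontalNWCorner (x : Q.Vertex) : Prop :=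
  ∃ p ∈ Finset.Icc 1 (Q.uT (Q.t x.k)), IsNWCorner (R.H (Q.t x.k) p) (Q.posT x)

/-- `x = φ_α(P)` with `P` a SE corner of a horizontal path of `A_α`. -/
def IsHorizontalSECorner (x : Q.Vertex) : Prop :=
  ∃ p ∈ Finset.Icc 1 (Q.uT (Q.t x.k)), IsSECorner (R.H (Q.t x.k) p) (Q.posT x)

/-- `x = φ_β(P)` with `P` a NW corner of a vertical path of `A_β`. -/
def IsVerticalNWCorner (x : Q.Vertex) : Prop :=
  ∃ q ∈ Finset.Icc 1 (Q.uS (Q.s x.k)), IsNWCorner (R.V (Q.s x.k) q) (Q.posS x)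

/-- `x = φ_β(P)` with `P` a SE corner of a vertical path of `A_β`. -/
def IsVerticalSECorner (x : Q.Vertex) : Prop :=
  ∃ q ∈ Finset.Icc 1 (Q.uS (Q.s x.k)), IsSECorner (R.V (Q.s x.k) q) (Q.posS x)

/-- Each corner of a horizontal path lies in a vertical path, and each corner of a vertical path
lies in a horizontal path. -/
def IsStraight : Prop :=
  (∀ x : Q.Vertex, R.IsHorizontalNWCorner x ∨ R.IsHorizontalSECorner x → R.OnVertical x) ∧
    ∀ x : Q.Vertex, R.IsVerticalNWCorner x ∨ R.IsVerticalSECorner x → R.OnHorizontal x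

/-- `C` consists of the vertices lying on both a horizontal and a vertical path of `R`. -/
def Induces (C : Finset Q.Vertex) : Prop :=
  ∀ x : Q.Vertex, x ∈ C ↔ R.OnHorizontal x ∧ R.OnVertical x

/-- `x` lies on `H^{t k}_p|_k ∩ V^{s k}_q|_k`, where `k` is the page of `x`. -/
def Meets (p q : ℕ) (x : Q.Vertex) : Prop :=
  Q.posT x ∈ R.H (Q.t x.k) p ∧ Q.posS x ∈ R.V (Q.s x.k) q

/-- `x` is the SW endpoint `P^k_{pq}` of `H^{t k}_p|_k ∩ V^{s k}_q|_k`. -/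
def IsSWEnd (p q : ℕ) (x : Q.Vertex) : Prop :=
  R.Meets p q x ∧ ∀ y : Q.Vertex, y.k = x.k → R.Meets p q y → y.i ≤ x.i ∧ x.j ≤ y.j

/-- `x` is the NE endpoint `Q^k_{pq}` of `H^{t k}_p|_k ∩ V^{s k}_q|_k`. -/
def IsNEEnd (p q : ℕ) (x : Q.Vertex) : Prop :=
  R.Meets p q x ∧ ∀ y : Q.Vertex, y.k = x.k → R.Meets p q y → x.i ≤ y.i ∧ y.j ≤ x.j

/- For a target vertex `α`, the vertical paths crossing `A_α` are renumbered
`V^α_1, …, V^α_{v_α}` from left to right, so that `V^{s k}_q` on page `k` becomes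
`V^α_{vertOffset k + q}`; for a source vertex `β`, the horizontal paths crossing `A_β` are
renumbered `H^β_1, …, H^β_{v_β}` from top to bottom. `P_{pq}` and `Q_{pq}` are the SW and the NE
endpoint of `H_p ∩ V_q` in this numbering. -/

/-- A horizontal NW corner in `A_α` not of the form `Q_{p, p + v_α - u_α}`, `1 ≤ p ≤ u_α`. -/
def IsEssentialHorizontalNWCorner (x : Q.Vertex) : Prop :=
  R.IsHorizontalNWCorner x ∧
    ¬ ∃ p ∈ Finset.Icc 1 (Q.uT (Q.t x.k)), ∃ q ∈ Finset.Icc 1 (Q.uS (Q.s x.k)),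
      Q.vertOffset x.k + q + Q.uT (Q.t x.k) = p + Q.vT (Q.t x.k) ∧ R.IsNEEnd p q x

/-- A vertical NW corner in `A_β` not of the form `P_{q + v_β - u_β, q}`, `1 ≤ q ≤ u_β`. -/
def IsEssentialVerticalNWCorner (x : Q.Vertex) : Prop :=
  R.IsVerticalNWCorner x ∧
    ¬ ∃ q ∈ Finset.Icc 1 (Q.uS (Q.s x.k)), ∃ p ∈ Finset.Icc 1 (Q.uT (Q.t x.k)),
      Q.horizOffset x.k + p + Q.uS (Q.s x.k) = q + Q.vS (Q.s x.k) ∧ R.IsSWEnd p q x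

/-- A horizontal SE corner in `A_α` not of the form `P_{p, p}`, `1 ≤ p ≤ u_α`
(the image of the NW notion under the rotation by 180 degrees). -/
def IsEssentialHorizontalSECorner (x : Q.Vertex) : Prop :=
  R.IsHorizontalSECorner x ∧
    ¬ ∃ p ∈ Finset.Icc 1 (Q.uT (Q.t x.k)), ∃ q ∈ Finset.Icc 1 (Q.uS (Q.s x.k)),
      Q.vertOffset x.k + q = p ∧ R.IsSWEnd p q x

/-- A vertical SE corner in `A_β` not of the form `Q_{q, q}`, `1 ≤ q ≤ u_β`
(the image of the NW notion under the rotation by 180 degrees). -/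
def IsEssentialVerticalSECorner (x : Q.Vertex) : Prop :=
  R.IsVerticalSECorner x ∧
    ¬ ∃ q ∈ Finset.Icc 1 (Q.uS (Q.s x.k)), ∃ p ∈ Finset.Icc 1 (Q.uT (Q.t x.k)),
      Q.horizOffset x.k + p = q ∧ R.IsNEEnd p q x

end RoadMap

section Concurrent

variable {T S : Type*} [DecidableEq T] [DecidableEq S] (Q : BipartiteData T S)

/-- `C` is a concurrent vertex map. -/
def IsConcurrentVertexMap (C : Finset Q.Vertex) : Prop :=
  ∃ R : Q.RoadMap, R.IsStraight ∧ R.Induces C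

/-- The relation `C <_T C'` between concurrent vertex maps `C = (P_1 <_T ⋯ <_T P_N)` and
`C' = (P'_1 <_T ⋯ <_T P'_N)`. -/
def LtT (C C' : Finset Q.Vertex) : Prop :=
  Q.IsConcurrentVertexMap C ∧ Q.IsConcurrentVertexMap C' ∧
    ∃ (N : ℕ) (P P' : Fin N → Q.Vertex),
      StrictMono P ∧ StrictMono P' ∧ (C : Set Q.Vertex) = Set.range P ∧
      (C' : Set Q.Vertex) = Set.range P' ∧
      ∃ t, P t < P' t ∧ ∀ s, t < s → P s = P' s

/-- `C ≤_T C'`. -/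
def LeT (C C' : Finset Q.Vertex) : Prop := Q.LtT C C' ∨ C = C'

end Concurrent

end BipartiteData

set_option linter.unusedSectionVars false

/-! The proof rests on two facts about a concurrent vertex map C with a straight road map.

(1) `RoadMap.not_compatible`: if x is not in C, a set containing x, all essential NW corners and all
points of C after x is not u-compatible. Suppose that x lies on no horizontal path, say between the
p-th and the next one of A_α. The u - p paths SE of x carry a chain of u - p SE corners SE of x;
these belong to C and come after x. Each lies on a vertical path, and the indices of these vertical
paths increase, so a vertical path NW of x cannot have too large an index. This makes NW corners NW
of x essential. If x lies on a vertical path, the first p horizontal paths supply p such corners NW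
of x, and together with x there are u + 1 points on a diagonal. If x lies on no path at all, the
chain may break in one of the two arrays containing x, but not in both (`Side.nwChain`).

(2) `RoadMap.exists_flip`: an essential NW corner z can be exchanged for a later point x outside C
so that C with z replaced by x is again a concurrent vertex map. Either z is a NW corner of both
paths through it, and both are flipped, after the common corners that block the way SE of z; or, up
to transposition, the vertical path runs north through z, and the piece of the horizontal path up to
the next vertical path is shifted by (1, 1), together with the pieces in its way. Essentiality
guarantees that the next vertical path exists.

By (1), the greedy algorithm rebuilds C from any subset containing the essential NW corners. By (2),
if z is missing from the subset, the algorithm cannot end with C, since it would have accepted x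
before reaching z. Flipping missing essential corners over and over raises C under `<_T` and keeps
the subset inside; it ends at a concurrent vertex map with no missing essential corner, which is the
output of the algorithm. Hence the inequality.

Transposition (`op`) exchanges horizontal and vertical paths. Rotation by 180 degrees with the
arrows reversed (`Reversal`) exchanges NW and SE and reverses `<_T`, which gives the statements on
`cMin`. Paths are extended to infinity and written as functions from diagonals to rows, so that most
geometric steps become linear integer arithmetic; the basic fact `Grid.cross_once` says that a
horizontal and a vertical path cross only once. -/

namespace BipartiteData

/-! ### Infinite lattice paths as functions of the diagonal. -/

/-- `f d` is the row of the point with column minus row equal to `d` on an infinite lattice path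
going north and east. -/
def IsStep (f : ℤ → ℤ) : Prop := ∀ d, f (d + 1) = f d ∨ f (d + 1) = f d - 1

namespace IsStep

variable {f g : ℤ → ℤ}

theorem antitone (hf : IsStep f) {d e : ℤ} (h : d ≤ e) : f e ≤ f d := by
  induction e, h using Int.leInduction with
  | base => exact le_rfl
  | succ n _ ih => rcases hf n with h | h <;> omega

/-- The column of the point on the diagonal `d` is `d + f d`; a step east raises it by one and a
step north keeps it. -/
theorem col_mono (hf : IsStep f) {d e : ℤ} (h : d ≤ e) : d + f d ≤ e + f e := by
  induction e, h using Int.leInduction with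
  | base => exact le_rfl
  | succ n _ ih => rcases hf n with h | h <;> omega

theorem pred (hf : IsStep f) (d : ℤ) : f (d - 1) = f d ∨ f (d - 1) = f d + 1 := by
  have h := hf (d - 1)
  rw [sub_add_cancel] at h
  omega

/-- Rotation by 180 degrees. It exchanges first and last meeting points, and SE and NW corners, so
the mirrored lemmas below follow from their counterparts. -/
theorem neg (hf : IsStep f) : IsStep (fun d => - f (-d)) := by
  intro d
  have h := hf.pred (-d)
  have e : -(d + 1) = -d - 1 := by ring
  simp only [e]
  omega

/-- The first meeting point of two paths after `d`. -/
theorem exists_first (hf : IsStep f) (hg : IsStep g) {d e : ℤ} (hde : d ≤ e) (h1 : g d < f d)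
    (h2 : f e ≤ g e) : ∃ c, d < c ∧ c ≤ e ∧ f c = g c ∧ ∀ x, d ≤ x → x < c → g x < f x := by
  obtain ⟨c, ⟨hc1, hc2⟩, hc3⟩ := Int.exists_least_of_bdd
    (P := fun c => d ≤ c ∧ f c ≤ g c) ⟨d, fun z hz => hz.1⟩ ⟨e, hde, h2⟩
  have hlt : ∀ x, d ≤ x → x < c → g x < f x := fun x h h' => by
    by_contra hx
    have := hc3 x ⟨h, by omega⟩
    omega
  have hdc : d < c := by
    rcases hc1.lt_or_eq with h | h
    · exact h
    · subst h; omega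
  have h := hlt (c - 1) (by omega) (by omega)
  refine ⟨c, hdc, hc3 e ⟨hde, h2⟩, ?_, hlt⟩
  -- From one diagonal to the next, `f - g` changes by at most one, so it vanishes when it ceases to
  -- be positive.
  rcases hf.pred c with h' | h' <;> rcases hg.pred c with h'' | h'' <;> omega

/-- The last meeting point of two paths before `e`. -/
theorem exists_last (hf : IsStep f) (hg : IsStep g) {d e : ℤ} (hde : d ≤ e) (h1 : g d ≤ f d)
    (h2 : f e < g e) : ∃ c, d ≤ c ∧ c < e ∧ f c = g c ∧ ∀ x, c < x → x ≤ e → f x < g x := by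
  obtain ⟨c, hc1, hc2, hc3, hc4⟩ := exists_first hf.neg hg.neg (d := -e) (e := -d)
    (by omega) (by simpa using h2) (by simpa using h1)
  refine ⟨-c, by omega, by omega, by omega, fun x hx hx' => ?_⟩
  have := hc4 (-x) (by omega) (by omega)
  simp only [neg_neg] at this
  omega

/-- A path that starts with a step north and ends with a step east has a NW corner. -/
theorem exists_nw (hf : IsStep f) {d e : ℤ} (hde : d + 1 < e) (h1 : f (d + 1) = f d - 1)
    (h2 : f (e - 1) = f e) : ∃ c, d < c ∧ c < e ∧ f (c - 1) = f c + 1 ∧ f (c + 1) = f c := by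
  -- The corner is where the first step east after `d` begins; the step before it goes north, by
  -- minimality or by `h1`.
  obtain ⟨c, ⟨hc1, hc2⟩, hc3⟩ := Int.exists_least_of_bdd
    (P := fun c => d < c ∧ f (c + 1) = f c) ⟨d, fun z hz => hz.1.le⟩
    ⟨e - 1, by omega, by rw [sub_add_cancel, h2]⟩
  refine ⟨c, hc1, ?_, ?_, hc2⟩
  · have := hc3 (e - 1) ⟨by omega, by rw [sub_add_cancel, h2]⟩
    omega
  · by_contra h
    have h' : f (c - 1) = f c := by rcases hf.pred c with h' | h' <;> omega
    by_cases hdc : d < c - 1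
    · have := hc3 (c - 1) ⟨hdc, by rw [sub_add_cancel, h']⟩
      omega
    · have : c = d + 1 := by omega
      subst this
      rw [add_sub_cancel_right] at h'
      omega

/-- A path from a common point to a common point that stays strictly NW of another one in between
has a NW corner in between. -/
theorem exists_nw_of_bigon (hf : IsStep f) (hg : IsStep g) {d e : ℤ} (hde : d + 1 < e)
    (h1 : f d = g d) (h2 : f e = g e) (h : ∀ x, d < x → x < e → f x < g x) :
    ∃ c, d < c ∧ c < e ∧ f (c - 1) = f c + 1 ∧ f (c + 1) = f c := by
  apply exists_nw hf hde
  · have := h (d + 1) (by omega) (by omega)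
    rcases hf d with h' | h' <;> rcases hg d with h'' | h'' <;> omega
  · have := h (e - 1) (by omega) (by omega)
    rcases hf.pred e with h' | h' <;> rcases hg.pred e with h'' | h'' <;> omega

/-- A path that is SE of the point `(i, d + i)` and ends in a row not below `i` has a SE corner
SE of that point, in the column in which the path leaves the row `i + 1`. -/
theorem exists_se_corner (hf : IsStep f) {lo hi A B i d : ℤ}
    (hB : ∀ d, hi < d + f d → f d = B) (hfA : ∀ d, f d ≤ A) (hBf : ∀ d, B ≤ f d)
    (h1 : i < f d) (h2 : B ≤ i) (h3 : lo ≤ d + i) :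
    ∃ e, f (e - 1) = f e ∧ f (e + 1) = f e - 1 ∧ i < f e ∧ d + i < e + f e ∧ e + f e ≤ hi ∧
      ∀ x, i < f x → x + f x ≤ e + f e := by
  have hend : ∀ x, i < f x → x ≤ hi - B := fun x hx => by
    by_contra hx'
    have := hB x (by have := hBf x; omega)
    omega
  -- `c` is the last diagonal on which the path is still below the row `i`.
  obtain ⟨c, hc1, hc2⟩ := Int.exists_greatest_of_bdd (P := fun c => i < f c) ⟨_, hend⟩ ⟨d, h1⟩
  have hc3 : f (c + 1) = f c - 1 ∧ f c = i + 1 := by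
    have h : ¬ i < f (c + 1) := fun h => by have := hc2 _ h; omega
    rcases hf c with h' | h' <;> omega
  have hdc := hf.antitone (hc2 d h1)
  have hdc' := hc2 d h1
  have hstart : ∃ x, x + f x < c + f c := ⟨lo - A - 1, by have := hfA (lo - A - 1); omega⟩
  have hbd : ∀ x, x + f x < c + f c → x ≤ c := fun x hx => by
    by_contra h
    have := hf.col_mono (show c ≤ x by omega)
    omega
  -- The last point in an earlier column: the corner `x + 1` is the lowest point of the vertical run
  -- through `c`.
  obtain ⟨x, hx1, hx2⟩ := Int.exists_greatest_of_bdd ⟨c, hbd⟩ hstart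
  have hxc : x < c := by
    rcases (hbd x hx1).lt_or_eq with h | h
    · exact h
    · subst h; omega
  have hcol : ∀ y, x < y → y ≤ c → y + f y = c + f c := fun y h h' => by
    have h1 := hf.col_mono h'
    have h2 : ¬ y + f y < c + f c := fun hy => by have := hx2 y hy; omega
    omega
  have hx3 := hcol (x + 1) (by omega) (by omega)
  have hx4 : f (x + 1 + 1) = f (x + 1) - 1 := by
    rcases (show x + 1 ≤ c by omega).lt_or_eq with h | h
    · have := hcol (x + 1 + 1) (by omega) (by omega)
      omega
    · rw [h]; exact hc3.1
  refine ⟨x + 1, ?_, hx4, ?_, by omega, ?_, fun y hy => ?_⟩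
  · rw [add_sub_cancel_right]
    rcases hf x with h | h <;> omega
  · have := hf.antitone (show x + 1 ≤ c by omega)
    omega
  · by_contra h
    have h1 := hB c (by omega)
    have := hBf (c + 1)
    omega
  · have := hf.col_mono (hc2 y hy)
    omega

/-- A path that is NW of the point `(i, d + i)` and starts in a row not above `i` has a NW corner
NW of that point, in the column in which the path leaves the row `i`. -/
theorem exists_nw_corner (hf : IsStep f) {lo hi A B i d : ℤ} (hA : ∀ d, d + f d < lo → f d = A)
    (hfA : ∀ d, f d ≤ A) (hBf : ∀ d, B ≤ f d)
    (h1 : f d < i) (h2 : i ≤ A) (h3 : d + i ≤ hi) :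
    ∃ e, f (e - 1) = f e + 1 ∧ f (e + 1) = f e ∧ f e < i ∧ e + f e < d + i ∧ lo ≤ e + f e ∧
      ∀ x, f x < i → e + f e ≤ x + f x := by
  obtain ⟨e, h1, h2, h3, h4, h5, h6⟩ := exists_se_corner hf.neg (lo := -hi) (hi := -lo) (A := -B)
    (B := -A) (i := -i) (d := -d)
    (fun d hd => by rw [hA (-d) (by omega)])
    (fun d => by have := hBf (-d); omega) (fun d => by have := hfA (-d); omega)
    (by simpa using h1) (by omega) (by omega)
  refine ⟨-e, ?_, ?_, by omega, by omega, by omega, fun x hx => ?_⟩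
  · rw [show -e - 1 = -(e + 1) by ring]; omega
  · rw [show -e + 1 = -(e - 1) by ring]; omega
  · have := h6 (-x) (by simpa using hx)
    simp only [neg_neg] at this
    omega

end IsStep

/-! ### Crossings of horizontal and vertical paths in one array. -/

/-- The horizontal paths `ρ p`, `1 ≤ p ≤ u`, and the vertical paths `ν n`, `1 ≤ n ≤ v`, crossing an
`a × b` array, extended to infinite paths, for a straight road map. -/
structure Grid (a b u v : ℕ) (ρ ν : ℕ → ℤ → ℤ) : Prop where
  stepH : ∀ p, 1 ≤ p → p ≤ u → IsStep (ρ p)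
  stepV : ∀ n, 1 ≤ n → n ≤ v → IsStep (ν n)
  lt_H : ∀ p p', 1 ≤ p → p < p' → p' ≤ u → ∀ d, ρ p d < ρ p' d
  lt_V : ∀ n n', 1 ≤ n → n < n' → n' ≤ v → ∀ d, ν n d < ν n' d
  row_ge : ∀ p, 1 ≤ p → p ≤ u → ∀ d, (p : ℤ) ≤ ρ p d
  row_le : ∀ p, 1 ≤ p → p ≤ u → ∀ d, ρ p d ≤ a - u + p
  left : ∀ p, 1 ≤ p → p ≤ u → ∀ d, d + ρ p d < 1 → ρ p d = a - u + p
  right : ∀ p, 1 ≤ p → p ≤ u → ∀ d, b < d + ρ p d → ρ p d = p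
  col_pos : ∀ n, 1 ≤ n → n ≤ v → ∀ d, 1 ≤ d + ν n d
  col_le : ∀ n, 1 ≤ n → n ≤ v → ∀ d, d + ν n d ≤ b
  -- Straightness concerns only corners whose two neighbours on the path lie in the array; the
  -- column bounds, and the row bounds for vertical paths, ensure this.
  nwH : ∀ p, 1 ≤ p → p ≤ u → ∀ d, ρ p (d - 1) = ρ p d + 1 → ρ p (d + 1) = ρ p d →
    1 ≤ d + ρ p d → d + ρ p d < b → ∃ n, 1 ≤ n ∧ n ≤ v ∧ ν n d = ρ p d
  seH : ∀ p, 1 ≤ p → p ≤ u → ∀ d, ρ p (d - 1) = ρ p d → ρ p (d + 1) = ρ p d - 1 →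
    1 < d + ρ p d → d + ρ p d ≤ b → ∃ n, 1 ≤ n ∧ n ≤ v ∧ ν n d = ρ p d
  nwV : ∀ n, 1 ≤ n → n ≤ v → ∀ d, ν n (d - 1) = ν n d + 1 → ν n (d + 1) = ν n d →
    1 ≤ ν n d → ν n d < a → ∃ p, 1 ≤ p ∧ p ≤ u ∧ ρ p d = ν n d
  seV : ∀ n, 1 ≤ n → n ≤ v → ∀ d, ν n (d - 1) = ν n d → ν n (d + 1) = ν n d - 1 →
    1 < ν n d → ν n d ≤ a → ∃ p, 1 ≤ p ∧ p ≤ u ∧ ρ p d = ν n d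

namespace Grid

variable {a b u v : ℕ} {ρ ν : ℕ → ℤ → ℤ} (G : Grid a b u v ρ ν)
include G

theorem lt_of_ν_lt {n n' : ℕ} {d : ℤ} (hn : n ≤ v) (hn' : 1 ≤ n') (h : ν n d < ν n' d) :
    n < n' := by
  by_contra hle
  rcases (not_lt.1 hle).lt_or_eq with h' | h'
  · exact absurd (G.lt_V n' n hn' h' hn d) (by omega)
  · subst h'; omega

theorem lt_of_ρ_lt {p p' : ℕ} {d : ℤ} (hp : p ≤ u) (hp' : 1 ≤ p') (h : ρ p d < ρ p' d) :
    p < p' := by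
  by_contra hle
  rcases (not_lt.1 hle).lt_or_eq with h' | h'
  · exact absurd (G.lt_H p' p hp' h' hp d) (by omega)
  · subst h'; omega

theorem row_bounds {p : ℕ} (h : 1 ≤ p) (h' : p ≤ u) (d : ℤ) : 1 ≤ ρ p d ∧ ρ p d ≤ a := by
  have := G.row_ge p h h' d
  have := G.row_le p h h' d
  omega

/-- On a diagonal `d ≤ -a`, a point in a positive column lies below the row `a`. -/
theorem below_start {p n : ℕ} (hp : 1 ≤ p) (hp' : p ≤ u) (hn : 1 ≤ n) (hn' : n ≤ v) {d : ℤ}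
    (hd : d ≤ -a) : ρ p d < ν n d := by
  have := G.row_bounds hp hp' d
  have := G.col_pos n hn hn' d
  omega

theorem above_end {p n : ℕ} (hp : 1 ≤ p) (hp' : p ≤ u) (hn : 1 ≤ n) (hn' : n ≤ v) {d : ℤ}
    (hd : (b : ℤ) ≤ d) : ν n d < ρ p d := by
  have := G.row_bounds hp hp' d
  have := G.col_le n hn hn' d
  omega

/-- A horizontal and a vertical path meet in a connected set, after which the vertical path stays NW
of the horizontal one, and before which it stays SE of it. -/
theorem cross_once : ∀ s : ℕ, ∀ p n : ℕ, p + n = s → 1 ≤ p → p ≤ u → 1 ≤ n → n ≤ v →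
    (∀ d e, d ≤ e → ν n d < ρ p d → ν n e < ρ p e) ∧
      ∀ d e, d ≤ e → ρ p e < ν n e → ρ p d < ν n d := by
  intro s
  -- Each claim for `(p, n)` is reduced to the other claim for a pair in which one index is smaller.
  induction s using Nat.strong_induction_on with
  | _ s ih =>
  intro p n hs hp hp' hn hn'
  have hfH := G.stepH p hp hp'
  have hfV := G.stepV n hn hn'
  constructor
  · intro d e hde h
    by_contra hcon
    obtain ⟨d₁, h11, h12, h13, h14⟩ := hfV.exists_last hfH (d := min d (-a)) (e := d)
      (by omega) (G.below_start hp hp' hn hn' (by omega)).le h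
    obtain ⟨d₂, h21, h22, h23, h24⟩ := hfH.exists_first hfV hde h (by omega)
    obtain ⟨c, hc1, hc2, hc3, hc4⟩ := hfV.exists_nw_of_bigon hfH (d := d₁) (e := d₂) (by omega)
      h13 h23.symm (fun x hx hx' => by
        by_cases hxd : x ≤ d
        · exact h14 x hx hxd
        · exact h24 x (by omega) hx')
    have hb1 := G.row_bounds hp hp' d₁
    have hb2 := G.row_bounds hp hp' d₂
    have hcr : ν n c < ρ p c := by
      by_cases hxd : c ≤ d
      · exact h14 c hc1 hxd
      · exact h24 c (by omega) hc2
    have ha1 := hfV.antitone (show c ≤ d₂ by omega)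
    have ha2 := hfV.antitone (show d₁ ≤ c - 1 by omega)
    -- A NW corner of the upper side `ν n` of the bigon lies on some `ρ p'` with `p' < p`. This path
    -- is on `ν n` at `c` but strictly NW of it at `d₂`, against the second claim for `(p', n)`.
    obtain ⟨p', hp1, hp2, hp3⟩ := G.nwV n hn hn' c hc3 hc4 (by omega) (by omega)
    have hlt : p' < p := G.lt_of_ρ_lt hp2 hp (d := c) (by omega)
    have hlt' := G.lt_H p' p hp1 hlt hp' d₂
    have := (ih (p' + n) (by omega) p' n rfl hp1 hp2 hn hn').2 c d₂ (by omega) (by omega)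
    omega
  · intro d e hde h
    by_contra hcon
    obtain ⟨d₁, h11, h12, h13, h14⟩ := hfH.exists_last hfV hde (by omega) h
    obtain ⟨d₂, h21, h22, h23, h24⟩ := hfV.exists_first hfH (d := e) (e := max e b)
      (by omega) h (G.above_end hp hp' hn hn' (by omega)).le
    obtain ⟨c, hc1, hc2, hc3, hc4⟩ := hfH.exists_nw_of_bigon hfV (d := d₁) (e := d₂) (by omega)
      h13 h23.symm (fun x hx hx' => by
        by_cases hxd : x ≤ e
        · exact h14 x hx hxd
        · exact h24 x (by omega) hx')
    have hcr : ρ p c < ν n c := by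
      by_cases hxd : c ≤ e
      · exact h14 c hc1 hxd
      · exact h24 c (by omega) hc2
    have hb1 := G.col_pos n hn hn' d₁
    have hb2 := G.col_le n hn hn' c
    have ha1 := hfH.col_mono (show d₁ ≤ c by omega)
    -- Now `ρ p` is the upper side; the path `ν n'` through its corner is strictly NW of `ρ p` at
    -- `d₁` and on it at `c`, against the first claim for `(p, n')`.
    obtain ⟨n', hn1, hn2, hn3⟩ := G.nwH p hp hp' c hc3 hc4 (by omega) (by omega)
    have hlt : n' < n := G.lt_of_ν_lt hn2 hn (d := c) (by omega)
    have hlt' := G.lt_V n' n hn1 hlt hn' d₁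
    have := (ih (p + n') (by omega) p n' rfl hp hp' hn1 hn2).1 d₁ c (by omega) (by omega)
    omega

theorem above_of_above {p n : ℕ} (hp : 1 ≤ p) (hp' : p ≤ u) (hn : 1 ≤ n) (hn' : n ≤ v) {d e : ℤ}
    (hde : d ≤ e) (h : ν n d < ρ p d) : ν n e < ρ p e :=
  (G.cross_once _ p n rfl hp hp' hn hn').1 d e hde h

/-- By straightness a vertical path passes through the corner, so a chain of such corners advances
in the vertical indices as well as in the horizontal ones. -/
theorem exists_seH {p : ℕ} (hp : 1 ≤ p) (hp' : p ≤ u) {i d : ℤ} (h1 : i < ρ p d)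
    (h2 : (p : ℤ) ≤ i) (h3 : 1 ≤ d + i) :
    ∃ e, ρ p (e - 1) = ρ p e ∧ ρ p (e + 1) = ρ p e - 1 ∧ i < ρ p e ∧ d + i < e + ρ p e ∧
      e + ρ p e ≤ b ∧ ∃ n, 1 ≤ n ∧ n ≤ v ∧ ν n e = ρ p e := by
  obtain ⟨e, h4, h5, h6, h7, h8, -⟩ := (G.stepH p hp hp').exists_se_corner
    (G.right p hp hp') (G.row_le p hp hp') (G.row_ge p hp hp') h1 h2 h3
  exact ⟨e, h4, h5, h6, h7, h8, G.seH p hp hp' e h4 h5 (by omega) h8⟩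

theorem exists_nwH {p : ℕ} (hp : 1 ≤ p) (hp' : p ≤ u) {i d : ℤ} (h1 : ρ p d < i)
    (h2 : i ≤ a - u + p) (h3 : d + i ≤ b) :
    ∃ e, ρ p (e - 1) = ρ p e + 1 ∧ ρ p (e + 1) = ρ p e ∧ ρ p e < i ∧ e + ρ p e < d + i ∧
      1 ≤ e + ρ p e ∧ (∀ x, ρ p x < i → e + ρ p e ≤ x + ρ p x) ∧
      ∃ n, 1 ≤ n ∧ n ≤ v ∧ ν n e = ρ p e := by
  obtain ⟨e, h4, h5, h6, h7, h8, h9⟩ := (G.stepH p hp hp').exists_nw_corner (G.left p hp hp')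
    (G.row_le p hp hp') (G.row_ge p hp hp') h1 h2 h3
  exact ⟨e, h4, h5, h6, h7, h8, h9, G.nwH p hp hp' e h4 h5 h8 (by omega)⟩

end Grid
end BipartiteData

/-! ### Shifting pieces of horizontal paths by (1, 1). -/

namespace BipartiteData

/-- The horizontal segment consisting of the points `(i, j)` with `j₀ ≤ j < j₁`. -/
def segment (g : ℤ × ℤ × ℤ) : Set (ℤ × ℤ) := {c | c.1 = g.1 ∧ g.2.1 ≤ c.2 ∧ c.2 < g.2.2}

theorem mem_segment {g : ℤ × ℤ × ℤ} {c : ℤ × ℤ} :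
    c ∈ segment g ↔ c.1 = g.1 ∧ g.2.1 ≤ c.2 ∧ c.2 < g.2.2 := Iff.rfl

/-- The infinite path `f` passes through `c`. -/
def Through (f : ℤ → ℤ) (c : ℤ × ℤ) : Prop := f (c.2 - c.1) = c.1

/-- One of the paths `f 1, …, f u` passes through `c`. -/
def SomeThrough (u : ℕ) (f : ℕ → ℤ → ℤ) (c : ℤ × ℤ) : Prop :=
  ∃ p, 1 ≤ p ∧ p ≤ u ∧ Through (f p) c

/-- The path `ρ m` turns east in the row `i` at `e` on `ν n` and remains in this row until it meets
`ν (n + 1)` at `w`. -/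
structure Slot (u v : ℕ) (ρ ν : ℕ → ℤ → ℤ) (m n : ℕ) (i e w : ℤ) : Prop where
  one_le : 1 ≤ m
  le : m ≤ u
  one_le' : 1 ≤ n
  lt : n + 1 ≤ v
  lt_end : e < w
  south : ρ m (e - 1) = i + 1
  flat : ∀ d, e ≤ d → d ≤ w → ρ m d = i
  start : ν n e = i
  finish : ν (n + 1) w = i
  below : ∀ d, e ≤ d → d < w → i < ν (n + 1) d

namespace Grid

variable {a b u v : ℕ} {ρ ν : ℕ → ℤ → ℤ} (G : Grid a b u v ρ ν)
include G

theorem eq_succ_of_ρ {p p' : ℕ} {d : ℤ} (hp : 1 ≤ p) (hp' : p ≤ u) (h1 : 1 ≤ p') (h2 : p' ≤ u)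
    (h : ρ p' d = ρ p d + 1) : p' = p + 1 := by
  have h3 : p < p' := G.lt_of_ρ_lt hp' h1 (d := d) (by omega)
  by_contra h4
  have h5 := G.lt_H p (p + 1) hp (by omega) (by omega) d
  have h6 := G.lt_H (p + 1) p' (by omega) (by omega) h2 d
  omega

/-- If `ρ m` left the row before meeting `ν (n + 1)`, it would have a SE corner there, and the
vertical path through that corner would lie strictly between `ν n` and `ν (n + 1)`. -/
theorem exists_slot {m n : ℕ} {i e d : ℤ} (hm : 1 ≤ m) (hm' : m ≤ u) (hn : 1 ≤ n) (hn' : n + 1 ≤ v)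
    (hed : e ≤ d) (south : ρ m (e - 1) = i + 1) (flat : ∀ x, e ≤ x → x ≤ d + 1 → ρ m x = i)
    (start : ν n e = i) (hd : i < ν (n + 1) d) (hd' : ν n (d + 1) < i) :
    ∃ w, d < w ∧ Slot u v ρ ν m n i e w := by
  have hfm := G.stepH m hm hm'
  have hfn := G.stepV (n + 1) (by omega) hn'
  have hρd := flat d hed (by omega)
  have hρd' := flat (d + 1) (by omega) le_rfl
  obtain ⟨w, h1, h2, h3, h4⟩ := hfn.exists_first hfm (d := d) (e := max d b) (by omega)
    (by omega) (G.above_end hm hm' (by omega) hn' (by omega)).le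
  have hc1 := G.col_pos n hn (by omega) e
  have hc2 := G.col_le (n + 1) (by omega) hn' w
  have key : ∀ x, d + 1 ≤ x → x ≤ w → ρ m x = i := by
    intro x hx
    induction x, hx using Int.leInduction with
    | base => intro; exact hρd'
    | succ y hy ih =>
      intro hyw
      have ihy := ih (by omega)
      rcases hfm y with h | h
      · omega
      · exfalso
        have hprev : ρ m (y - 1) = i := by
          have hle := hfm.antitone (show d ≤ y - 1 by omega)
          have hge := hfm.antitone (show y - 1 ≤ y by omega)
          omega
        have hcw := hfm.antitone (show y + 1 ≤ w by omega)
        have hcc := hfn.col_mono (show y ≤ w by omega)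
        have h4y := h4 y (by omega) (by omega)
        obtain ⟨k, hk1, hk2, hk3⟩ := G.seH m hm hm' y (by omega) h (by omega) (by omega)
        have h5 := G.above_of_above hm hm' hn (by omega) hy (by omega)
        have h6 : n < k := G.lt_of_ν_lt (by omega) hk1 (d := y) (by omega)
        have h7 : k < n + 1 := G.lt_of_ν_lt hk2 (by omega) (d := y) (by omega)
        omega
  have hflat : ∀ x, e ≤ x → x ≤ w → ρ m x = i := fun x hx hx' => by
    by_cases h : x ≤ d + 1
    · exact flat x hx h
    · exact key x (by omega) hx'
  refine ⟨w, h1, hm, hm', hn, hn', by omega, south, hflat, start, ?_, ?_⟩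
  · rw [h3]; exact hflat w (by omega) le_rfl
  · intro x hx hxw
    by_cases h : x ≤ d
    · have := hfn.antitone h
      omega
    · have := h4 x (by omega) hxw
      have := hflat x hx hxw.le
      omega

/-- Coming from the west, `ν n` would be NW of `ρ m` just before meeting it, and by `cross_once` it
could not come back. -/
theorem _root_.BipartiteData.Slot.south_V {m n : ℕ} {i e w : ℤ}
    (s : Slot u v ρ ν m n i e w) : ν n (e - 1) = i + 1 := by
  have h1 := s.start
  have h2 := s.flat e le_rfl s.lt_end.le
  have hn : n ≤ v := by have := s.lt; omega
  rcases (G.stepV n s.one_le' hn).pred e with h | h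
  · have := G.above_of_above s.one_le s.le s.one_le' hn (d := e - 1) (e := e) (by omega)
      (by have := s.south; omega)
    omega
  · omega

theorem _root_.BipartiteData.Slot.south_finish {m n : ℕ} {i e w : ℤ}
    (s : Slot u v ρ ν m n i e w) : ν (n + 1) (w - 1) = i + 1 := by
  have h1 := s.finish
  have h2 := s.below (w - 1) (by have := s.lt_end; omega) (by omega)
  rcases (G.stepV (n + 1) (by omega) s.lt).pred w with h | h <;> omega

/-- On these diagonals `ν n` is in a row at most `i` and `ν (n + 1)` in a row at least `i + 1`. So
`ν (n + 1)` is the only vertical path that can meet the shifted segment. -/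
theorem _root_.BipartiteData.Slot.eq_of_below {m n k : ℕ} {i e w d : ℤ}
    (s : Slot u v ρ ν m n i e w) (hd : e ≤ d) (hd' : d < w) (hk : 1 ≤ k) (hk' : k ≤ v)
    (h : ν k d = i + 1) : k = n + 1 := by
  have hn : n ≤ v := by have := s.lt; omega
  have h1 := (G.stepV n s.one_le' hn).antitone hd
  have h2 := s.start
  have h3 : n < k := G.lt_of_ν_lt hn hk (d := d) (by omega)
  by_contra h4
  have h5 := G.lt_V (n + 1) k (by omega) (by omega) hk' d
  have h6 := s.below d hd hd'
  omega

/-- The slot following a slot whose lower right end lies on the next horizontal path. -/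
theorem _root_.BipartiteData.Slot.next {m n : ℕ} {i e w : ℤ}
    (s : Slot u v ρ ν m n i e w) (hnv : n + u < m + v) (hm : m < u)
    (hy : ρ (m + 1) (w - 1) = i + 1) :
    ∃ e' w', e ≤ e' ∧ w ≤ w' ∧ Slot u v ρ ν (m + 1) (n + 1) (i + 1) e' w' ∧
      ∀ d, ρ (m + 1) d ≤ i + 1 → e' ≤ d := by
  have hf := G.stepH (m + 1) (by omega) (by omega)
  have hlt := s.lt_end
  have hs := s.south
  -- The inequality `hnv` leaves room for the path `ν (n + 2)` that ends the new slot.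
  have hnv' : n + 2 ≤ v := by omega
  have hbd : ∀ d, ρ (m + 1) d ≤ i + 1 → e ≤ d := fun d hd => by
    by_contra h
    have h1 := hf.antitone (show d ≤ e - 1 by omega)
    have h2 := G.lt_H m (m + 1) s.one_le (by omega) (by omega) (e - 1)
    omega
  -- At `e'` the path `ρ (m + 1)` enters the row `i + 1` from the south and turns east; the vertical
  -- path through this NW corner can only be `ν (n + 1)`.
  obtain ⟨e', he1, he2⟩ := Int.exists_least_of_bdd (P := fun d => ρ (m + 1) d ≤ i + 1)
    ⟨e, hbd⟩ ⟨w - 1, hy.le⟩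
  have hee' := hbd e' he1
  have he'w := he2 (w - 1) hy.le
  have hflat : ∀ x, e' ≤ x → x ≤ w → ρ (m + 1) x = i + 1 := fun x hx hx' => by
    have h1 := hf.antitone hx
    have h2 := G.lt_H m (m + 1) s.one_le (by omega) (by omega) x
    have h3 := s.flat x (by omega) hx'
    omega
  have he'0 := hflat e' le_rfl (by omega)
  have he'1 := hflat (e' + 1) (by omega) (by omega)
  have hsouth : ρ (m + 1) (e' - 1) = i + 1 + 1 := by
    rcases hf.pred e' with h | h
    · have := he2 (e' - 1) (by omega)
      omega
    · omega
  have hfin := s.south_finish G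
  have hlt2 := G.lt_V (n + 1) (n + 2) (by omega) (by omega) hnv' (w - 1)
  have hcol := G.col_le (n + 2) (by omega) hnv' (w - 1)
  have hcol' := G.col_pos n s.one_le' (by omega) e
  have hst := s.start
  obtain ⟨k, hk1, hk2, hk3⟩ := G.nwH (m + 1) (by omega) (by omega) e' (by omega) (by omega)
    (by omega) (by omega)
  obtain rfl := s.eq_of_below G hee' (by omega) hk1 hk2 (by omega)
  have hfinish := s.finish
  obtain ⟨w', hw', s'⟩ := G.exists_slot (m := m + 1) (n := n + 1) (i := i + 1) (e := e')
    (d := w - 1) (by omega) (by omega) (by omega) (by omega) (by omega) hsouth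
    (fun x hx hx' => hflat x hx (by omega)) (by omega)
    (by show i + 1 < ν (n + 2) (w - 1); omega) (by rw [sub_add_cancel]; omega)
  exact ⟨e', w', hee', by omega, s', he2⟩

/-- The data of a family `g` of segments of the paths `ρ k`, `m ≤ k ≤ u`, whose shift by `(1, 1)`
replaces the first segment by the point `x`, as far as the points on vertical paths are
concerned. -/
def _root_.BipartiteData.IsShift (a u v : ℕ) (ρ ν : ℕ → ℤ → ℤ) (m : ℕ) (i e : ℤ)
    (g : ℕ → ℤ × ℤ × ℤ) (x : ℤ × ℤ) : Prop :=
  (∀ k, m < k → k ≤ u → g k = (0, 0, 0) ∨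
    ∃ n' i' e' w', Slot u v ρ ν k n' i' e' w' ∧ g k = (i', e' + i', w' + i')) ∧
  -- A piece pushed onto another path lands on points which that path gives up, so the shifted paths
  -- stay disjoint.
  (∀ k l c, m ≤ k → k ≤ u → 1 ≤ l → l ≤ u → c ∈ segment (g k) →
    Through (ρ l) (c.1 + 1, c.2 + 1) → (c.1 + 1, c.2 + 1) ∈ segment (g l)) ∧
  SomeThrough v ν x ∧ ¬ SomeThrough u ρ x ∧ x.1 ≤ a ∧ i < x.1 ∧ e + i < x.2 ∧
  -- On the vertical paths, the points gained are the points lost, except that those of the first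
  -- segment are traded for `x`.
  ∀ c, SomeThrough v ν c →
    ((∃ k, m ≤ k ∧ k ≤ u ∧ (c.1 - 1, c.2 - 1) ∈ segment (g k)) ↔
      (∃ k, m < k ∧ k ≤ u ∧ c ∈ segment (g k)) ∨ c = x)

/-- If the lower right end is free, the whole shifted segment is free: a horizontal path through it
would be `ρ (m + 1)`, running along the row `i + 1` to that end. So one segment suffices. -/
theorem isShift_of_last {m n : ℕ} {i e w : ℤ} (s : Slot u v ρ ν m n i e w)
    (hy : ¬ (m < u ∧ ρ (m + 1) (w - 1) = i + 1)) :
    IsShift a u v ρ ν m i e (fun k => if k = m then (i, e + i, w + i) else (0, 0, 0))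
      (i + 1, w + i) := by
  have hlt := s.lt_end
  have hfin := s.south_finish G
  have hs := s.south
  have hb := G.row_bounds s.one_le s.le (e - 1)
  have hb' := G.row_bounds s.one_le s.le e
  have hfe := s.flat e le_rfl (by omega)
  have hnot : ∀ d, e ≤ d → d < w → ∀ l, 1 ≤ l → l ≤ u → ρ l d ≠ i + 1 := by
    intro d hd hd' l hl hl' h
    have h1 := s.flat d hd hd'.le
    obtain rfl := G.eq_succ_of_ρ s.one_le s.le hl hl' (d := d) (by omega)
    apply hy
    refine ⟨by omega, ?_⟩
    have h2 := (G.stepH _ hl hl').antitone (show d ≤ w - 1 by omega)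
    have h3 := G.lt_H m (m + 1) s.one_le (by omega) hl' (w - 1)
    have h4 := s.flat (w - 1) (by omega) (by omega)
    omega
  refine ⟨fun k hk hk' => Or.inl (if_neg (by omega)), ?_, ?_, ?_, by simp only; omega,
    by simp only; omega, by simp only; omega, ?_⟩
  · intro k l c hk hk' hl hl' hc hthr
    by_cases hkm : k = m
    · subst hkm
      simp only [if_true, mem_segment] at hc
      simp only [Through] at hthr
      exact absurd hthr (by
        rw [show c.2 + 1 - (c.1 + 1) = c.2 - c.1 by ring, hc.1]
        exact hnot _ (by omega) (by omega) l hl hl')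
    · simp only [if_neg hkm, mem_segment] at hc
      omega
  · refine ⟨n + 1, by omega, s.lt, ?_⟩
    simp only [Through]
    rw [show w + i - (i + 1) = w - 1 by ring, hfin]
  · rintro ⟨p, hp, hp', h⟩
    simp only [Through] at h
    rw [show w + i - (i + 1) = w - 1 by ring] at h
    exact hnot (w - 1) (by omega) (by omega) p hp hp' h
  · rintro ⟨r, j⟩ ⟨k, hk, hk', hthr⟩
    simp only [Through] at hthr
    have hnone : ¬ ∃ k, m < k ∧ k ≤ u ∧
        (r, j) ∈ segment (if k = m then (i, e + i, w + i) else (0, 0, 0)) := by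
      rintro ⟨k, h, -, h'⟩
      rw [if_neg (by omega)] at h'
      simp only [mem_segment] at h'
      omega
    constructor
    · rintro ⟨l, hl, hl', hc⟩
      right
      by_cases hlm : l = m
      · subst hlm
        simp only [if_true, mem_segment] at hc
        obtain rfl : r = i + 1 := by omega
        by_cases hj : j = w + i
        · rw [hj]
        · exfalso
          obtain rfl := s.eq_of_below G (d := j - (i + 1)) (by omega) (by omega) hk hk' hthr
          have hf := G.stepV (n + 1) (by omega) s.lt
          have h1 : ν (n + 1) (w - 1 - 1) = i + 1 := by
            have h2 := hf.antitone (show j - (i + 1) ≤ w - 1 - 1 by omega)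
            have h3 := hf.antitone (show w - 1 - 1 ≤ w - 1 by omega)
            omega
          -- If `ν (n + 1)` came to the lower right end from the west, it would have a SE corner
          -- there, and a horizontal path would pass through that point.
          obtain ⟨p, hp, hp', hp3⟩ := G.seV (n + 1) (by omega) s.lt (w - 1) (by omega)
            (by rw [sub_add_cancel, hfin, s.finish]; ring) (by omega) (by omega)
          exact hnot (w - 1) (by omega) (by omega) p hp hp' (by omega)
      · simp only [if_neg hlm, mem_segment] at hc
        omega
    · rintro (h | h)
      · exact absurd h hnone
      · obtain ⟨rfl, rfl⟩ := Prod.mk.inj h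
        refine ⟨m, le_rfl, s.le, ?_⟩
        simp only [if_true, mem_segment]
        omega

/-- Shifting the segment of a slot, and those of the slots following it, by `(1, 1)`. -/
theorem exists_isShift : ∀ t m n : ℕ, ∀ i e w : ℤ, m + t = u → Slot u v ρ ν m n i e w →
    n + u < m + v → ∃ (g : ℕ → ℤ × ℤ × ℤ) (x : ℤ × ℤ), g m = (i, e + i, w + i) ∧
      IsShift a u v ρ ν m i e g x := by
  intro t
  induction t with
  | zero =>
    intro m n i e w hmt s _
    exact ⟨_, _, if_pos rfl, G.isShift_of_last s (by omega)⟩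
  | succ t ih =>
    intro m n i e w hmt s hnv
    by_cases hy : m < u ∧ ρ (m + 1) (w - 1) = i + 1
    swap
    · exact ⟨_, _, if_pos rfl, G.isShift_of_last s hy⟩
    -- The lower right end is occupied by `ρ (m + 1)`, whose own slot has to be shifted too; the
    -- induction hypothesis handles that slot and its successors.
    obtain ⟨e', w', hee', hww', s', hleast⟩ := s.next G hnv hy.1 hy.2
    obtain ⟨g', x, hg', h1, h2, h3, h4, h5, h6, h7, h8⟩ :=
      ih (m + 1) (n + 1) (i + 1) e' w' (by omega) s' (by omega)
    have hgm : Function.update g' m (i, e + i, w + i) m = (i, e + i, w + i) :=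
      Function.update_self ..
    have hgk : ∀ k, m < k → Function.update g' m (i, e + i, w + i) k = g' k := fun k hk =>
      Function.update_of_ne (by omega) ..
    have hlt := s.lt_end
    have hlt' := s'.lt_end
    refine ⟨Function.update g' m (i, e + i, w + i), x, hgm, ?_, ?_, h3, h4, h5, by omega, by omega,
      ?_⟩
    · intro k hk hk'
      rw [hgk k hk]
      by_cases hkm : k = m + 1
      · subst hkm
        exact Or.inr ⟨_, _, _, _, s', hg'⟩
      · exact h1 k (by omega) hk'
    · intro k l c hk hk' hl hl' hc hthr
      simp only [Through, show c.2 + 1 - (c.1 + 1) = c.2 - c.1 by ring] at hthr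
      by_cases hkm : k = m
      · subst hkm
        rw [hgm] at hc
        simp only [mem_segment] at hc
        have hρ := s.flat (c.2 - c.1) (by omega) (by omega)
        obtain rfl := G.eq_succ_of_ρ s.one_le s.le hl hl' (d := c.2 - c.1) (by omega)
        rw [hgk _ (by omega), hg']
        have := hleast (c.2 - c.1) (by omega)
        simp only [mem_segment]
        omega
      -- The pushed point lies SE of `ρ k`, so only a path of larger index passes through it; in
      -- particular `l ≠ m`, and the update does not matter.
      · have hkl : k < l := by
          rw [hgk k (by omega)] at hc
          have hslot : ∃ n' i' e' w', Slot u v ρ ν k n' i' e' w' ∧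
              g' k = (i', e' + i', w' + i') := by
            by_cases hkm' : k = m + 1
            · subst hkm'
              exact ⟨_, _, _, _, s', hg'⟩
            · rcases h1 k (by omega) hk' with h | h
              · rw [h] at hc
                simp only [mem_segment] at hc
                omega
              · exact h
          obtain ⟨n', i', e'', w'', s'', hg''⟩ := hslot
          rw [hg''] at hc
          simp only [mem_segment] at hc
          have := s''.flat (c.2 - c.1) (by omega) (by omega)
          exact G.lt_of_ρ_lt hk' hl (d := c.2 - c.1) (by omega)
        rw [hgk k (by omega)] at hc
        rw [hgk l (by omega)]
        exact h2 k l c (by omega) hk' hl hl' hc (by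
          simp only [Through, show c.2 + 1 - (c.1 + 1) = c.2 - c.1 by ring]; exact hthr)
    · rintro ⟨r, j⟩ ⟨k, hk, hk', hthr⟩
      have h8' := h8 (r, j) ⟨k, hk, hk', hthr⟩
      simp only [Through] at hthr
      -- Along vertical paths, what the first segment gains is what the second one loses: in both
      -- places `ν (n + 1)` is the only vertical path.
      have key : (r - 1, j - 1) ∈ segment (Function.update g' m (i, e + i, w + i) m) ↔
          (r, j) ∈ segment (Function.update g' m (i, e + i, w + i) (m + 1)) := by
        rw [hgm, hgk _ (by omega), hg']
        simp only [mem_segment]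
        constructor
        · rintro ⟨hr, hj, hj'⟩
          obtain rfl : r = i + 1 := by omega
          obtain rfl := s.eq_of_below G (d := j - (i + 1)) (by omega) (by omega) hk hk' hthr
          refine ⟨rfl, ?_, by omega⟩
          by_contra hlt
          have e1 := (G.stepV (n + 1) hk hk').antitone (show j - (i + 1) ≤ e' - 1 by omega)
          have e2 := s'.south_V G
          omega
        · rintro ⟨hr, hj, hj'⟩
          subst hr
          refine ⟨by omega, by omega, ?_⟩
          by_contra hlt
          have e1 := (G.stepV (n + 1) (by omega) s.lt).antitone
            (show w ≤ j - (i + 1) by omega)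
          have e2 := s.finish
          have e3 := G.lt_of_ν_lt (n := n + 1) (n' := k) (d := j - (i + 1)) s.lt hk (by omega)
          have e4 := s'.below (j - (i + 1)) (by omega) (by omega)
          have e5 := G.lt_of_ν_lt (n := k) (n' := n + 1 + 1) (d := j - (i + 1)) hk' (by omega)
            (by omega)
          omega
      constructor
      · rintro ⟨l, hl, hl', hc⟩
        by_cases hlm : l = m
        · subst hlm
          exact Or.inl ⟨l + 1, by omega, by omega, key.1 hc⟩
        · rw [hgk l (by omega)] at hc
          rcases h8'.1 ⟨l, by omega, hl', hc⟩ with ⟨q, hq, hq', hcq⟩ | h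
          · exact Or.inl ⟨q, by omega, hq', by rw [hgk q (by omega)]; exact hcq⟩
          · exact Or.inr h
      · rintro (⟨l, hl, hl', hc⟩ | h)
        · by_cases hlm : l = m + 1
          · subst hlm
            exact ⟨m, le_rfl, by omega, key.2 hc⟩
          · rw [hgk l (by omega)] at hc
            obtain ⟨q, hq, hq', hcq⟩ := h8'.2 (Or.inl ⟨l, by omega, hl', hc⟩)
            exact ⟨q, by omega, hq', by rw [hgk q (by omega)]; exact hcq⟩
        · obtain ⟨q, hq, hq', hcq⟩ := h8'.2 (Or.inr h)
          exact ⟨q, by omega, hq', by rw [hgk q (by omega)]; exact hcq⟩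

end Grid
end BipartiteData

/-! ### Lattice paths as lists, and their shifts. -/

namespace BipartiteData

theorem Step.swap {x y : ℤ × ℤ} (h : Step x y) : Step y.swap x.swap := by
  rcases h with rfl | rfl
  · exact Or.inr (Prod.ext (by simp) (by simp))
  · exact Or.inl (Prod.ext (by simp) (by simp))

namespace IsPath

variable {p q : ℤ × ℤ} {l : List (ℤ × ℤ)}

/-- Meant for transposition and rotation by 180 degrees: both reverse steps, so the list has to be
read backwards. -/
theorem map_reverse {φ : ℤ × ℤ → ℤ × ℤ} (hφ : ∀ x y, Step x y → Step (φ y) (φ x))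
    (h : IsPath p q l) : IsPath (φ q) (φ p) (l.reverse.map φ) := by
  obtain ⟨h1, h2, h3⟩ := h
  refine ⟨by simp [h2], by simp [h1], ?_⟩
  rw [List.isChain_map, List.isChain_reverse]
  exact h3.imp fun a b hab => hφ a b hab

/-- A path as the part of an infinite path, extended to the west and to the east, that lies between
the columns of its endpoints. -/
theorem exists_row : ∀ (l : List (ℤ × ℤ)) (p q : ℤ × ℤ), IsPath p q l → ∃ f, IsStep f ∧
    (∀ c, c ∈ l ↔ Through f c ∧ p.2 ≤ c.2 ∧ c.2 ≤ q.2) ∧ (∀ d, d + f d < p.2 → f d = p.1) ∧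
    (∀ d, q.2 < d + f d → f d = q.1) ∧ (∀ d, d ≤ p.2 - p.1 → f d = p.1) ∧ (∀ d, f d ≤ p.1) ∧
    (∀ d, q.1 ≤ f d) ∧ p.2 ≤ q.2
  | [], p, q, h => by simp [IsPath] at h
  | [x], p, q, h => by
    simp only [IsPath, List.head?_cons, Option.some.injEq, List.getLast?_singleton] at h
    obtain ⟨rfl, rfl, -⟩ := h
    refine ⟨fun _ => x.1, fun d => Or.inl rfl, fun c => ?_, fun _ _ => rfl, fun _ _ => rfl,
      fun _ _ => rfl, fun _ => le_rfl, fun _ => le_rfl, le_rfl⟩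
    simp only [List.mem_singleton, Through, Prod.ext_iff]
    omega
  | x :: y :: t, p, q, h => by
    simp only [IsPath, List.head?_cons, Option.some.injEq, List.getLast?_cons_cons,
      List.isChain_cons_cons] at h
    obtain ⟨rfl, h2, hxy, h4⟩ := h
    obtain ⟨f, hf, hmem, hl, hr, hd, hle, hge, hpq⟩ := exists_row (y :: t) y q ⟨by simp, h2, h4⟩
    rcases hxy with rfl | rfl
    -- First step east: the westward extension of the tail already passes through `x`.
    · simp only at hmem hl hd hle hpq
      refine ⟨f, hf, fun c => ?_, fun d h => hl d (by omega), hr, fun d h => hd d (by omega), hle,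
        hge, by omega⟩
      rw [List.mem_cons, hmem, Prod.ext_iff]
      simp only [Through]
      constructor
      · rintro (h | h)
        · refine ⟨?_, by omega, by omega⟩
          rw [hd _ (by omega)]; omega
        · exact ⟨h.1, by omega, h.2.2⟩
      · rintro ⟨h1, h2, h3⟩
        by_cases h : x.2 + 1 ≤ c.2
        · exact Or.inr ⟨h1, h, h3⟩
        · have := hl (c.2 - c.1) (by omega)
          exact Or.inl (by omega)
    · simp only at hmem hl hd hle hpq
      have hstep : ∀ d, (if d ≤ x.2 - x.1 then x.1 else f d) = f d ∧ x.2 - x.1 < d ∨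
          (if d ≤ x.2 - x.1 then x.1 else f d) = x.1 ∧ d ≤ x.2 - x.1 := fun d => by
        split_ifs <;> simp <;> omega
      -- First step north: the extension runs along the row of `x` up to its diagonal and then
      -- follows that of the tail.
      refine ⟨fun d => if d ≤ x.2 - x.1 then x.1 else f d, fun d => ?_, fun c => ?_, fun d h => ?_,
        fun d h => ?_, fun d h => if_pos h, fun d => ?_, fun d => ?_, hpq⟩
      · simp only
        have := hf d
        have h1 := hd (d + 1)
        rcases hstep d with h | h <;> rcases hstep (d + 1) with h' | h' <;> omega
      · rw [List.mem_cons, hmem, Prod.ext_iff]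
        simp only [Through]
        have h1 := hd (c.2 - c.1)
        rcases hstep (c.2 - c.1) with h | h <;> rw [h.1] <;> omega
      · have h1 := hl d
        rcases hstep d with h' | h' <;> simp only at h ⊢ <;> omega
      · have h1 := hr d
        rcases hstep d with h' | h' <;> simp only at h ⊢ <;> omega
      · have := hle d
        rcases hstep d with h' | h' <;> simp only <;> omega
      · have := hge d
        have := hge (x.2 - x.1 + 1)
        have := hd (x.2 - x.1 + 1) (by omega)
        rcases hstep d with h' | h' <;> simp only <;> omega

/-- A path as the part of an infinite path, extended to the south and to the north, that lies
between the rows of its endpoints. -/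
theorem exists_col (h : IsPath p q l) : ∃ f, IsStep f ∧
    (∀ c, c ∈ l ↔ Through f c ∧ q.1 ≤ c.1 ∧ c.1 ≤ p.1) ∧ (∀ d, f d < q.1 → d + f d = q.2) ∧
    (∀ d, p.1 < f d → d + f d = p.2) ∧ (∀ d, d + f d ≤ q.2) ∧ (∀ d, p.2 ≤ d + f d) := by
  obtain ⟨f, hf, hmem, hl, hr, -, hle, hge, -⟩ := exists_row _ _ _
    (h.map_reverse fun _ _ => Step.swap)
  simp only [Prod.fst_swap, Prod.snd_swap] at hl hr hle hge
  -- On the diagonal `-d` the transposed path is in the row `f (-d)`, which is the column of the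
  -- original point; subtracting `d` gives its row.
  refine ⟨fun d => f (-d) - d, fun d => ?_, fun c => ?_, fun d h => ?_, fun d h => ?_, fun d => ?_,
    fun d => ?_⟩
  · have := hf.pred (-d)
    rw [show -d - 1 = -(d + 1) by ring] at this
    simp only
    omega
  · have := hmem c.swap
    simp only [List.mem_map, List.mem_reverse, Prod.swap_inj, exists_eq_right, Through,
      Prod.fst_swap, Prod.snd_swap] at this
    rw [this]
    simp only [Through]
    rw [show -(c.2 - c.1) = c.1 - c.2 by ring]
    omega
  · have := hl (-d) (by simp only at h; omega)
    simp only; omega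
  · have := hr (-d) (by simp only at h; omega)
    simp only; omega
  · have := hle (-d)
    simp only; omega
  · have := hge (-d)
    simp only; omega

end IsPath

/-- The segment `g`, its right neighbour and the point south of its first point lie in `l`,
unless `g` is empty. -/
def SegmentIn (l : List (ℤ × ℤ)) (g : ℤ × ℤ × ℤ) : Prop :=
  g.2.1 < g.2.2 → (g.1 + 1, g.2.1) ∈ l ∧ ∀ j, g.2.1 ≤ j → j ≤ g.2.2 → (g.1, j) ∈ l

open Classical in
/-- The map that shifts the segment `g` by `(1, 1)`. -/
noncomputable def shiftPoint (g : ℤ × ℤ × ℤ) (c : ℤ × ℤ) : ℤ × ℤ :=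
  if c ∈ segment g then (c.1 + 1, c.2 + 1) else c

theorem SegmentIn.subset {l : List (ℤ × ℤ)} {g : ℤ × ℤ × ℤ} (h : SegmentIn l g) {c : ℤ × ℤ}
    (hc : c ∈ segment g) : c ∈ l := by
  rw [mem_segment] at hc
  have := (h (by omega)).2 c.2 (by omega) (by omega)
  rwa [← hc.1] at this

theorem SegmentIn.mem_map {l : List (ℤ × ℤ)} {g : ℤ × ℤ × ℤ} (h : SegmentIn l g) (c : ℤ × ℤ) :
    c ∈ l.map (shiftPoint g) ↔
      (c ∈ l ∧ c ∉ segment g) ∨ (c.1 - 1, c.2 - 1) ∈ segment g := by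
  rw [List.mem_map]
  constructor
  · rintro ⟨x, hx, rfl⟩
    by_cases hs : x ∈ segment g
    · right; simp [shiftPoint, hs]
    · left; simpa [shiftPoint, hs] using hx
  · rintro (⟨h1, h2⟩ | h1)
    · exact ⟨c, h1, by simp [shiftPoint, h2]⟩
    · exact ⟨_, h.subset h1, by simp [shiftPoint, h1]⟩

namespace IsPath

variable {p q : ℤ × ℤ} {l : List (ℤ × ℤ)} {g : ℤ × ℤ × ℤ}

/-- A segment entered from the south and left to the east is, after the shift, entered by a step
east and left by a step north. The endpoints stay fixed, because the path continues south of the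
first point of the segment and east of its last one. -/
theorem shift (h : IsPath p q l) (hg : SegmentIn l g) : IsPath p q (l.map (shiftPoint g)) := by
  obtain ⟨f, hf, hmem, -, -, -, hle, -, -⟩ := exists_row _ _ _ h
  by_cases hempty : g.2.1 < g.2.2
  swap
  · have : shiftPoint g = id := by
      funext c
      exact if_neg fun hc => by rw [mem_segment] at hc; omega
    rwa [this, List.map_id]
  obtain ⟨hs, hrow⟩ := hg hempty
  have hs' := (hmem _).1 hs
  have hrow' := fun j h1 h2 => (hmem _).1 (hrow j h1 h2)
  simp only [Through] at hs' hrow' hmem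
  have hfix : ∀ c, c ∉ segment g → shiftPoint g c = c := fun c hc => if_neg hc
  have hmove : ∀ c, c ∈ segment g → shiftPoint g c = (c.1 + 1, c.2 + 1) := fun c hc => if_pos hc
  obtain ⟨h1, h2, h3⟩ := h
  refine ⟨?_, ?_, ?_⟩
  · rw [List.head?_map, h1, Option.map_some, hfix]
    intro hp
    rw [mem_segment] at hp
    have := hle (g.2.1 - (g.1 + 1))
    omega
  · rw [List.getLast?_map, h2, Option.map_some, hfix]
    intro hq
    rw [mem_segment] at hq
    have := hrow' (q.2 + 1) (by omega) (by omega)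
    omega
  · rw [List.isChain_map]
    refine List.IsChain.imp_of_mem_imp ?_ h3
    rintro ⟨x1, x2⟩ y hx hy hxy
    have hx' := ((hmem _).1 hx).1
    have hy' := ((hmem _).1 hy).1
    have ht := hrow' (x2 + 1)
    have ht' := hrow' (x2 - 1)
    simp only at hx' ht ht'
    by_cases hxs : (x1, x2) ∈ segment g <;> by_cases hys : y ∈ segment g
    · rw [hmove _ hxs, hmove _ hys]
      rcases hxy with rfl | rfl
      · exact Or.inl rfl
      · exact Or.inr (by simp)
    · rw [hmove _ hxs, hfix _ hys]
      rw [mem_segment] at hxs hys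
      simp only at hxs
      have ht1 := (ht (by omega) (by omega)).1
      rcases hxy with rfl | rfl
      · exact Or.inr (by simp)
      · simp only at hy'
        rw [show x2 - (x1 - 1) = x2 + 1 - g.1 by omega] at hy'
        omega
    · rw [hfix _ hxs, hmove _ hys]
      rw [mem_segment] at hxs hys
      rcases hxy with rfl | rfl
      · simp only at hxs hys
        rw [show g.2.1 - (g.1 + 1) = x2 - x1 by omega] at hs'
        omega
      · simp only at hxs hys
        by_cases hx2 : x2 = g.2.1
        · exact Or.inl (by simp)
        · have ht1 := (ht' (by omega) (by omega)).1
          rw [show x2 - 1 - g.1 = x2 - x1 by omega] at ht1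
          omega
    · rwa [hfix _ hxs, hfix _ hys]

/-- The corners of a path obtained by shifting a segment. -/
theorem corner_shift (h : IsPath p q l) (hg : SegmentIn l g) {c : ℤ × ℤ}
    (hc : IsNWCorner (l.map (shiftPoint g)) c ∨ IsSECorner (l.map (shiftPoint g)) c) :
    ((IsNWCorner l c ∨ IsSECorner l c) ∧ c ∉ segment g) ∨
      (g.2.1 < g.2.2 ∧ (c = (g.1 + 1, g.2.1) ∨ c = (g.1, g.2.2) ∨ c = (g.1 + 1, g.2.2))) := by
  obtain ⟨f, hf, hmem, -, -, -, hle, -, -⟩ := exists_row _ _ _ h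
  simp only [IsNWCorner, IsSECorner, hg.mem_map, Prod.ext_iff] at hc ⊢
  by_cases hempty : g.2.1 < g.2.2
  swap
  · have hno : ∀ c, c ∉ segment g := fun c hc => by rw [mem_segment] at hc; omega
    simp only [hno, not_false_eq_true, and_true, or_false] at hc
    exact Or.inl ⟨hc, hno c⟩
  obtain ⟨hs, hrow⟩ := hg hempty
  have hs' := ((hmem _).1 hs).1
  have hrow' := fun j h1 h2 => ((hmem _).1 (hrow j h1 h2)).1
  -- A path meets each diagonal at most once, so a point of `l` on a diagonal of the segment lies in
  -- its row.
  have huniq : ∀ x ∈ l, ∀ j, g.2.1 ≤ j → j ≤ g.2.2 → x.2 - x.1 = j - g.1 → x.1 = g.1 := by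
    intro x hx j h1 h2 h3
    have e1 := ((hmem _).1 hx).1
    have e2 := hrow' j h1 h2
    simp only [Through] at e1 e2
    rw [h3] at e1
    omega
  have huniq' : ∀ x ∈ l, x.2 - x.1 = g.2.1 - (g.1 + 1) → x.1 = g.1 + 1 := by
    intro x hx h3
    have e1 := ((hmem _).1 hx).1
    simp only [Through] at e1 hs'
    rw [h3] at e1
    omega
  by_cases hnew : (c.1 - 1, c.2 - 1) ∈ segment g
  · right
    refine ⟨hempty, ?_⟩
    have hnew' := hnew
    rw [mem_segment] at hnew'
    simp only at hnew'
    rcases hc with ⟨-, hc, -⟩ | ⟨-, hc, -⟩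
    · rcases hc with hc | hc
      · by_cases hcj : c.2 - 1 = g.2.1
        · have := huniq' _ hc.1 (by simp only; omega)
          simp only at this; omega
        · have := huniq _ hc.1 (c.2 - 2) (by omega) (by omega) (by simp only; omega)
          simp only at this; omega
      · rw [mem_segment] at hc; simp only at hc; omega
    · rcases hc with hc | hc
      · have := hc.2
        rw [mem_segment] at this; simp only at this
        omega
      · rw [mem_segment] at hc; simp only at hc; omega
  · have hcl : c ∈ l ∧ c ∉ segment g := by
      rcases hc with ⟨hc, -⟩ | ⟨hc, -⟩ <;> exact hc.resolve_right hnew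
    have hcs := hcl.2
    rw [mem_segment] at hcs
    rcases hc with ⟨-, h1, h2⟩ | ⟨-, h1, h2⟩
    · rcases h1 with h1 | h1
      · rcases h2 with h2 | h2
        · exact Or.inl ⟨Or.inl ⟨hcl.1, h1.1, h2.1⟩, hcl.2⟩
        · rw [mem_segment] at h2
          simp only at h2
          by_cases hcj : c.2 = g.2.1
          · right; omega
          · have := huniq _ hcl.1 (c.2 - 1) (by omega) (by omega) (by omega)
            omega
      · rw [mem_segment] at h1
        simp only at h1
        right; omega
    · rcases h1 with h1 | h1
      · rcases h2 with h2 | h2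
        · exact Or.inl ⟨Or.inr ⟨hcl.1, h1.1, h2.1⟩, hcl.2⟩
        · rw [mem_segment] at h2
          simp only at h2
          have := huniq _ hcl.1 (c.2 - 1) (by omega) (by omega) (by omega)
          omega
      · rw [mem_segment] at h1
        simp only at h1
        by_cases hcj : c.2 - 1 = g.2.1
        · have := huniq' _ hcl.1 (by omega)
          omega
        · have := huniq _ hcl.1 (c.2 - 2) (by omega) (by omega) (by omega)
          omega

end IsPath

end BipartiteData

/-! ### Positions of the pages in an array. -/

namespace BipartiteData

/-- The part of the sum of the weights `w l`, `l` satisfying `P`, that belongs to `l < m`. -/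
def partialSum {r : ℕ} (w : Fin r → ℕ) (P : Fin r → Prop) [DecidablePred P] (m : ℕ) : ℕ :=
  ∑ l ∈ Finset.univ.filter (fun l : Fin r => l.val < m ∧ P l), w l

section PartialSum

variable {r : ℕ} (w : Fin r → ℕ) (P : Fin r → Prop) [DecidablePred P]

theorem partialSum_mono {m m' : ℕ} (h : m ≤ m') : partialSum w P m ≤ partialSum w P m' :=
  Finset.sum_le_sum_of_subset fun l hl => by
    simp only [Finset.mem_filter] at hl ⊢
    exact ⟨hl.1, by omega, hl.2.2⟩

theorem partialSum_total : partialSum w P r = ∑ l ∈ Finset.univ.filter P, w l := by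
  simp [partialSum]

theorem partialSum_succ (k : Fin r) :
    partialSum w P (k + 1) = partialSum w P k + if P k then w k else 0 := by
  unfold partialSum
  by_cases hP : P k
  · have : Finset.univ.filter (fun l : Fin r => l.val < k + 1 ∧ P l) =
        insert k (Finset.univ.filter (fun l : Fin r => l.val < k ∧ P l)) := by
      ext l
      simp only [Finset.mem_filter, Finset.mem_univ, true_and, Finset.mem_insert]
      constructor
      · rintro ⟨h1, h2⟩
        by_cases h : l = k
        · exact Or.inl h
        · exact Or.inr ⟨by have := Fin.val_ne_of_ne h; omega, h2⟩
      · rintro (rfl | h)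
        · exact ⟨by omega, hP⟩
        · exact ⟨by omega, h.2⟩
    rw [this, Finset.sum_insert (by simp), if_pos hP, add_comm]
  · rw [if_neg hP, add_zero]
    congr 1
    ext l
    simp only [Finset.mem_filter, Finset.mem_univ, true_and, and_congr_left_iff]
    intro h
    have : l ≠ k := fun h' => hP (h' ▸ h)
    have := Fin.val_ne_of_ne this
    omega

theorem partialSum_add_le {k : Fin r} (hk : P k) {m : ℕ} (h : k < m) :
    partialSum w P k + w k ≤ partialSum w P m := by
  have := partialSum_succ w P k
  rw [if_pos hk] at this
  rw [← this]
  exact partialSum_mono w P h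

/-- Used to find the page that contains the `n`-th column, or the `n`-th vertical path, of an array.
-/
theorem exists_partialSum {n : ℕ} (hn : 1 ≤ n) (hn' : n ≤ ∑ l ∈ Finset.univ.filter P, w l) :
    ∃ k : Fin r, P k ∧ partialSum w P k < n ∧ n ≤ partialSum w P k + w k := by
  have hex : ∃ m, n ≤ partialSum w P m := ⟨r, by rwa [partialSum_total]⟩
  classical
  obtain ⟨m, hm, hmin⟩ : ∃ m, n ≤ partialSum w P m ∧ ∀ l < m, ¬ n ≤ partialSum w P l :=
    ⟨Nat.find hex, Nat.find_spec hex, fun l hl => Nat.find_min hex hl⟩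
  have hmr : m ≤ r := by
    by_contra h
    exact hmin r (by omega) (by rwa [partialSum_total])
  cases m with
  | zero => simp [partialSum] at hm; omega
  | succ m =>
    have h1 := hmin m (by omega)
    have h2 := partialSum_succ w P ⟨m, by omega⟩
    simp only at h2
    split_ifs at h2 with h3
    · exact ⟨⟨m, by omega⟩, h3, by simp only; omega, by simp only; omega⟩
    · omega

end PartialSum

variable {T S : Type*} [DecidableEq T] [DecidableEq S]

section Offsets

variable (Q : BipartiteData T S)

theorem colOffset_eq {k : Fin Q.r} {α : T} (h : Q.t k = α) :
    Q.colOffset k = partialSum (fun l => Q.mS (Q.s l)) (fun l => Q.t l = α) k := by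
  subst h; rfl

theorem vertOffset_eq {k : Fin Q.r} {α : T} (h : Q.t k = α) :
    Q.vertOffset k = partialSum (fun l => Q.uS (Q.s l)) (fun l => Q.t l = α) k := by
  subst h; rfl

theorem colOffset_add_le {k k' : Fin Q.r} (h : Q.t k = Q.t k') (hk : k < k') :
    Q.colOffset k + Q.mS (Q.s k) ≤ Q.colOffset k' := by
  rw [Q.colOffset_eq h, Q.colOffset_eq rfl]
  exact partialSum_add_le (fun l => Q.mS (Q.s l)) (fun l => Q.t l = Q.t k') h hk

theorem vertOffset_add_le {k k' : Fin Q.r} (h : Q.t k = Q.t k') (hk : k < k') :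
    Q.vertOffset k + Q.uS (Q.s k) ≤ Q.vertOffset k' := by
  rw [Q.vertOffset_eq h, Q.vertOffset_eq rfl]
  exact partialSum_add_le (fun l => Q.uS (Q.s l)) (fun l => Q.t l = Q.t k') h hk

theorem colOffset_add_le_bT (k : Fin Q.r) :
    Q.colOffset k + Q.mS (Q.s k) ≤ Q.bT (Q.t k) := by
  rw [Q.colOffset_eq rfl, bT, ← partialSum_total]
  exact partialSum_add_le (fun l => Q.mS (Q.s l)) (fun l => Q.t l = Q.t k) rfl k.2

theorem vertOffset_add_le_vT (k : Fin Q.r) :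
    Q.vertOffset k + Q.uS (Q.s k) ≤ Q.vT (Q.t k) := by
  rw [Q.vertOffset_eq rfl, vT, ← partialSum_total]
  exact partialSum_add_le (fun l => Q.uS (Q.s l)) (fun l => Q.t l = Q.t k) rfl k.2

theorem exists_col {α : T} {n : ℕ} (hn : 1 ≤ n) (hn' : n ≤ Q.bT α) :
    ∃ k, Q.t k = α ∧ Q.colOffset k < n ∧ n ≤ Q.colOffset k + Q.mS (Q.s k) := by
  obtain ⟨k, hk, h⟩ := exists_partialSum (fun l => Q.mS (Q.s l)) (fun l => Q.t l = α) hn hn'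
  exact ⟨k, hk, by rwa [Q.colOffset_eq hk]⟩

theorem exists_vert {α : T} {n : ℕ} (hn : 1 ≤ n) (hn' : n ≤ Q.vT α) :
    ∃ k, Q.t k = α ∧ Q.vertOffset k < n ∧ n ≤ Q.vertOffset k + Q.uS (Q.s k) := by
  obtain ⟨k, hk, h⟩ := exists_partialSum (fun l => Q.uS (Q.s l)) (fun l => Q.t l = α) hn hn'
  exact ⟨k, hk, by rwa [Q.vertOffset_eq hk]⟩

theorem eq_of_vert {k k' : Fin Q.r} (h : Q.t k = Q.t k') {q q' : ℕ}
    (hq : 1 ≤ q) (hq' : q ≤ Q.uS (Q.s k)) (h1 : 1 ≤ q') (h2 : q' ≤ Q.uS (Q.s k'))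
    (he : Q.vertOffset k + q = Q.vertOffset k' + q') : k = k' ∧ q = q' := by
  rcases lt_trichotomy k k' with h3 | h3 | h3
  · have := Q.vertOffset_add_le h h3
    omega
  · subst h3
    exact ⟨rfl, by omega⟩
  · have := Q.vertOffset_add_le h.symm h3
    omega

theorem le_of_col {k k' : Fin Q.r} (h : Q.t k = Q.t k') {j j' : ℤ}
    (hj' : j ≤ Q.mS (Q.s k)) (h1 : 1 ≤ j')
    (he : (Q.colOffset k' : ℤ) + j' ≤ Q.colOffset k + j) : k' ≤ k := by
  by_contra h3
  have := Q.colOffset_add_le h (not_le.1 h3)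
  omega

theorem le_of_vert {k k' : Fin Q.r} (h : Q.t k = Q.t k') {q q' : ℕ}
    (hq' : q ≤ Q.uS (Q.s k)) (h1 : 1 ≤ q')
    (he : Q.vertOffset k' + q' ≤ Q.vertOffset k + q) : k' ≤ k := by
  by_contra h3
  have := Q.vertOffset_add_le h (not_le.1 h3)
  omega

variable {Q}

theorem Vertex.bounds (x : Q.Vertex) :
    1 ≤ x.i ∧ x.i ≤ Q.mT (Q.t x.k) ∧ 1 ≤ x.j ∧ x.j ≤ Q.mS (Q.s x.k) := by
  have h1 := x.hi
  have h2 := x.hj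
  rw [Finset.mem_Icc] at h1 h2
  omega

theorem posT_bounds (x : Q.Vertex) : 1 ≤ (Q.posT x).1 ∧ (Q.posT x).1 ≤ Q.aT (Q.t x.k) ∧
    1 ≤ (Q.posT x).2 ∧ (Q.posT x).2 ≤ Q.bT (Q.t x.k) := by
  have h1 := x.bounds
  have h2 := Q.colOffset_add_le_bT x.k
  simp only [posT, aT]
  omega

theorem exists_posT {α : T} {c : ℤ × ℤ} (h1 : 1 ≤ c.1) (h2 : c.1 ≤ Q.aT α) (h3 : 1 ≤ c.2)
    (h4 : c.2 ≤ Q.bT α) : ∃ x : Q.Vertex, Q.t x.k = α ∧ Q.posT x = c := by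
  obtain ⟨k, hk, h5, h6⟩ := Q.exists_col (α := α) (n := c.2.toNat) (by omega) (by omega)
  subst hk
  simp only [aT] at h2
  refine ⟨⟨k, c.1.toNat, c.2.toNat - Q.colOffset k, ?_, ?_⟩, rfl, ?_⟩
  · rw [Finset.mem_Icc]; omega
  · rw [Finset.mem_Icc]; omega
  · simp only [posT, Prod.ext_iff]
    omega

theorem posT_injective {x y : Q.Vertex} (h : Q.t x.k = Q.t y.k) (hp : Q.posT x = Q.posT y) :
    x = y := by
  simp only [posT, Prod.mk.injEq] at hp
  have hx := x.bounds
  have hy := y.bounds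
  have h1 := Q.le_of_col h (j := x.j) (j' := y.j) (by omega) (by omega) (by omega)
  have h2 := Q.le_of_col h.symm (j := y.j) (j' := x.j) (by omega) (by omega) (by omega)
  have hk : x.k = y.k := le_antisymm h2 h1
  refine Vertex.ext hk (by omega) ?_
  rw [hk] at hp
  omega

/-- A point of `A_α` SE of another one lies on a later page or is SE of it on the same page. -/
theorem page_of_posT_lt {x y : Q.Vertex} (h : Q.t x.k = Q.t y.k)
    (h2 : (Q.posT x).2 < (Q.posT y).2) : x.k < y.k ∨ x.k = y.k ∧ x.j < y.j := by
  simp only [posT] at h2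
  have hx := x.bounds
  have hy := y.bounds
  have h1 := Q.le_of_col h.symm (j := y.j) (j' := x.j) (by omega) (by omega) (by omega)
  rcases h1.lt_or_eq with h | h
  · exact Or.inl h
  · refine Or.inr ⟨h, ?_⟩
    rw [h] at h2
    omega

end Offsets

/-! ### Transposition. -/

section Op

/-- The data with the roles of sources and targets, and of rows and columns, exchanged. -/
def op (Q : BipartiteData T S) : BipartiteData S T where
  r := Q.r
  t := Q.s
  s := Q.t
  mT := Q.mS
  mS := Q.mT
  uT := Q.uS
  uS := Q.uT

variable {Q : BipartiteData T S}

theorem Admissible.op (h : Q.Admissible) : Q.op.Admissible where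
  target β := by
    have := h.source β
    rwa [min_comm] at this
  source α := by
    have := h.target α
    rwa [min_comm] at this

/-- The transposed vertex. -/
def Vertex.op (x : Q.Vertex) : Q.op.Vertex := ⟨x.k, x.j, x.i, x.hj, x.hi⟩

theorem Vertex.op_injective : Function.Injective (Vertex.op (Q := Q)) := fun x y h => by
  have h1 := congrArg Vertex.k h
  have h2 := congrArg Vertex.i h
  have h3 := congrArg Vertex.j h
  exact Vertex.ext h1 h3 h2

theorem posT_op (x : Q.Vertex) : Q.op.posT x.op = (Q.posS x).swap := rfl

theorem posS_op (x : Q.Vertex) : Q.op.posS x.op = (Q.posT x).swap := rfl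

theorem IsPath.swap {p q : ℤ × ℤ} {l : List (ℤ × ℤ)} (h : IsPath p q l) :
    IsPath q.swap p.swap (l.reverse.map Prod.swap) := h.map_reverse fun _ _ => Step.swap

theorem mem_map_swap {l : List (ℤ × ℤ)} {c : ℤ × ℤ} :
    c ∈ l.reverse.map Prod.swap ↔ c.swap ∈ l := by
  rw [List.mem_map]
  constructor
  · rintro ⟨x, hx, rfl⟩
    simpa using hx
  · intro h
    exact ⟨c.swap, by simpa using h, by simp⟩

theorem disjoint_map_swap {l l' : List (ℤ × ℤ)} (h : l.Disjoint l') :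
    (l.reverse.map Prod.swap).Disjoint (l'.reverse.map Prod.swap) := fun _ hc hc' =>
  h (mem_map_swap.1 hc) (mem_map_swap.1 hc')

theorem isNWCorner_map_swap {l : List (ℤ × ℤ)} {c : ℤ × ℤ} :
    IsNWCorner (l.reverse.map Prod.swap) c.swap ↔ IsNWCorner l c := by
  simp only [IsNWCorner, mem_map_swap, Prod.swap_swap]
  exact and_congr_right fun _ => and_comm

theorem isSECorner_map_swap {l : List (ℤ × ℤ)} {c : ℤ × ℤ} :
    IsSECorner (l.reverse.map Prod.swap) c.swap ↔ IsSECorner l c := by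
  simp only [IsSECorner, mem_map_swap, Prod.swap_swap]
  exact and_congr_right fun _ => and_comm

namespace RoadMap

/-- The transposed road map. -/
def op (R : Q.RoadMap) : Q.op.RoadMap where
  H β q := (R.V β q).reverse.map Prod.swap
  V α p := (R.H α p).reverse.map Prod.swap
  H_path β q hq := (R.V_path β q hq).swap
  V_path α p hp := (R.H_path α p hp).swap
  H_disjoint β q hq q' hq' h := disjoint_map_swap (R.V_disjoint β q hq q' hq' h)
  V_disjoint α p hp p' hp' h := disjoint_map_swap (R.H_disjoint α p hp p' hp' h)

variable (R : Q.RoadMap)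

theorem mem_op_H (x : Q.Vertex) (q : ℕ) :
    Q.op.posT x.op ∈ R.op.H (Q.s x.k) q ↔ Q.posS x ∈ R.V (Q.s x.k) q := by
  rw [posT_op]
  exact mem_map_swap

theorem mem_op_V (x : Q.Vertex) (p : ℕ) :
    Q.op.posS x.op ∈ R.op.V (Q.t x.k) p ↔ Q.posT x ∈ R.H (Q.t x.k) p := by
  rw [posS_op]
  exact mem_map_swap

theorem onHorizontal_op (x : Q.Vertex) : R.op.OnHorizontal x.op ↔ R.OnVertical x :=
  exists_congr fun q => and_congr_right fun _ => R.mem_op_H x q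

theorem onVertical_op (x : Q.Vertex) : R.op.OnVertical x.op ↔ R.OnHorizontal x :=
  exists_congr fun p => and_congr_right fun _ => R.mem_op_V x p

theorem isHorizontalNWCorner_op (x : Q.Vertex) :
    R.op.IsHorizontalNWCorner x.op ↔ R.IsVerticalNWCorner x :=
  exists_congr fun _ => and_congr_right fun _ => isNWCorner_map_swap (c := Q.posS x)

theorem isVerticalNWCorner_op (x : Q.Vertex) :
    R.op.IsVerticalNWCorner x.op ↔ R.IsHorizontalNWCorner x :=
  exists_congr fun _ => and_congr_right fun _ => isNWCorner_map_swap (c := Q.posT x)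

theorem isHorizontalSECorner_op (x : Q.Vertex) :
    R.op.IsHorizontalSECorner x.op ↔ R.IsVerticalSECorner x :=
  exists_congr fun _ => and_congr_right fun _ => isSECorner_map_swap (c := Q.posS x)

theorem isVerticalSECorner_op (x : Q.Vertex) :
    R.op.IsVerticalSECorner x.op ↔ R.IsHorizontalSECorner x :=
  exists_congr fun _ => and_congr_right fun _ => isSECorner_map_swap (c := Q.posT x)

theorem meets_op (p q : ℕ) (x : Q.Vertex) : R.op.Meets q p x.op ↔ R.Meets p q x :=
  (and_congr (R.mem_op_H x q) (R.mem_op_V x p)).trans and_comm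

/-- Transposition is the reflection in the NW-SE diagonal: it preserves the directions NW and SE and
exchanges SW and NE. -/
theorem isNEEnd_op (p q : ℕ) (x : Q.Vertex) : R.op.IsNEEnd q p x.op ↔ R.IsSWEnd p q x := by
  refine and_congr (R.meets_op p q x) ⟨fun h y hy hm => ?_, fun h y hy hm => ?_⟩
  · exact (h y.op hy ((R.meets_op p q y).2 hm)).symm
  · exact (h ⟨y.k, y.j, y.i, y.hj, y.hi⟩ hy ((R.meets_op p q ⟨y.k, y.j, y.i, y.hj, y.hi⟩).1 hm)).symm

theorem isSWEnd_op (p q : ℕ) (x : Q.Vertex) : R.op.IsSWEnd q p x.op ↔ R.IsNEEnd p q x := by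
  refine and_congr (R.meets_op p q x) ⟨fun h y hy hm => ?_, fun h y hy hm => ?_⟩
  · exact (h y.op hy ((R.meets_op p q y).2 hm)).symm
  · exact (h ⟨y.k, y.j, y.i, y.hj, y.hi⟩ hy ((R.meets_op p q ⟨y.k, y.j, y.i, y.hj, y.hi⟩).1 hm)).symm

theorem isEssentialHorizontalNWCorner_op (x : Q.Vertex) :
    R.op.IsEssentialHorizontalNWCorner x.op ↔ R.IsEssentialVerticalNWCorner x := by
  refine and_congr (R.isHorizontalNWCorner_op x) (not_congr (exists_congr fun q =>
    and_congr_right fun _ => exists_congr fun p => and_congr_right fun _ =>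
      and_congr Iff.rfl (R.isNEEnd_op p q x)))

theorem isEssentialVerticalNWCorner_op (x : Q.Vertex) :
    R.op.IsEssentialVerticalNWCorner x.op ↔ R.IsEssentialHorizontalNWCorner x := by
  refine and_congr (R.isVerticalNWCorner_op x) (not_congr (exists_congr fun q =>
    and_congr_right fun _ => exists_congr fun p => and_congr_right fun _ =>
      and_congr Iff.rfl (R.isSWEnd_op q p x)))

variable {R}

theorem IsStraight.op (h : R.IsStraight) : R.op.IsStraight :=
  ⟨fun x hx => h.2 ⟨x.k, x.j, x.i, x.hj, x.hi⟩ (hx.imp (R.isHorizontalNWCorner_op _).1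
      (R.isHorizontalSECorner_op _).1) |> (R.onVertical_op _).2,
    fun x hx => h.1 ⟨x.k, x.j, x.i, x.hj, x.hi⟩ (hx.imp (R.isVerticalNWCorner_op _).1
      (R.isVerticalSECorner_op _).1) |> (R.onHorizontal_op _).2⟩

end RoadMap

end Op

end BipartiteData

/-! ### The grid of a straight road map in the array of a target. -/

namespace BipartiteData
theorem through_iff {f : ℤ → ℤ} {i j d : ℤ} (h : j - i = d) : Through f (i, j) ↔ f d = i := by
  subst h; rfl

namespace RoadMap

variable {T S : Type*} [DecidableEq T] [DecidableEq S] {Q : BipartiteData T S} (R : Q.RoadMap)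

open Classical in
/-- The path `H α p`, extended to the west and to the east. -/
noncomputable def hRow (α : T) (p : ℕ) : ℤ → ℤ :=
  if h : p ∈ Finset.Icc 1 (Q.uT α) then (IsPath.exists_row _ _ _ (R.H_path α p h)).choose else 0

open Classical in
/-- The path `V β q`, extended to the south and to the north. -/
noncomputable def vRow (β : S) (q : ℕ) : ℤ → ℤ :=
  if h : q ∈ Finset.Icc 1 (Q.uS β) then (IsPath.exists_col (R.V_path β q h)).choose else 0

theorem hRow_spec {α : T} {p : ℕ} (hp : 1 ≤ p) (hp' : p ≤ Q.uT α) : IsStep (R.hRow α p) ∧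
    (∀ c, c ∈ R.H α p ↔ Through (R.hRow α p) c ∧ 1 ≤ c.2 ∧ c.2 ≤ Q.bT α) ∧
    (∀ d, d + R.hRow α p d < 1 → R.hRow α p d = Q.aT α - Q.uT α + p) ∧
    (∀ d, Q.bT α < d + R.hRow α p d → R.hRow α p d = p) ∧
    (∀ d, R.hRow α p d ≤ Q.aT α - Q.uT α + p) ∧ ∀ d, p ≤ R.hRow α p d := by
  have h : p ∈ Finset.Icc 1 (Q.uT α) := Finset.mem_Icc.2 ⟨hp, hp'⟩
  obtain ⟨h1, h2, h3, h4, -, h5, h6, -⟩ :=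
    (IsPath.exists_row _ _ _ (R.H_path α p h)).choose_spec
  rw [hRow, dif_pos h]
  exact ⟨h1, h2, h3, h4, h5, h6⟩

theorem vRow_spec {β : S} {q : ℕ} (hq : 1 ≤ q) (hq' : q ≤ Q.uS β) : IsStep (R.vRow β q) ∧
    (∀ c, c ∈ R.V β q ↔ Through (R.vRow β q) c ∧ 1 ≤ c.1 ∧ c.1 ≤ Q.aS β) ∧
    (∀ d, R.vRow β q d < 1 → d + R.vRow β q d = Q.bS β - Q.uS β + q) ∧
    (∀ d, Q.aS β < R.vRow β q d → d + R.vRow β q d = q) ∧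
    (∀ d, d + R.vRow β q d ≤ Q.bS β - Q.uS β + q) ∧ ∀ d, q ≤ d + R.vRow β q d := by
  have h : q ∈ Finset.Icc 1 (Q.uS β) := Finset.mem_Icc.2 ⟨hq, hq'⟩
  have h1 := (IsPath.exists_col (R.V_path β q h)).choose_spec
  rw [vRow, dif_pos h]
  exact h1

/-- Far to the SW the paths are ordered by their starting rows. Afterwards they never meet: in the
array they are disjoint, and outside of it they run in different rows. -/
theorem hRow_lt {α : T} {p p' : ℕ} (hp : 1 ≤ p) (hpp' : p < p') (hp' : p' ≤ Q.uT α) (d : ℤ) :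
    R.hRow α p d < R.hRow α p' d := by
  obtain ⟨h1, h2, h3, h4, h5, h6⟩ := R.hRow_spec hp (hpp'.le.trans hp')
  obtain ⟨h1', h2', h3', h4', h5', h6'⟩ := R.hRow_spec (by omega) hp'
  by_contra hcon
  obtain ⟨c, -, -, hc, -⟩ := h1'.exists_first h1 (d := min d (- Q.aT α)) (e := d) (by omega)
    (by
      have e1 := h5 (min d (- Q.aT α))
      have e2 := h5' (min d (- Q.aT α))
      rw [h3 _ (by omega), h3' _ (by omega)]
      omega) (by omega)
  by_cases hc1 : c + R.hRow α p c < 1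
  · have := h3 c hc1
    have := h3' c (by omega)
    omega
  · by_cases hc2 : Q.bT α < c + R.hRow α p c
    · have := h4 c hc2
      have := h4' c (by omega)
      omega
    · refine R.H_disjoint α p (Finset.mem_Icc.2 (by omega)) p' (Finset.mem_Icc.2 (by omega))
        (by omega) (a := (R.hRow α p c, c + R.hRow α p c)) ((h2 _).2 ⟨?_, ?_⟩) ((h2' _).2 ⟨?_, ?_⟩)
      · exact (through_iff (d := c) (by ring)).2 rfl
      · simp only; omega
      · exact (through_iff (d := c) (by ring)).2 hc
      · simp only; omega

theorem vRow_lt {β : S} {q q' : ℕ} (hq : 1 ≤ q) (hqq' : q < q') (hq' : q' ≤ Q.uS β) (d : ℤ) :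
    R.vRow β q d < R.vRow β q' d := by
  obtain ⟨h1, h2, h3, h4, h5, h6⟩ := R.vRow_spec hq (hqq'.le.trans hq')
  obtain ⟨h1', h2', h3', h4', h5', h6'⟩ := R.vRow_spec (by omega) hq'
  by_contra hcon
  obtain ⟨c, -, -, hc, -⟩ := h1'.exists_first h1 (d := min d (- Q.aS β)) (e := d) (by omega)
    (by
      have e1 := h6 (min d (- Q.aS β))
      have e2 := h6' (min d (- Q.aS β))
      have e3 := h4 (min d (- Q.aS β)) (by omega)
      have e4 := h4' (min d (- Q.aS β)) (by omega)
      omega) (by omega)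
  by_cases hc1 : R.vRow β q c < 1
  · have := h3 c hc1
    have := h3' c (by omega)
    omega
  · by_cases hc2 : Q.aS β < R.vRow β q c
    · have := h4 c hc2
      have := h4' c (by omega)
      omega
    · refine R.V_disjoint β q (Finset.mem_Icc.2 (by omega)) q' (Finset.mem_Icc.2 (by omega))
        (by omega) (a := (R.vRow β q c, c + R.vRow β q c)) ((h2 _).2 ⟨?_, ?_⟩) ((h2' _).2 ⟨?_, ?_⟩)
      · exact (through_iff (d := c) (by ring)).2 rfl
      · simp only; omega
      · exact (through_iff (d := c) (by ring)).2 hc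
      · simp only; omega

/-- The path `V (s k) q`, extended to the south and to the north, in the coordinates of
`A_{t k}`. -/
noncomputable def nuPage (k : Fin Q.r) (q : ℕ) (d : ℤ) : ℤ :=
  -- Passing from `A_{t k}` to `A_{s k}` moves a point `colOffset` columns to the left and
  -- `rowOffset` rows down, so its diagonal drops by both offsets.
  R.vRow (Q.s k) q (d - Q.colOffset k - Q.rowOffset k) - Q.rowOffset k

open Classical in
/-- The `n`-th vertical path crossing `A_α`, in the coordinates of `A_α`. -/
noncomputable def nu (α : T) (n : ℕ) : ℤ → ℤ :=
  if h : ∃ x : Fin Q.r × ℕ, Q.t x.1 = α ∧ 1 ≤ x.2 ∧ x.2 ≤ Q.uS (Q.s x.1) ∧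
    Q.vertOffset x.1 + x.2 = n then R.nuPage h.choose.1 h.choose.2 else 0

theorem nu_eq (k : Fin Q.r) {q : ℕ} (hq : 1 ≤ q) (hq' : q ≤ Q.uS (Q.s k)) :
    R.nu (Q.t k) (Q.vertOffset k + q) = R.nuPage k q := by
  have h : ∃ x : Fin Q.r × ℕ, Q.t x.1 = Q.t k ∧ 1 ≤ x.2 ∧ x.2 ≤ Q.uS (Q.s x.1) ∧
      Q.vertOffset x.1 + x.2 = Q.vertOffset k + q := ⟨(k, q), rfl, hq, hq', rfl⟩
  rw [nu, dif_pos h]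
  obtain ⟨h1, h2, h3, h4⟩ := h.choose_spec
  obtain ⟨h5, h6⟩ := Q.eq_of_vert h1 h2 h3 hq hq' h4
  rw [h5, h6]

theorem exists_nu_eq {α : T} {n : ℕ} (hn : 1 ≤ n) (hn' : n ≤ Q.vT α) :
    ∃ k q, Q.t k = α ∧ 1 ≤ q ∧ q ≤ Q.uS (Q.s k) ∧ n = Q.vertOffset k + q ∧
      R.nu α n = R.nuPage k q := by
  obtain ⟨k, hk, h1, h2⟩ := Q.exists_vert hn hn'
  subst hk
  obtain ⟨q, rfl⟩ := Nat.exists_eq_add_of_le h1.le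
  exact ⟨k, q, rfl, by omega, by omega, rfl, R.nu_eq k (by omega) (by omega)⟩

theorem nuPage_step (k : Fin Q.r) {q : ℕ} (hq : 1 ≤ q) (hq' : q ≤ Q.uS (Q.s k)) :
    IsStep (R.nuPage k q) := fun d => by
  have := (R.vRow_spec hq hq').1 (d - Q.colOffset k - Q.rowOffset k)
  simp only [nuPage, show d + 1 - (Q.colOffset k : ℤ) - Q.rowOffset k =
    d - Q.colOffset k - Q.rowOffset k + 1 by ring]
  omega

/-- The extension to the south and to the north stays in the columns of the page, so vertical paths
of different pages cannot meet in `A_α`. -/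
theorem nuPage_col (hQ : Q.Admissible) (k : Fin Q.r) {q : ℕ} (hq : 1 ≤ q)
    (hq' : q ≤ Q.uS (Q.s k)) (d : ℤ) : Q.colOffset k + 1 ≤ d + R.nuPage k q d ∧
      d + R.nuPage k q d ≤ Q.colOffset k + Q.mS (Q.s k) := by
  obtain ⟨-, -, -, -, h1, h2⟩ := R.vRow_spec hq hq'
  have e1 := h1 (d - Q.colOffset k - Q.rowOffset k)
  have e2 := h2 (d - Q.colOffset k - Q.rowOffset k)
  have e3 := (hQ.source (Q.s k)).2.1
  simp only [bS] at e1 e3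
  simp only [nuPage]
  omega

/-- The vertex in a given position on a page. -/
theorem exists_vertex {k : Fin Q.r} {i j : ℤ} (h1 : 1 ≤ i) (h2 : i ≤ Q.mT (Q.t k))
    (h3 : 1 ≤ j) (h4 : j ≤ Q.mS (Q.s k)) : ∃ x : Q.Vertex, x.k = k ∧ (x.i : ℤ) = i ∧ (x.j : ℤ) = j :=
  ⟨⟨k, i.toNat, j.toNat, Finset.mem_Icc.2 (by omega), Finset.mem_Icc.2 (by omega)⟩, rfl,
    by simp only; omega, by simp only; omega⟩

theorem mem_H_iff (x : Q.Vertex) {p : ℕ} (hp : 1 ≤ p) (hp' : p ≤ Q.uT (Q.t x.k)) :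
    Q.posT x ∈ R.H (Q.t x.k) p ↔ Through (R.hRow (Q.t x.k) p) (Q.posT x) := by
  have := posT_bounds x
  rw [(R.hRow_spec hp hp').2.1]
  exact ⟨fun h => h.1, fun h => ⟨h, this.2.2⟩⟩

theorem mem_V_iff_nuPage (x : Q.Vertex) {q : ℕ} (hq : 1 ≤ q) (hq' : q ≤ Q.uS (Q.s x.k)) :
    Q.posS x ∈ R.V (Q.s x.k) q ↔ Through (R.nuPage x.k q) (Q.posT x) := by
  have := posT_bounds x.op
  rw [posT_op] at this
  simp only [Prod.fst_swap, Prod.snd_swap] at this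
  rw [(R.vRow_spec hq hq').2.1]
  have e : (Q.posT x).2 - (Q.posT x).1 - Q.colOffset x.k - Q.rowOffset x.k =
    (Q.posS x).2 - (Q.posS x).1 := by simp only [posT, posS]; ring
  simp only [Through, nuPage, e]
  have e' : (Q.posT x).1 = (Q.posS x).1 - Q.rowOffset x.k := by simp only [posT, posS]; ring
  rw [e']
  exact ⟨fun h => by omega, fun h => ⟨by omega, this.2.2⟩⟩

theorem mem_V_iff (x : Q.Vertex) {q : ℕ} (hq : 1 ≤ q) (hq' : q ≤ Q.uS (Q.s x.k)) :
    Q.posS x ∈ R.V (Q.s x.k) q ↔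
      Through (R.nu (Q.t x.k) (Q.vertOffset x.k + q)) (Q.posT x) := by
  rw [R.nu_eq x.k hq hq', R.mem_V_iff_nuPage x hq hq']

theorem onHorizontal_iff (x : Q.Vertex) : R.OnHorizontal x ↔
    SomeThrough (Q.uT (Q.t x.k)) (R.hRow (Q.t x.k)) (Q.posT x) := by
  refine exists_congr fun p => ?_
  rw [Finset.mem_Icc, and_assoc]
  exact and_congr_right fun h1 => and_congr_right fun h2 => R.mem_H_iff x h1 h2

/-- The column of a point on a vertical path determines the page of that path. -/
theorem exists_mem_V_of_nu (hQ : Q.Admissible) (x : Q.Vertex) {n : ℕ} (hn : 1 ≤ n)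
    (hn' : n ≤ Q.vT (Q.t x.k)) (h : Through (R.nu (Q.t x.k) n) (Q.posT x)) :
    ∃ q, 1 ≤ q ∧ q ≤ Q.uS (Q.s x.k) ∧ n = Q.vertOffset x.k + q ∧ Q.posS x ∈ R.V (Q.s x.k) q := by
  obtain ⟨k, q, hk, hq, hq', rfl, he⟩ := R.exists_nu_eq hn hn'
  rw [he] at h
  have hcol := R.nuPage_col hQ k hq hq' ((Q.posT x).2 - (Q.posT x).1)
  rw [h] at hcol
  simp only [posT] at hcol
  have hb := x.bounds
  have h1 := Q.le_of_col hk (j := Q.mS (Q.s k)) (j' := x.j) (by omega) (by omega) (by omega)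
  have h2 := Q.le_of_col hk.symm (j := x.j) (j' := 1) (by omega) (by omega) (by omega)
  obtain rfl := le_antisymm h1 h2
  exact ⟨q, hq, hq', rfl, (R.mem_V_iff_nuPage x hq hq').2 h⟩

theorem onVertical_iff (hQ : Q.Admissible) (x : Q.Vertex) : R.OnVertical x ↔
    SomeThrough (Q.vT (Q.t x.k)) (R.nu (Q.t x.k)) (Q.posT x) := by
  constructor
  · rintro ⟨q, hq, h⟩
    rw [Finset.mem_Icc] at hq
    have := Q.vertOffset_add_le_vT x.k
    exact ⟨Q.vertOffset x.k + q, by omega, by omega, (R.mem_V_iff x hq.1 hq.2).1 h⟩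
  · rintro ⟨n, hn, hn', h⟩
    obtain ⟨q, hq, hq', -, hm⟩ := R.exists_mem_V_of_nu hQ x hn hn' h
    exact ⟨q, Finset.mem_Icc.2 ⟨hq, hq'⟩, hm⟩

variable {R}

theorem exists_nu_of_corner (hQ : Q.Admissible) (hR : R.IsStraight) {α : T} {p : ℕ}
    (hp : 1 ≤ p) (hp' : p ≤ Q.uT α) {c : ℤ × ℤ}
    (hc : IsNWCorner (R.H α p) c ∨ IsSECorner (R.H α p) c) :
    ∃ n, 1 ≤ n ∧ n ≤ Q.vT α ∧ Through (R.nu α n) c := by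
  obtain ⟨-, h2, -, -, h5, h6⟩ := R.hRow_spec hp hp'
  have hmem : c ∈ R.H α p := by rcases hc with hc | hc <;> exact hc.1
  have h3 := (h2 c).1 hmem
  have h4 := h5 (c.2 - c.1)
  have h7 := h6 (c.2 - c.1)
  have h8 := h3.1
  simp only [Through] at h8
  obtain ⟨x, rfl, rfl⟩ := exists_posT (Q := Q) (α := α) (c := c) (by omega) (by omega) h3.2.1 h3.2.2
  exact (R.onVertical_iff hQ x).1 (hR.1 x (hc.imp (fun h => ⟨p, Finset.mem_Icc.2 ⟨hp, hp'⟩, h⟩)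
    (fun h => ⟨p, Finset.mem_Icc.2 ⟨hp, hp'⟩, h⟩)))

/-- The row bounds put the corner and its neighbours on the page, where the extended path agrees
with the given one and straightness applies. -/
theorem exists_hRow_of_corner (hQ : Q.Admissible) (hR : R.IsStraight) {k : Fin Q.r} {q : ℕ}
    (hq : 1 ≤ q) (hq' : q ≤ Q.uS (Q.s k)) {d : ℤ} (h1 : 1 ≤ R.nuPage k q d)
    (h2 : R.nuPage k q d ≤ Q.aT (Q.t k))
    (hc : (R.nuPage k q (d - 1) = R.nuPage k q d + 1 ∧ R.nuPage k q (d + 1) = R.nuPage k q d ∧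
        R.nuPage k q d < Q.aT (Q.t k)) ∨
      (R.nuPage k q (d - 1) = R.nuPage k q d ∧ R.nuPage k q (d + 1) = R.nuPage k q d - 1 ∧
        1 < R.nuPage k q d)) :
    ∃ p, 1 ≤ p ∧ p ≤ Q.uT (Q.t k) ∧ R.hRow (Q.t k) p d = R.nuPage k q d := by
  have hcol := R.nuPage_col hQ k hq hq' d
  have hcol1 := R.nuPage_col hQ k hq hq' (d + 1)
  have hcol2 := R.nuPage_col hQ k hq hq' (d - 1)
  simp only [aT] at h2 hc
  obtain ⟨x, rfl, hi, hj⟩ := exists_vertex (Q := Q) (k := k) (i := R.nuPage k q d)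
    (j := d + R.nuPage k q d - Q.colOffset k) h1 h2 (by omega) (by omega)
  have hmem : ∀ {e i j : ℤ}, j - i = e → 1 ≤ i → i ≤ Q.mT (Q.t x.k) → R.nuPage x.k q e = i →
      (Q.rowOffset x.k + i, j - Q.colOffset x.k) ∈ R.V (Q.s x.k) q := by
    intro e i j he hi hi' hn
    have hcole := R.nuPage_col hQ x.k hq hq' e
    obtain ⟨y, hyk, hyi, hyj⟩ := exists_vertex (Q := Q) (k := x.k) (i := i)
      (j := j - Q.colOffset x.k) hi hi' (by omega) (by omega)
    have := R.mem_V_iff_nuPage y (q := q) hq (by rw [hyk]; exact hq')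
    rw [hyk] at this
    have hS : Q.posS y = (Q.rowOffset x.k + i, j - Q.colOffset x.k) := by
      simp only [posS, hyk, hyi, hyj]
    rw [hS] at this
    refine this.2 ?_
    have hT : Q.posT y = (i, j) := by
      simp only [posT, hyk, hyi, hyj, Prod.mk.injEq, true_and]; ring
    rw [hT, through_iff he]
    exact hn
  have hposS : Q.posS x = (Q.rowOffset x.k + R.nuPage x.k q d,
      d + R.nuPage x.k q d - Q.colOffset x.k) := by simp only [posS, hi, hj]
  have hposT : Q.posT x = (R.nuPage x.k q d, d + R.nuPage x.k q d) := by
    simp only [posT, hi, hj, Prod.mk.injEq, true_and]; ring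
  have hon : R.OnHorizontal x := by
    refine hR.2 x (hc.imp (fun h => ⟨q, Finset.mem_Icc.2 ⟨hq, hq'⟩, ?_⟩)
      (fun h => ⟨q, Finset.mem_Icc.2 ⟨hq, hq'⟩, ?_⟩))
    · rw [hposS]
      refine ⟨hmem (e := d) (by ring) h1 h2 rfl, ?_, ?_⟩
      · have := hmem (e := d - 1) (i := R.nuPage x.k q d + 1) (j := d + R.nuPage x.k q d) (by ring)
          (by omega) (by omega) h.1
        rwa [← add_assoc] at this
      · have := hmem (e := d + 1) (i := R.nuPage x.k q d) (j := d + R.nuPage x.k q d + 1) (by ring)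
          (by omega) (by omega) h.2.1
        rwa [add_sub_right_comm] at this
    · rw [hposS]
      refine ⟨hmem (e := d) (by ring) h1 h2 rfl, ?_, ?_⟩
      · have := hmem (e := d + 1) (i := R.nuPage x.k q d - 1) (j := d + R.nuPage x.k q d) (by ring)
          (by omega) (by omega) h.2.1
        rwa [← add_sub_assoc] at this
      · have := hmem (e := d - 1) (i := R.nuPage x.k q d) (j := d + R.nuPage x.k q d - 1) (by ring)
          (by omega) (by omega) h.1
        rwa [sub_right_comm] at this
  obtain ⟨p, hp, hp', h⟩ := (R.onHorizontal_iff x).1 hon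
  rw [hposT, through_iff (d := d) (by ring)] at h
  exact ⟨p, hp, hp', h⟩

theorem grid (hQ : Q.Admissible) (hR : R.IsStraight) (α : T) :
    Grid (Q.aT α) (Q.bT α) (Q.uT α) (Q.vT α) (R.hRow α) (R.nu α) where
  stepH p hp hp' := (R.hRow_spec hp hp').1
  stepV n hn hn' := by
    obtain ⟨k, q, rfl, hq, hq', rfl, he⟩ := R.exists_nu_eq hn hn'
    rw [he]
    exact R.nuPage_step k hq hq'
  lt_H p p' hp hpp' hp' d := R.hRow_lt hp hpp' hp' d
  lt_V n n' hn hnn' hn' d := by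
    obtain ⟨k, q, rfl, hq, hq', rfl, he⟩ := R.exists_nu_eq hn (hnn'.le.trans hn')
    obtain ⟨k', q', hk, h1, h2, rfl, he'⟩ := R.exists_nu_eq (by omega) hn'
    rw [he, he']
    have hle := Q.le_of_vert hk (q := q') (q' := q) (by omega) (by omega) (by omega)
    -- Paths of different pages are ordered by their columns, paths of the same page by `vRow_lt`.
    rcases hle.lt_or_eq with h | h
    · have := R.nuPage_col hQ k hq hq' d
      have := R.nuPage_col hQ k' h1 h2 d
      have := Q.colOffset_add_le hk.symm h
      omega
    · subst h
      have := R.vRow_lt hq (show q < q' by omega) h2 (d - Q.colOffset k - Q.rowOffset k)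
      simp only [nuPage]
      omega
  row_ge p hp hp' := (R.hRow_spec hp hp').2.2.2.2.2
  row_le p hp hp' := (R.hRow_spec hp hp').2.2.2.2.1
  left p hp hp' := (R.hRow_spec hp hp').2.2.1
  right p hp hp' := (R.hRow_spec hp hp').2.2.2.1
  col_pos n hn hn' d := by
    obtain ⟨k, q, rfl, hq, hq', rfl, he⟩ := R.exists_nu_eq hn hn'
    have := R.nuPage_col hQ k hq hq' d
    rw [he]; omega
  col_le n hn hn' d := by
    obtain ⟨k, q, rfl, hq, hq', rfl, he⟩ := R.exists_nu_eq hn hn'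
    have := R.nuPage_col hQ k hq hq' d
    have := Q.colOffset_add_le_bT k
    rw [he]; omega
  nwH p hp hp' d h1 h2 h3 h4 := by
    have hmem := (R.hRow_spec hp hp').2.1
    have e0 : (R.hRow α p d, d + R.hRow α p d) ∈ R.H α p :=
      (hmem _).2 ⟨(through_iff (d := d) (by ring)).2 rfl, by simp only; omega⟩
    obtain ⟨n, hn, hn', h⟩ := exists_nu_of_corner hQ hR hp hp' (Or.inl ⟨e0,
      (hmem _).2 ⟨(through_iff (d := d - 1) (by ring)).2 h1, by simp only; omega⟩,
      (hmem _).2 ⟨(through_iff (d := d + 1) (by ring)).2 h2, by simp only; omega⟩⟩)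
    exact ⟨n, hn, hn', (through_iff (by ring)).1 h⟩
  seH p hp hp' d h1 h2 h3 h4 := by
    have hmem := (R.hRow_spec hp hp').2.1
    have e0 : (R.hRow α p d, d + R.hRow α p d) ∈ R.H α p :=
      (hmem _).2 ⟨(through_iff (d := d) (by ring)).2 rfl, by simp only; omega⟩
    obtain ⟨n, hn, hn', h⟩ := exists_nu_of_corner hQ hR hp hp' (Or.inr ⟨e0,
      (hmem _).2 ⟨(through_iff (d := d + 1) (by ring)).2 h2, by simp only; omega⟩,
      (hmem _).2 ⟨(through_iff (d := d - 1) (by ring)).2 h1, by simp only; omega⟩⟩)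
    exact ⟨n, hn, hn', (through_iff (by ring)).1 h⟩
  nwV n hn hn' d h1 h2 h3 h4 := by
    obtain ⟨k, q, rfl, hq, hq', rfl, he⟩ := R.exists_nu_eq hn hn'
    rw [he] at h1 h2 h3 h4 ⊢
    exact exists_hRow_of_corner hQ hR hq hq' h3 h4.le (Or.inl ⟨h1, h2, h4⟩)
  seV n hn hn' d h1 h2 h3 h4 := by
    obtain ⟨k, q, rfl, hq, hq', rfl, he⟩ := R.exists_nu_eq hn hn'
    rw [he] at h1 h2 h3 h4 ⊢
    exact exists_hRow_of_corner hQ hR hq hq' h3.le h4 (Or.inr ⟨h1, h2, h3⟩)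

end RoadMap
end BipartiteData

/-! ### Diagonal chains and essential NW corners. -/

namespace BipartiteData

section Chains

/-- `d` lies strictly SE of `c`. -/
def Diag (c d : ℤ × ℤ) : Prop := c.1 < d.1 ∧ c.2 < d.2

theorem Diag.trans {c d e : ℤ × ℤ} (h : Diag c d) (h' : Diag d e) : Diag c e :=
  ⟨h.1.trans h'.1, h.2.trans h'.2⟩

/-- `X` contains a diagonal chain of `n` points strictly NW of `c`. -/
def NWChain (X : Set (ℤ × ℤ)) (c : ℤ × ℤ) (n : ℕ) : Prop :=
  ∃ l : List (ℤ × ℤ), l.length = n ∧ l.Pairwise Diag ∧ ∀ y ∈ l, y ∈ X ∧ Diag y c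

/-- `X` contains a diagonal chain of `n` points strictly SE of `c`. -/
def SEChain (X : Set (ℤ × ℤ)) (c : ℤ × ℤ) (n : ℕ) : Prop :=
  ∃ l : List (ℤ × ℤ), l.length = n ∧ l.Pairwise Diag ∧ ∀ y ∈ l, y ∈ X ∧ Diag c y

variable {X : Set (ℤ × ℤ)} {c d : ℤ × ℤ} {n m : ℕ}

theorem NWChain.zero (X : Set (ℤ × ℤ)) (c : ℤ × ℤ) : NWChain X c 0 := ⟨[], by simp⟩

theorem SEChain.zero (X : Set (ℤ × ℤ)) (c : ℤ × ℤ) : SEChain X c 0 := ⟨[], by simp⟩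

theorem NWChain.succ (h : NWChain X d n) (hd : d ∈ X) (hdc : Diag d c) : NWChain X c (n + 1) := by
  obtain ⟨l, h1, h2, h3⟩ := h
  refine ⟨l ++ [d], by simp [h1], ?_, ?_⟩
  · rw [List.pairwise_append]
    exact ⟨h2, by simp, fun a ha b hb => by
      rw [List.mem_singleton] at hb
      exact hb ▸ (h3 a ha).2⟩
  · intro y hy
    rw [List.mem_append, List.mem_singleton] at hy
    rcases hy with hy | rfl
    · exact ⟨(h3 y hy).1, (h3 y hy).2.trans hdc⟩
    · exact ⟨hd, hdc⟩

theorem SEChain.succ (h : SEChain X d n) (hd : d ∈ X) (hcd : Diag c d) : SEChain X c (n + 1) := by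
  obtain ⟨l, h1, h2, h3⟩ := h
  refine ⟨d :: l, by simp [h1], ?_, ?_⟩
  · rw [List.pairwise_cons]
    exact ⟨fun a ha => (h3 a ha).2, h2⟩
  · intro y hy
    rw [List.mem_cons] at hy
    rcases hy with rfl | hy
    · exact ⟨hd, hcd⟩
    · exact ⟨(h3 y hy).1, hcd.trans (h3 y hy).2⟩

theorem NWChain.join (h : NWChain X c n) (hc : c ∈ X) (h' : SEChain X c m) :
    HasDiagonalChain X (n + m + 1) := by
  obtain ⟨l, h1, h2, h3⟩ := h
  obtain ⟨l', h1', h2', h3'⟩ := h'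
  have hpw : (l ++ c :: l').Pairwise Diag := by
    rw [List.pairwise_append, List.pairwise_cons]
    refine ⟨h2, ⟨fun a ha => (h3' a ha).2, h2'⟩, fun a ha b hb => ?_⟩
    rw [List.mem_cons] at hb
    rcases hb with rfl | hb
    · exact (h3 a ha).2
    · exact (h3 a ha).2.trans (h3' b hb).2
  have hlen : (l ++ c :: l').length = n + m + 1 := by simp [h1, h1']; ring
  rw [← hlen]
  refine ⟨fun a => (l ++ c :: l').get a, fun a => ?_, fun a b hab => ?_⟩
  · have := List.get_mem (l ++ c :: l') a
    rw [List.mem_append, List.mem_cons] at this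
    rcases this with h | h | h
    · exact (h3 _ h).1
    · show (l ++ c :: l').get a ∈ X
      rw [h]
      exact hc
    · exact (h3' _ h).1
  · exact List.pairwise_iff_get.1 hpw a b hab

theorem SEChain.mono {Y : Set (ℤ × ℤ)} (h : SEChain X c n)
    (hXY : ∀ y ∈ X, Diag c y → y ∈ Y) : SEChain Y c n := by
  obtain ⟨l, h1, h2, h3⟩ := h
  exact ⟨l, h1, h2, fun y hy => ⟨hXY y (h3 y hy).1 (h3 y hy).2, (h3 y hy).2⟩⟩

theorem HasDiagonalChain.of_swap {X Y : Set (ℤ × ℤ)} (hXY : ∀ c ∈ X, c.swap ∈ Y)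
    (h : HasDiagonalChain X n) : HasDiagonalChain Y n := by
  obtain ⟨f, h1, h2⟩ := h
  exact ⟨fun a => (f a).swap, fun a => hXY _ (h1 a), fun a b hab => (h2 a b hab).symm⟩

end Chains

namespace IsStep

variable {f : ℤ → ℤ} {c d : ℤ × ℤ}

/-- A point strictly SE of a point of the path is strictly SE of the path; hence a path never
contains two points of a diagonal chain. -/
theorem lt_of_diag (hf : IsStep f) (hc : Through f c) (h : Diag c d) :
    f (d.2 - d.1) < d.1 := by
  have h1 := h.1
  have h2 := h.2
  simp only [Through] at hc
  rcases le_total (c.2 - c.1) (d.2 - d.1) with h3 | h3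
  · have := hf.antitone h3
    omega
  · have := hf.col_mono h3
    omega

end IsStep

namespace Grid

variable {a b u v : ℕ} {ρ ν : ℕ → ℤ → ℤ} (G : Grid a b u v ρ ν)
include G

theorem ν_lt_of_diag {n n' : ℕ} {c d : ℤ × ℤ} (hn : 1 ≤ n) (hn' : n ≤ v) (h1 : 1 ≤ n')
    (hc : Through (ν n) c) (hd : Through (ν n') d) (h : Diag c d) : n < n' := by
  have h2 := (G.stepV n hn hn').lt_of_diag hc h
  exact G.lt_of_ν_lt hn' h1 (d := d.2 - d.1) (by rw [hd]; exact h2)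

theorem ρ_lt_of_diag {p p' : ℕ} {c d : ℤ × ℤ} (hp : 1 ≤ p) (hp' : p ≤ u) (h1 : 1 ≤ p')
    (hc : Through (ρ p) c) (hd : Through (ρ p') d) (h : Diag c d) : p < p' := by
  have h2 := (G.stepH p hp hp').lt_of_diag hc h
  exact G.lt_of_ρ_lt hp' h1 (d := d.2 - d.1) (by rw [hd]; exact h2)

theorem ν_unique {n n' : ℕ} {c : ℤ × ℤ} (hn : 1 ≤ n) (hn' : n ≤ v) (h1 : 1 ≤ n') (h2 : n' ≤ v)
    (hc : Through (ν n) c) (hc' : Through (ν n') c) : n = n' := by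
  simp only [Through] at hc hc'
  rcases lt_trichotomy n n' with h | h | h
  · have := G.lt_V n n' hn h h2 (c.2 - c.1)
    omega
  · exact h
  · have := G.lt_V n' n h1 h hn' (c.2 - c.1)
    omega

/-- The chain of SE corners SE of a point that lies between two horizontal paths. -/
theorem seChain : ∀ (s m : ℕ) (c : ℤ × ℤ), m + s = u →
    (m < u → c.1 < ρ (m + 1) (c.2 - c.1) ∧ (m + 1 : ℤ) ≤ c.1) → 1 ≤ c.2 →
    SEChain {y | SomeThrough u ρ y ∧ SomeThrough v ν y ∧ 1 ≤ y.2 ∧ y.2 ≤ b} c s ∧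
      ∀ n z, 1 ≤ n → n ≤ v → Through (ν n) z → z.1 ≤ c.1 → z.2 ≤ c.2 → n + s ≤ v := by
  intro s
  induction s with
  | zero => exact fun m c _ _ _ => ⟨SEChain.zero _ _, fun n z _ hn _ _ _ => hn⟩
  | succ s ih =>
    intro m c hm hc hcol
    obtain ⟨h1, h2⟩ := hc (by omega)
    -- The next point is a SE corner of `ρ (m + 1)`, which is NW of `ρ (m + 2)`. The vertical paths
    -- through the chain have increasing indices, all beyond that of a path through `z`; hence the
    -- bound on `n`.
    obtain ⟨e, -, -, h3, h4, h5, n', hn1, hn2, hn3⟩ := G.exists_seH (p := m + 1) (by omega)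
      (by omega) h1 (by push_cast; omega) (by omega)
    have hdiag : Diag c (ρ (m + 1) e, e + ρ (m + 1) e) := ⟨h3, by simp only; omega⟩
    have hthr : Through (ν n') (ρ (m + 1) e, e + ρ (m + 1) e) :=
      (through_iff (d := e) (by ring)).2 hn3
    obtain ⟨h6, h7⟩ := ih (m + 1) (ρ (m + 1) e, e + ρ (m + 1) e) (by omega) (fun hlt => by
      simp only [add_sub_cancel_right]
      have := G.lt_H (m + 1) (m + 1 + 1) (by omega) (by omega) (by omega) e
      exact ⟨this, by push_cast; omega⟩) (by simp only; omega)
    refine ⟨h6.succ ⟨⟨m + 1, by omega, by omega, (through_iff (d := e) (by ring)).2 rfl⟩,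
      ⟨n', hn1, hn2, hthr⟩, by simp only; omega, h5⟩ hdiag, fun n z hn hn' hz hz1 hz2 => ?_⟩
    have h8 := h7 n' _ hn1 hn2 hthr le_rfl le_rfl
    have h9 := G.ν_lt_of_diag hn hn' hn1 hz hthr
      ⟨by simp only; omega, by simp only; omega⟩
    omega

end Grid

variable {T S : Type*} [DecidableEq T] [DecidableEq S] {Q : BipartiteData T S}

/-- `y` lies on a later page than `x` or strictly SE of `x` on the same page. -/
def Later (x y : Q.Vertex) : Prop := x.k < y.k ∨ x.k = y.k ∧ x.i < y.i ∧ x.j < y.j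

/-- Unlike `<_T`, the relation `Later` is invariant under transposition, and it replaces `<_T`
wherever a statement is transposed. -/
theorem Later.lt {x y : Q.Vertex} (h : Later x y) : x < y := by
  rw [Vertex.lt_iff]
  rcases h with h | h
  · exact Or.inl h
  · exact Or.inr (Or.inl ⟨h.1, h.2.1⟩)

theorem diag_posT {x y : Q.Vertex} (h : x.k = y.k) (hi : x.i < y.i) (hj : x.j < y.j) :
    Diag (Q.posT x) (Q.posT y) := by
  simp only [Diag, posT, h]
  omega

theorem later_of_diag {x y : Q.Vertex} (h : Q.t x.k = Q.t y.k) (hd : Diag (Q.posT x) (Q.posT y)) :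
    Later x y := by
  rcases page_of_posT_lt h hd.2 with h1 | h1
  · exact Or.inl h1
  · have := hd.1
    simp only [posT] at this
    exact Or.inr ⟨h1.1, by omega, h1.2⟩

namespace RoadMap

theorem op_op (R : Q.RoadMap) : R.op.op = R := by
  obtain ⟨H, V, _, _, _, _⟩ := R
  simp only [op, List.map_reverse, List.reverse_reverse, List.map_map, Prod.swap_swap_eq,
    List.map_id]
  rfl

/-- The essential NW corners. -/
def IsEssentialNWCorner (R : Q.RoadMap) (x : Q.Vertex) : Prop :=
  R.IsEssentialHorizontalNWCorner x ∨ R.IsEssentialVerticalNWCorner x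

theorem isEssentialNWCorner_op (R : Q.RoadMap) (x : Q.Vertex) :
    R.op.IsEssentialNWCorner x.op ↔ R.IsEssentialNWCorner x := by
  unfold IsEssentialNWCorner
  rw [R.isEssentialHorizontalNWCorner_op, R.isEssentialVerticalNWCorner_op, or_comm]

theorem H_unique (R : Q.RoadMap) {α : T} {c : ℤ × ℤ} {p p' : ℕ} (hp : 1 ≤ p) (hp' : p ≤ Q.uT α) (h1 : 1 ≤ p')
    (h2 : p' ≤ Q.uT α) (h : c ∈ R.H α p) (h' : c ∈ R.H α p') : p = p' := by
  by_contra hne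
  exact R.H_disjoint α p (Finset.mem_Icc.2 ⟨hp, hp'⟩) p' (Finset.mem_Icc.2 ⟨h1, h2⟩) hne h h'

variable {R : Q.RoadMap} (hQ : Q.Admissible) (hR : R.IsStraight)
include hQ hR

/-- The horizontal and the vertical path through a point are unique, so the index equation that
makes a corner inessential can hold for `m` and `n` only. -/
theorem essential_of_ne {y : Q.Vertex} {m n : ℕ} (hm : 1 ≤ m) (hm' : m ≤ Q.uT (Q.t y.k))
    (hc : IsNWCorner (R.H (Q.t y.k) m) (Q.posT y)) (hn : 1 ≤ n) (hn' : n ≤ Q.vT (Q.t y.k))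
    (hthr : Through (R.nu (Q.t y.k) n) (Q.posT y))
    (hne : n + Q.uT (Q.t y.k) ≠ m + Q.vT (Q.t y.k)) : R.IsEssentialNWCorner y := by
  refine Or.inl ⟨⟨m, Finset.mem_Icc.2 ⟨hm, hm'⟩, hc⟩, ?_⟩
  rintro ⟨p, hp, q, hq, he, ⟨h1, h2⟩, -⟩
  rw [Finset.mem_Icc] at hp hq
  obtain rfl := R.H_unique hp.1 hp.2 hm hm' h1 hc.1
  have := Q.vertOffset_add_le_vT y.k
  have := (grid hQ hR (Q.t y.k)).ν_unique (by omega) (by omega) hn hn'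
    ((R.mem_V_iff y hq.1 hq.2).1 h2) hthr
  omega

/-- The NW corner of `H m` next to a point SE of `H m`. -/
theorem exists_nwCorner {x : Q.Vertex} {m : ℕ} (hm : 1 ≤ m) (hm' : m ≤ Q.uT (Q.t x.k))
    (h1 : R.hRow (Q.t x.k) m ((Q.posT x).2 - (Q.posT x).1) < (Q.posT x).1)
    (h2 : (Q.posT x).1 ≤ Q.aT (Q.t x.k) - Q.uT (Q.t x.k) + m) :
    ∃ y : Q.Vertex, Q.t y.k = Q.t x.k ∧ IsNWCorner (R.H (Q.t x.k) m) (Q.posT y) ∧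
      Diag (Q.posT y) (Q.posT x) ∧
      (∀ w ∈ R.H (Q.t x.k) m, w.1 < (Q.posT x).1 → (Q.posT y).2 ≤ w.2) ∧
      ∃ n, 1 ≤ n ∧ n ≤ Q.vT (Q.t x.k) ∧ Through (R.nu (Q.t x.k) n) (Q.posT y) := by
  have hb := posT_bounds x
  have G := grid hQ hR (Q.t x.k)
  have hspec := (R.hRow_spec hm hm').2.1
  obtain ⟨e, e1, e2, e3, e4, e5, e6, n, hn, hn', e7⟩ := G.exists_nwH hm hm' h1 h2 (by omega)
  have hrow := G.row_bounds hm hm' e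
  obtain ⟨y, hy, hpos⟩ := exists_posT (Q := Q) (α := Q.t x.k)
    (c := (R.hRow (Q.t x.k) m e, e + R.hRow (Q.t x.k) m e)) hrow.1 hrow.2 e5
    (by simp only; omega)
  refine ⟨y, hy, ?_, ?_, fun w hw hw1 => ?_, n, hn, hn', ?_⟩
  · rw [hpos]
    refine ⟨(hspec _).2 ⟨?_, ?_⟩, (hspec _).2 ⟨?_, ?_⟩, (hspec _).2 ⟨?_, ?_⟩⟩
    · exact (through_iff (d := e) (by ring)).2 rfl
    · simp only; omega
    · exact (through_iff (d := e - 1) (by ring)).2 e1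
    · simp only; omega
    · exact (through_iff (d := e + 1) (by ring)).2 e2
    · simp only; omega
  · rw [hpos]
    exact ⟨e3, by simp only; omega⟩
  · rw [hpos]
    have h3 := ((hspec w).1 hw).1
    simp only [Through] at h3
    have := e6 (w.2 - w.1) (by omega)
    simp only
    omega
  · rw [hpos]
    exact (through_iff (d := e) (by ring)).2 e7

/-- If there are enough vertical paths SE of a point, there is a full chain of essential corners
NW of it. -/
theorem nwChain_of_index {α : T} {X : Set (ℤ × ℤ)}
    (hX : ∀ y, Q.t y.k = α → R.IsEssentialNWCorner y → Q.posT y ∈ X) :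
    ∀ (m n : ℕ) (x : Q.Vertex), Q.t x.k = α → m ≤ Q.uT α → 1 ≤ n → n ≤ Q.vT α →
      Through (R.nu α n) (Q.posT x) → n + Q.uT α ≤ m + Q.vT α →
      (1 ≤ m → R.hRow α m ((Q.posT x).2 - (Q.posT x).1) < (Q.posT x).1 ∧
        (Q.posT x).1 ≤ Q.aT α - Q.uT α + m) → NWChain X (Q.posT x) m := by
  intro m
  induction m with
  | zero => exact fun _ _ _ _ _ _ _ _ _ => NWChain.zero _ _
  | succ m ih =>
    intro n x hx hm hn hn' hthr hle hcond
    subst hx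
    obtain ⟨h1, h2⟩ := hcond (by omega)
    have G := grid hQ hR (Q.t x.k)
    obtain ⟨y, hy, h3, h4, -, n', hn1, hn2, h5⟩ := exists_nwCorner hQ hR (by omega) hm h1 h2
    -- The corner lies strictly NW of a point of `ν n`, so `n' < n`. The inequality `hle` thus
    -- becomes strict for the corner, which is therefore essential, and the weak form survives for
    -- `m`.
    have hlt := G.ν_lt_of_diag hn1 hn2 hn h5 hthr h4
    have hess : R.IsEssentialNWCorner y := by
      rw [← hy] at h3 hn2 h5
      exact essential_of_ne hQ hR (by omega) (by rw [hy]; exact hm) h3 hn1 hn2 h5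
        (by rw [hy]; omega)
    refine (ih n' y hy (by omega) hn1 hn2 h5 (by omega) fun hm1 => ?_).succ (hX y hy hess) h4
    have h6 := (((R.hRow_spec (by omega) hm).2.1 _).1 h3.1).1
    have h7 := G.lt_H m (m + 1) hm1 (by omega) hm ((Q.posT y).2 - (Q.posT y).1)
    have h8 := h4.1
    simp only [Through] at h6
    push_cast at h2
    omega

end RoadMap

/-! ### NW chains in one of the two arrays containing a point. -/

/-- The horizontal paths NW of `c` are those of index at most `p`, and there are at least as many
vertical paths SE of the points NW of `c` as there are horizontal paths of larger index. -/
structure Side (R : Q.RoadMap) (c : Q.Vertex) (p : ℕ) : Prop where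
  le : p ≤ Q.uT (Q.t c.k)
  above : 1 ≤ p → R.hRow (Q.t c.k) p ((Q.posT c).2 - (Q.posT c).1) < (Q.posT c).1 ∧
    (Q.posT c).1 ≤ Q.aT (Q.t c.k) - Q.uT (Q.t c.k) + p
  bound : ∀ (y : Q.Vertex) (n : ℕ), Q.t y.k = Q.t c.k → Diag (Q.posT y) (Q.posT c) → 1 ≤ n →
    n ≤ Q.vT (Q.t c.k) → Through (R.nu (Q.t c.k) n) (Q.posT y) →
    n + Q.uT (Q.t c.k) ≤ p + Q.vT (Q.t c.k)
  last : ∀ (y : Q.Vertex) (p' : ℕ), y.k = c.k → y.i < c.i → y.j < c.j → 1 ≤ p' →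
    p' ≤ Q.uT (Q.t c.k) → Q.posT y ∈ R.H (Q.t c.k) p' → p' ≤ p

namespace Side

open RoadMap

variable {R : Q.RoadMap} (hQ : Q.Admissible) (hR : R.IsStraight)
include hQ hR

/-- Moving from `c` to a point of `H (p + 1)` NW of it uses up one horizontal path and at least one
vertical path, so the balance in `bound` is kept. -/
theorem step {c a : Q.Vertex} {p q : ℕ} (h : Side R c (p + 1)) (hk : a.k = c.k) (hi : a.i < c.i)
    (hj : a.j < c.j) (hH : Q.posT a ∈ R.H (Q.t a.k) (p + 1)) (hq : 1 ≤ q)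
    (hq' : q ≤ Q.uS (Q.s a.k)) (hV : Q.posS a ∈ R.V (Q.s a.k) q) : Side R a p := by
  have hdiag := diag_posT hk hi hj
  obtain ⟨h1, h2, h3, h4⟩ := h
  rw [← hk] at h1 h2 h3 h4
  have G := grid hQ hR (Q.t a.k)
  have hthr := (R.mem_H_iff a (p := p + 1) (by omega) h1).1 hH
  have hv := Q.vertOffset_add_le_vT a.k
  have hthrV := (R.mem_V_iff a hq hq').1 hV
  have hidx := h3 a (Q.vertOffset a.k + q) rfl hdiag (by omega) (by omega) hthrV
  refine ⟨by omega, fun hp => ?_, fun y n hy hd hn hn' hth => ?_, fun y p' hy hyi hyj hp hp' hm => ?_⟩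
  · have := G.lt_H p (p + 1) hp (by omega) h1 ((Q.posT a).2 - (Q.posT a).1)
    have h5 := (h2 (by omega)).2
    have h6 := hdiag.1
    rw [Through] at hthr
    push_cast at h5
    omega
  · have := G.ν_lt_of_diag hn hn' (by omega) hth hthrV hd
    omega
  · rw [← hy] at hm hp'
    have hth := (R.mem_H_iff y hp hp').1 hm
    rw [hy] at hth hp'
    have := G.ρ_lt_of_diag hp hp' (by omega) hth hthr (diag_posT hy hyi hyj)
    omega

/-- A horizontal path NW of `c` passes through a point NW of `c` on the same page. -/
theorem exists_page {c : Q.Vertex} {p : ℕ} (h : Side R c p) (hp : 1 ≤ p) (hj : 2 ≤ c.j) :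
    ∃ y : Q.Vertex, y.k = c.k ∧ y.i < c.i ∧ y.j < c.j ∧ Q.posT y ∈ R.H (Q.t y.k) p := by
  have G := grid hQ hR (Q.t c.k)
  have hf := G.stepH p hp h.le
  have h1 := (h.above hp).1
  have hrow := fun d => G.row_bounds hp h.le d
  have hb := c.bounds
  -- The point wanted is the last one of `H p` in the column to the left of `c`, a column of the
  -- same page since `2 ≤ c.j`.
  obtain ⟨e, he1, he2⟩ := Int.exists_greatest_of_bdd
    (P := fun e => e + R.hRow (Q.t c.k) p e ≤ (Q.posT c).2 - 1)
    ⟨(Q.posT c).2, fun z hz => by have := hrow z; omega⟩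
    ⟨(Q.posT c).2 - (Q.posT c).1, by omega⟩
  have he3 : ¬ (e + 1 + R.hRow (Q.t c.k) p (e + 1) ≤ (Q.posT c).2 - 1) := fun hcon => by
    have := he2 _ hcon
    omega
  have he4 : e + R.hRow (Q.t c.k) p e = (Q.posT c).2 - 1 := by
    rcases hf e with h | h <;> omega
  have he5 := hf.antitone (he2 ((Q.posT c).2 - (Q.posT c).1) (by omega))
  have he6 := hrow e
  simp only [aT] at he6
  obtain ⟨y, hyk, hyi, hyj⟩ := exists_vertex (Q := Q) (k := c.k) (i := R.hRow (Q.t c.k) p e)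
    (j := c.j - 1) he6.1 he6.2 (by omega) (by omega)
  have hc1 : (Q.posT c).1 = c.i := rfl
  refine ⟨y, hyk, by omega, by omega, (R.mem_H_iff y hp (by rw [hyk]; exact h.le)).2 ?_⟩
  rw [hyk]
  have : Q.posT y = (R.hRow (Q.t c.k) p e, e + R.hRow (Q.t c.k) p e) := by
    rw [he4]
    simp only [posT, hyk, hyi, hyj, Prod.mk.injEq, true_and]
    ring
  rw [this]
  exact (through_iff (by ring)).2 rfl

theorem two_le {c : Q.Vertex} {p : ℕ} (h : Side R c p) (hp : 1 ≤ p) : 2 ≤ c.i := by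
  have h1 := (h.above hp).1
  have h2 := (grid hQ hR (Q.t c.k)).row_bounds hp h.le ((Q.posT c).2 - (Q.posT c).1)
  have hc1 : (Q.posT c).1 = c.i := rfl
  omega

/-- Either there is a full chain of essential corners NW of `c`, or the next NW corner of `H p` lies
on the next vertical path on the same page. -/
theorem chain_or_corner {c : Q.Vertex} {p q : ℕ} (h : Side R c (p + 1))
    (h' : Side R.op c.op (q + 1)) {X : Set (ℤ × ℤ)}
    (hX : ∀ y, Q.t y.k = Q.t c.k → R.IsEssentialNWCorner y → Q.posT y ∈ X) :
    NWChain X (Q.posT c) (p + 1) ∨ ∃ a : Q.Vertex, a.k = c.k ∧ a.i < c.i ∧ a.j < c.j ∧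
      IsNWCorner (R.H (Q.t a.k) (p + 1)) (Q.posT a) ∧ Q.posS a ∈ R.V (Q.s a.k) (q + 1) ∧
      ∀ w ∈ R.H (Q.t a.k) (p + 1), w.1 < (Q.posT c).1 → (Q.posT a).2 ≤ w.2 := by
  have hQ' := hQ.op
  have hR' := hR.op
  have G := grid hQ hR (Q.t c.k)
  have hle := h.le
  have hleq : q + 1 ≤ Q.uS (Q.s c.k) := h'.le
  obtain ⟨a, ha, h1, h2, h3, n, hn, hn', h4⟩ := exists_nwCorner hQ hR (by omega) h.le
    (h.above (by omega)).1 (h.above (by omega)).2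
  have hb := h.bound a n ha h2 hn hn' h4
  -- With strict inequality the corner is essential, and so are the ones that `nwChain_of_index`
  -- finds after it.
  by_cases hlt : n + Q.uT (Q.t c.k) < p + 1 + Q.vT (Q.t c.k)
  · left
    have hess : R.IsEssentialNWCorner a := by
      have h1' := h1
      have hn2 := hn'
      have h5 := h4
      rw [← ha] at h1' hn2 h5
      exact essential_of_ne hQ hR (by omega) (by rw [ha]; exact hle) h1' hn hn2 h5
        (by rw [ha]; omega)
    refine (nwChain_of_index hQ hR hX p n a ha (by omega) hn hn' h4 (by omega) fun hp => ?_).succ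
      (hX a ha hess) h2
    have h6 := (((R.hRow_spec (by omega) hle).2.1 _).1 h1.1).1
    have h7 := G.lt_H p (p + 1) hp (by omega) hle ((Q.posT a).2 - (Q.posT a).1)
    have h8 := h2.1
    have h9 := (h.above (by omega)).2
    simp only [Through] at h6
    push_cast at h9
    omega
  · right
    have hci : 2 ≤ c.i := h.two_le hQ hR (by omega)
    -- With equality, `n` is the largest index allowed by `bound`, hence at least that of `V (q +
    -- 1)`, which has a point `y` NW of `c` on the page. So `a` is on this page, and `last` for the
    -- vertical paths gives the opposite inequality.
    obtain ⟨y, hyk, hyi, hyj, hy⟩ := h'.exists_page hQ' hR' (by omega) hci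
    obtain ⟨y, rfl⟩ : ∃ z : Q.Vertex, y = z.op := ⟨⟨y.k, y.j, y.i, y.hj, y.hi⟩, rfl⟩
    have hyV : Q.posS y ∈ R.V (Q.s y.k) (q + 1) := (R.mem_op_H y (q + 1)).1 hy
    have hyk' : y.k = c.k := hyk
    have hyi' : y.i < c.i := hyj
    have hyj' : y.j < c.j := hyi
    have hthr := (R.mem_V_iff y (q := q + 1) (by omega) (by rw [hyk']; exact hleq)).1 hyV
    rw [hyk'] at hthr
    have hvle := Q.vertOffset_add_le_vT c.k
    have hyb := h.bound y (Q.vertOffset c.k + (q + 1)) (by rw [hyk']) (diag_posT hyk' hyi' hyj')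
      (by omega) (by omega) hthr
    rw [← ha] at hn' h4
    obtain ⟨qa, hqa, hqa', hna, haV⟩ := R.exists_mem_V_of_nu hQ a hn hn' h4
    have hak : a.k = c.k ∧ a.j < c.j := by
      rcases page_of_posT_lt ha h2.2 with h5 | h5
      · have := Q.vertOffset_add_le ha h5
        omega
      · exact h5
    have hai : a.i < c.i := by have := h2.1; simp only [posT] at this; omega
    have hlast := h'.last a.op qa hak.1 hak.2 hai hqa (by rw [hak.1] at hqa'; exact hqa') (by
      have := (R.mem_op_H a qa).2 haV
      rw [hak.1] at this
      exact this)
    have hoff : Q.vertOffset a.k = Q.vertOffset c.k := by rw [hak.1]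
    obtain rfl : qa = q + 1 := by omega
    rw [← ha] at h1 h3
    exact ⟨a, hak.1, hai, hak.2, h1, haV, h3⟩

/-- There is a chain of essential corners NW of `c` in one of the two arrays containing `c`. -/
theorem nwChain {α : T} {β : S} {X Y : Set (ℤ × ℤ)}
    (hX : ∀ y, Q.t y.k = α → R.IsEssentialNWCorner y → Q.posT y ∈ X)
    (hY : ∀ y, Q.s y.k = β → R.IsEssentialNWCorner y → Q.op.posT y.op ∈ Y) :
    ∀ (p q : ℕ) (c : Q.Vertex), Q.t c.k = α → Q.s c.k = β → Side R c p → Side R.op c.op q →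
      NWChain X (Q.posT c) p ∨ NWChain Y (Q.op.posT c.op) q := by
  have hQ' := hQ.op
  have hR' := hR.op
  intro p
  induction p with
  | zero => exact fun _ _ _ _ _ _ => Or.inl (NWChain.zero _ _)
  | succ p ih =>
    intro q c hα hβ h h'
    cases q with
    | zero => exact Or.inr (NWChain.zero _ _)
    | succ q =>
    subst hα hβ
    have hle := h.le
    have hleq : q + 1 ≤ Q.uS (Q.s c.k) := h'.le
    rcases h.chain_or_corner hQ hR h' hX with h1 | ⟨a, hak, hai, haj, haH, haV, ha⟩
    · exact Or.inl h1
    have h'' : Side R.op.op c.op.op (p + 1) := by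
      rw [R.op_op]; exact h
    rcases h'.chain_or_corner hQ' hR' (q := p) h'' (X := Y) (fun y hy he => by
        obtain ⟨y, rfl⟩ : ∃ z : Q.Vertex, y = z.op := ⟨⟨y.k, y.j, y.i, y.hj, y.hi⟩, rfl⟩
        exact hY y hy ((R.isEssentialNWCorner_op y).1 he)) with
      h1 | ⟨b, hbk, hbi, hbj, hbV, hbH, hb⟩
    · exact Or.inr h1
    obtain ⟨b, rfl⟩ : ∃ z : Q.Vertex, b = z.op := ⟨⟨b.k, b.j, b.i, b.hj, b.hi⟩, rfl⟩
    have hbk : b.k = c.k := hbk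
    have hbi' : b.i < c.i := hbj
    have hbj' : b.j < c.j := hbi
    have hbH : Q.posT b ∈ R.H (Q.t b.k) (p + 1) := (R.mem_op_V b (p + 1)).1 hbH
    have hbV' : Q.posS b ∈ R.V (Q.s b.k) (q + 1) := (R.mem_op_H b (q + 1)).1 hbV.1
    -- A common point of `H (p + 1)` and `V (q + 1)` that is an essential corner prolongs the chain
    -- from the induction hypothesis, in whichever array it lies.
    have extend : ∀ z : Q.Vertex, z.k = c.k → z.i < c.i → z.j < c.j →
        Q.posT z ∈ R.H (Q.t z.k) (p + 1) → Q.posS z ∈ R.V (Q.s z.k) (q + 1) →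
        R.IsEssentialNWCorner z → NWChain X (Q.posT c) (p + 1) ∨
          NWChain Y (Q.op.posT c.op) (q + 1) := by
      intro z hzk hzi hzj hzH hzV hze
      have s1 := h.step hQ hR hzk hzi hzj hzH (q := q + 1) (by omega)
        (by rw [hzk]; exact hleq) hzV
      have s2 := h'.step hQ' hR' (a := z.op) hzk hzj hzi ((R.mem_op_H z _).2 hzV) (q := p + 1)
        (by omega) (by have := hle; rw [← hzk] at this; exact this) ((R.mem_op_V z _).2 hzH)
      rcases ih q z (by rw [hzk]) (by rw [hzk]) s1 s2 with h2 | h2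
      · exact Or.inl (h2.succ (hX z (by rw [hzk]) hze) (diag_posT hzk hzi hzj))
      · exact Or.inr (h2.succ (hY z (by rw [hzk]) hze)
          (diag_posT (x := z.op) (y := c.op) hzk hzj hzi))
    by_cases hae : R.IsEssentialNWCorner a
    · exact extend a hak hai haj haH.1 haV hae
    by_cases hbe : R.IsEssentialNWCorner b
    · exact extend b hbk hbi' hbj' hbH hbV' hbe
    -- If both corners are inessential, `a` is the NE and `b` the SW endpoint of the intersection of
    -- `H (p + 1)` and `V (q + 1)`. But `a` is leftmost on `H (p + 1)` above the row of `c`, and `b`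
    -- is topmost on `V (q + 1)` left of its column. So `a = b`, and the point east of it lies on
    -- both paths, beyond the NE endpoint.
    exfalso
    have hlea : p + 1 ≤ Q.uT (Q.t a.k) := by rw [hak]; exact hle
    have hleb : q + 1 ≤ Q.uS (Q.s b.k) := by rw [hbk]; exact hleq
    have hleqa : q + 1 ≤ Q.uS (Q.s a.k) := by rw [hak]; exact hleq
    have hlepb : p + 1 ≤ Q.uT (Q.t b.k) := by rw [hbk]; exact hle
    have hane : R.IsNEEnd (p + 1) (q + 1) a := by
      by_contra hcon
      refine hae (Or.inl ⟨⟨p + 1, Finset.mem_Icc.2 ⟨by omega, hlea⟩, haH⟩, ?_⟩)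
      rintro ⟨p', hp', q', hq', -, hend⟩
      rw [Finset.mem_Icc] at hp' hq'
      obtain rfl := R.H_unique hp'.1 hp'.2 (by omega) hlea hend.1.1 haH.1
      obtain rfl := R.op.H_unique hq'.1 hq'.2 (by omega) hleqa
        ((R.mem_op_H a _).2 hend.1.2) ((R.mem_op_H a _).2 haV)
      exact hcon hend
    have hbsw : R.IsSWEnd (p + 1) (q + 1) b := by
      by_contra hcon
      refine hbe (Or.inr ⟨⟨q + 1, Finset.mem_Icc.2 ⟨by omega, hleb⟩,
        isNWCorner_map_swap.1 hbV⟩, ?_⟩)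
      rintro ⟨q', hq', p', hp', -, hend⟩
      rw [Finset.mem_Icc] at hp' hq'
      obtain rfl := R.H_unique hp'.1 hp'.2 (by omega) hlepb hend.1.1 hbH
      obtain rfl := R.op.H_unique hq'.1 hq'.2 (by omega) hleb
        ((R.mem_op_H b _).2 hend.1.2) ((R.mem_op_H b _).2 hbV')
      exact hcon hend
    have e1 := hane.2 b (by rw [hak, hbk]) ⟨hbH, hbV'⟩
    have e2 := ha (Q.posT b) (by rw [hak, ← hbk]; exact hbH) (by simp only [posT]; omega)
    have e3 := hb (Q.op.posT a.op) (by
      have := (R.mem_op_H a _).2 haV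
      rw [hak, ← hbk] at this
      exact this) (by simp only [posT, Vertex.op]; omega)
    have hoff : Q.colOffset a.k = Q.colOffset b.k := by rw [hak, hbk]
    have hoff' : Q.op.colOffset a.op.k = Q.op.colOffset b.op.k := by
      change Q.op.colOffset (a.k) = Q.op.colOffset b.k
      rw [hak, hbk]
    simp only [posT, hoff, hoff'] at e2 e3
    have e4 : b.op.j = b.i := rfl
    have e5 : a.op.j = a.i := rfl
    obtain rfl : a = b := Vertex.ext (by rw [hak, hbk]) (by omega) (by omega)
    have hcorner : IsNWCorner (R.V (Q.s a.k) (q + 1)) (Q.posS a) := isNWCorner_map_swap.1 hbV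
    have hspec := ((R.vRow_spec (by omega) hleqa).2.2.2.2.1) 
      ((Q.posS a).2 + 1 - (Q.posS a).1)
    have hthr := (((R.vRow_spec (by omega) hleqa).2.1 _).1 hcorner.2.2).1
    rw [through_iff rfl] at hthr
    rw [hthr] at hspec
    have hm := (hQ.source (Q.s a.k)).2.1
    simp only [bS] at hspec hm
    have hba := a.bounds
    obtain ⟨z, hzk, hzi, hzj⟩ := exists_vertex (Q := Q) (k := a.k) (i := a.i) (j := a.j + 1)
      (by omega) (by omega) (by omega) (by simp only [posS] at hspec; omega)
    have e6 := hane.2 z hzk ⟨by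
        have : Q.posT z = ((Q.posT a).1, (Q.posT a).2 + 1) := by
          simp only [posT, hzk, hzi, hzj, Prod.mk.injEq, true_and]; ring
        rw [this, hzk]
        exact haH.2.2, by
        have : Q.posS z = ((Q.posS a).1, (Q.posS a).2 + 1) := by
          simp only [posS, hzk, hzi, hzj]
        rw [this, hzk]
        exact hcorner.2.2⟩
    omega

end Side

end BipartiteData

/-! ### Incompatibility of points outside a concurrent vertex map. -/

namespace BipartiteData

theorem Grid.exists_index {a b u v : ℕ} {ρ ν : ℕ → ℤ → ℤ} (G : Grid a b u v ρ ν) {i d : ℤ}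
    (h : ∀ p, 1 ≤ p → p ≤ u → ρ p d ≠ i) : ∃ p, p ≤ u ∧
      (∀ m, 1 ≤ m → m ≤ p → ρ m d < i) ∧ ∀ m, p < m → m ≤ u → i < ρ m d := by
  have key : ∀ w, w ≤ u → ∃ p, p ≤ w ∧
      (∀ m, 1 ≤ m → m ≤ p → ρ m d < i) ∧ ∀ m, p < m → m ≤ w → i < ρ m d := by
    intro w
    induction w with
    | zero => exact fun _ => ⟨0, le_rfl, fun m _ _ => by omega, fun m _ _ => by omega⟩
    | succ w ih =>
      intro hw
      obtain ⟨p, hp, h1, h2⟩ := ih (by omega)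
      rcases lt_or_ge (ρ (w + 1) d) i with h3 | h3
      · refine ⟨w + 1, le_rfl, fun m hm hm' => ?_, fun m _ _ => by omega⟩
        rcases hm'.lt_or_eq with h4 | h4
        · exact (G.lt_H m (w + 1) hm h4 hw d).trans h3
        · rwa [h4]
      · refine ⟨p, by omega, h1, fun m hm hm' => ?_⟩
        rcases hm'.lt_or_eq with h4 | h4
        · exact h2 m hm (by omega)
        · have := h (w + 1) (by omega) hw
          rw [h4]
          omega
  exact key u le_rfl

variable {T S : Type*} [DecidableEq T] [DecidableEq S] {Q : BipartiteData T S}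

/-- `Vertex.op` as an embedding. -/
def opEmb (Q : BipartiteData T S) : Q.Vertex ↪ Q.op.Vertex := ⟨Vertex.op, Vertex.op_injective⟩

theorem Compatible.op {B : Finset Q.Vertex} (h : Q.Compatible B) :
    Q.op.Compatible (B.map (opEmb Q)) := by
  refine ⟨fun β hc => h.2 β (hc.of_swap ?_), fun α hc => h.1 α (hc.of_swap ?_)⟩
  · rintro c ⟨y, hy, hy2, rfl⟩
    obtain ⟨z, hz, rfl⟩ := Finset.mem_map.1 hy
    exact ⟨z, hz, hy2, rfl⟩
  · rintro c ⟨y, hy, hy2, rfl⟩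
    obtain ⟨z, hz, rfl⟩ := Finset.mem_map.1 hy
    exact ⟨z, hz, hy2, rfl⟩

namespace RoadMap

variable {R : Q.RoadMap} (hQ : Q.Admissible) (hR : R.IsStraight)
include hQ hR

/-- `x` lies between two consecutive horizontal paths. Each path SE of it contributes a SE corner to
the chain, and the vertical paths through these corners yield the bounds on the indices. -/
theorem exists_side {x : Q.Vertex} (hx : ¬ R.OnHorizontal x) : ∃ p, Side R x p ∧
    SEChain {c | ∃ y : Q.Vertex, Q.t y.k = Q.t x.k ∧ Q.posT y = c ∧ R.OnHorizontal y ∧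
      R.OnVertical y} (Q.posT x) (Q.uT (Q.t x.k) - p) ∧
    ∀ n, 1 ≤ n → n ≤ Q.vT (Q.t x.k) → Through (R.nu (Q.t x.k) n) (Q.posT x) →
      n + Q.uT (Q.t x.k) ≤ p + Q.vT (Q.t x.k) := by
  have G := grid hQ hR (Q.t x.k)
  have hb := posT_bounds x
  rw [R.onHorizontal_iff] at hx
  obtain ⟨p, hp, h1, h2⟩ := G.exists_index (i := (Q.posT x).1) (d := (Q.posT x).2 - (Q.posT x).1)
    (fun p hp hp' h => hx ⟨p, hp, hp', h⟩)
  obtain ⟨h3, h4⟩ := G.seChain (Q.uT (Q.t x.k) - p) p (Q.posT x) (by omega) (fun hlt => by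
    refine ⟨h2 (p + 1) (by omega) (by omega), ?_⟩
    by_cases hp0 : 1 ≤ p
    · have := h1 p hp0 le_rfl
      have := G.row_ge p hp0 hp ((Q.posT x).2 - (Q.posT x).1)
      omega
    · omega) hb.2.2.1
  refine ⟨p, ⟨hp, fun hp1 => ⟨h1 p hp1 le_rfl, ?_⟩, fun y n hy hd hn hn' hth => ?_,
    fun y p' hyk hyi hyj hp1 hp' hm => ?_⟩, h3.mono ?_, fun n hn hn' hth => ?_⟩
  · rcases hp.lt_or_eq with h5 | h5
    · have := h2 (p + 1) (by omega) (by omega)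
      have := G.row_le (p + 1) (by omega) (by omega) ((Q.posT x).2 - (Q.posT x).1)
      push_cast at this
      omega
    · have := (hQ.target (Q.t x.k)).2.1
      omega
  · have := h4 n _ hn hn' hth hd.1.le hd.2.le
    omega
  · by_contra hlt
    have h5 := h2 p' (by omega) hp'
    rw [← hyk] at hm hp'
    have h6 := (R.mem_H_iff y hp1 hp').1 hm
    rw [hyk] at h6 hp'
    have h7 := (G.stepH p' hp1 hp').lt_of_diag h6 (diag_posT hyk hyi hyj)
    omega
  · rintro c ⟨⟨m, hm, hm', h5⟩, h6, h7, h8⟩ -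
    have hrow := G.row_bounds hm hm' (c.2 - c.1)
    have h5' := h5
    simp only [Through] at h5'
    rw [h5'] at hrow
    obtain ⟨y, hy, rfl⟩ := exists_posT (Q := Q) (α := Q.t x.k) hrow.1 hrow.2 h7 h8
    refine ⟨y, hy, rfl, (R.onHorizontal_iff y).2 ?_, (R.onVertical_iff hQ y).2 ?_⟩
    · rw [hy]; exact ⟨m, hm, hm', h5⟩
    · rw [hy]; exact h6
  · have := h4 n _ hn hn' hth le_rfl le_rfl
    omega

/-- Essential corners NW of `x`, the point `x`, and later points of the map SE of `x` form a
diagonal chain that is one too long. -/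
theorem not_compatible_of_not_onHorizontal {x : Q.Vertex} (hx : ¬ R.OnHorizontal x)
    {B : Finset Q.Vertex} (hxB : x ∈ B) (hE : ∀ y, R.IsEssentialNWCorner y → y ∈ B)
    (hL : ∀ y, R.OnHorizontal y → R.OnVertical y → Later x y → y ∈ B) : ¬ Q.Compatible B := by
  intro hcomp
  have hcomp' := hcomp.op
  have hQ' := hQ.op
  have hR' := hR.op
  obtain ⟨p, h1, h2, h3⟩ := exists_side hQ hR hx
  have hp := h1.le
  have hse : SEChain (Q.preT B (Q.t x.k)) (Q.posT x) (Q.uT (Q.t x.k) - p) := h2.mono (by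
    rintro c ⟨y, hy, rfl, hyH, hyV⟩ hd
    exact ⟨y, hL y hyH hyV (later_of_diag hy.symm hd), hy, rfl⟩)
  have hX : ∀ y, Q.t y.k = Q.t x.k → R.IsEssentialNWCorner y →
      Q.posT y ∈ Q.preT B (Q.t x.k) := fun y hy he => ⟨y, hE y he, hy, rfl⟩
  have hT : ¬ NWChain (Q.preT B (Q.t x.k)) (Q.posT x) p := fun hc => by
    have := hc.join ⟨x, hxB, rfl, rfl⟩ hse
    rw [show p + (Q.uT (Q.t x.k) - p) + 1 = Q.uT (Q.t x.k) + 1 by omega] at this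
    exact hcomp.1 _ this
  -- On a vertical path, `x` itself satisfies the index condition of `nwChain_of_index`; off all
  -- paths, both arrays have to be considered together.
  by_cases hxV : R.OnVertical x
  · obtain ⟨n, hn, hn', hth⟩ := (R.onVertical_iff hQ x).1 hxV
    exact hT (nwChain_of_index hQ hR hX p n x rfl hp hn hn' hth (h3 n hn hn' hth) h1.above)
  · obtain ⟨q, h1', h2', -⟩ := exists_side hQ' hR' (x := x.op)
      (fun h => hxV ((R.onHorizontal_op x).1 h))
    have hq : q ≤ Q.uS (Q.s x.k) := h1'.le
    have hse' : SEChain (Q.op.preT (B.map (opEmb Q)) (Q.s x.k)) (Q.op.posT x.op)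
        (Q.uS (Q.s x.k) - q) := h2'.mono (by
      rintro c ⟨y, hy, rfl, hyH, hyV⟩ hd
      obtain ⟨y, rfl⟩ : ∃ z : Q.Vertex, y = z.op := ⟨⟨y.k, y.j, y.i, y.hj, y.hi⟩, rfl⟩
      refine ⟨y.op, Finset.mem_map.2 ⟨y, ?_, rfl⟩, hy, rfl⟩
      refine hL y ((R.onVertical_op y).1 hyV) ((R.onHorizontal_op y).1 hyH) ?_
      exact (later_of_diag (Q := Q.op) hy.symm hd).imp id (fun h => ⟨h.1, h.2.2, h.2.1⟩))
    have hY : ∀ y, Q.s y.k = Q.s x.k → R.IsEssentialNWCorner y →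
        Q.op.posT y.op ∈ Q.op.preT (B.map (opEmb Q)) (Q.s x.k) := fun y hy he =>
      ⟨y.op, Finset.mem_map.2 ⟨y, hE y he, rfl⟩, hy, rfl⟩
    rcases Side.nwChain hQ hR hX hY p q x rfl rfl h1 h1' with h4 | h4
    · exact hT h4
    · have := h4.join ⟨x.op, Finset.mem_map.2 ⟨x, hxB, rfl⟩, rfl, rfl⟩ hse'
      rw [show q + (Q.uS (Q.s x.k) - q) + 1 = Q.uS (Q.s x.k) + 1 by omega] at this
      exact hcomp'.1 _ this

/-- A set containing the essential NW corners, a vertex outside of the concurrent vertex map and the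
vertices of the map that follow it is not `u`-compatible. -/
theorem not_compatible {C : Finset Q.Vertex} (hC : R.Induces C) {x : Q.Vertex} (hx : x ∉ C)
    {B : Finset Q.Vertex} (hxB : x ∈ B) (hE : ∀ y, R.IsEssentialNWCorner y → y ∈ B)
    (hL : ∀ y ∈ C, Later x y → y ∈ B) : ¬ Q.Compatible B := by
  by_cases hxH : R.OnHorizontal x
  · have hxV : ¬ R.op.OnHorizontal x.op := fun h =>
      hx ((hC x).2 ⟨hxH, (R.onHorizontal_op x).1 h⟩)
    intro hcomp
    refine not_compatible_of_not_onHorizontal hQ.op hR.op hxV (B := B.map (opEmb Q))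
      (Finset.mem_map.2 ⟨x, hxB, rfl⟩) (fun y hy => ?_) (fun y hyH hyV hxy => ?_) hcomp.op
    · obtain ⟨y, rfl⟩ : ∃ z : Q.Vertex, y = z.op := ⟨⟨y.k, y.j, y.i, y.hj, y.hi⟩, rfl⟩
      exact Finset.mem_map.2 ⟨y, hE y ((R.isEssentialNWCorner_op y).1 hy), rfl⟩
    · obtain ⟨y, rfl⟩ : ∃ z : Q.Vertex, y = z.op := ⟨⟨y.k, y.j, y.i, y.hj, y.hi⟩, rfl⟩
      refine Finset.mem_map.2 ⟨y, hL y ((hC y).2 ⟨(R.onVertical_op y).1 hyV,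
        (R.onHorizontal_op y).1 hyH⟩) ?_, rfl⟩
      exact Or.imp id (fun h => ⟨h.1, h.2.2, h.2.1⟩) hxy
  · exact not_compatible_of_not_onHorizontal hQ hR hxH hxB hE
      (fun y hyH hyV => hL y ((hC y).2 ⟨hyH, hyV⟩))

end RoadMap

/-- Two of `u + 1` points would lie on the same horizontal path, which contains no two points in
diagonal position. -/
theorem RoadMap.not_chain_preT (R : Q.RoadMap) {C : Finset Q.Vertex}
    (hC : ∀ x ∈ C, R.OnHorizontal x) (α : T) :
    ¬ HasDiagonalChain (Q.preT C α) (Q.uT α + 1) := by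
  rintro ⟨f, h1, h2⟩
  have h3 : ∀ a, ∃ p ∈ Finset.Icc 1 (Q.uT α), Through (R.hRow α p) (f a) := fun a => by
    obtain ⟨x, hx, rfl, hpos⟩ := h1 a
    obtain ⟨p, hp, hp', h⟩ := (R.onHorizontal_iff x).1 (hC x hx)
    exact ⟨p, Finset.mem_Icc.2 ⟨hp, hp'⟩, by rwa [← hpos]⟩
  choose g hg hg' using h3
  obtain ⟨a, -, b, -, hab, he⟩ := Finset.exists_ne_map_eq_of_card_lt_of_maps_to
    (s := Finset.univ) (t := Finset.Icc 1 (Q.uT α)) (f := g) (by simp) (fun a _ => hg a)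
  wlog hlt : a < b generalizing a b
  · exact this b a hab.symm he.symm (lt_of_le_of_ne (not_lt.1 hlt) hab.symm)
  have hp := Finset.mem_Icc.1 (hg a)
  have h4 := ((R.hRow_spec hp.1 hp.2).1).lt_of_diag (hg' a) (h2 a b hlt)
  have h5 := hg' b
  rw [← he] at h5
  simp only [Through] at h5
  omega

/-- Concurrent vertex maps are `u`-compatible. -/
theorem RoadMap.Induces.compatible {R : Q.RoadMap} {C : Finset Q.Vertex} (hC : R.Induces C) :
    Q.Compatible C := by
  refine ⟨R.not_chain_preT fun x hx => ((hC x).1 hx).1, fun β hc => ?_⟩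
  refine R.op.not_chain_preT (C := C.map (opEmb Q)) (fun x hx => ?_) β (hc.of_swap ?_)
  · obtain ⟨y, hy, rfl⟩ := Finset.mem_map.1 hx
    exact (R.onHorizontal_op y).2 ((hC y).1 hy).2
  · rintro c ⟨y, hy, hy2, rfl⟩
    exact ⟨y.op, Finset.mem_map.2 ⟨y, hy, rfl⟩, hy2, rfl⟩

end BipartiteData

/-! ### Flipping a NW corner common to both paths. -/

namespace BipartiteData

variable {T S : Type*} [DecidableEq T] [DecidableEq S] {Q : BipartiteData T S}

namespace RoadMap

/-- The road map obtained by shifting a segment of each horizontal path by `(1, 1)`. -/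
noncomputable def shiftH (R : Q.RoadMap) (g : T → ℕ → ℤ × ℤ × ℤ)
    (hg : ∀ α, ∀ p ∈ Finset.Icc 1 (Q.uT α), SegmentIn (R.H α p) (g α p))
    (hg' : ∀ α, ∀ p ∈ Finset.Icc 1 (Q.uT α), ∀ p' ∈ Finset.Icc 1 (Q.uT α),
      ∀ c ∈ segment (g α p), (c.1 + 1, c.2 + 1) ∈ R.H α p' →
        (c.1 + 1, c.2 + 1) ∈ segment (g α p')) : Q.RoadMap where
  H α p := (R.H α p).map (shiftPoint (g α p))
  V := R.V
  H_path α p hp := (R.H_path α p hp).shift (hg α p hp)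
  V_path := R.V_path
  H_disjoint α p hp p' hp' hne c hc hc' := by
    have hdisj : ∀ c, c ∈ R.H α p → c ∉ R.H α p' := fun c h h' =>
      R.H_disjoint α p hp p' hp' hne h h'
    rcases ((hg α p hp).mem_map c).1 hc with h1 | h1 <;>
      rcases ((hg α p' hp').mem_map c).1 hc' with h2 | h2
    · exact hdisj c h1.1 h2.1
    · have := hg' α p' hp' p hp _ h2 (by simpa using h1.1)
      exact h1.2 (by simpa using this)
    · have := hg' α p hp p' hp' _ h1 (by simpa using h2.1)
      exact h2.2 (by simpa using this)
    · exact hdisj _ ((hg α p hp).subset h1) ((hg α p' hp').subset h2)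
  V_disjoint := R.V_disjoint

/-- The horizontal paths of one road map together with the vertical paths of another one. -/
def combine (R R' : Q.RoadMap) : Q.RoadMap where
  H := R.H
  V := R'.V
  H_path := R.H_path
  V_path := R'.V_path
  H_disjoint := R.H_disjoint
  V_disjoint := R'.V_disjoint

/-- The horizontal path `H p` with a NW corner `z` is replaced by the path with a SE corner
`z + (1, 1)`. -/
theorem exists_flipH (R : Q.RoadMap) {z x : Q.Vertex} {p : ℕ} (hp : 1 ≤ p)
    (hp' : p ≤ Q.uT (Q.t z.k)) (hz : IsNWCorner (R.H (Q.t z.k) p) (Q.posT z))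
    (hk : x.k = z.k) (hi : x.i = z.i + 1) (hj : x.j = z.j + 1) (hx : ¬ R.OnHorizontal x) :
    ∃ R' : Q.RoadMap, (∀ m, m ≠ p → R'.H (Q.t z.k) m = R.H (Q.t z.k) m) ∧
      (∀ y, R'.OnHorizontal y ↔ R.OnHorizontal y ∧ y ≠ z ∨ y = x) ∧
      ∀ y, R'.IsHorizontalNWCorner y ∨ R'.IsHorizontalSECorner y →
        (R.IsHorizontalNWCorner y ∨ R.IsHorizontalSECorner y) ∧ y ≠ z ∨ y = x ∨
          Q.t y.k = Q.t z.k ∧ (Q.posT y = ((Q.posT z).1 + 1, (Q.posT z).2) ∨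
            Q.posT y = ((Q.posT z).1, (Q.posT z).2 + 1)) := by
  set α := Q.t z.k with hα
  have hxz : Q.posT x = ((Q.posT z).1 + 1, (Q.posT z).2 + 1) := by
    simp only [posT, hk, hi, hj, Prod.mk.injEq]
    push_cast
    constructor <;> ring
  have hxα : Q.t x.k = α := by rw [hk]
  -- Flipping the corner is the shift of the segment that consists of `z` alone.
  let g : T → ℕ → ℤ × ℤ × ℤ := fun α' m =>
    if α' = α ∧ m = p then ((Q.posT z).1, (Q.posT z).2, (Q.posT z).2 + 1) else (0, 0, 0)
  have hempty : ∀ {α' m}, ¬ (α' = α ∧ m = p) → ∀ c, c ∉ segment (g α' m) := fun h c hc => by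
    simp only [g, if_neg h, mem_segment] at hc
    omega
  have hgz : ∀ c, c ∈ segment (g α p) ↔ c = Q.posT z := fun c => by
    simp only [g, and_self, if_true, mem_segment, Prod.ext_iff]
    omega
  have hseg : ∀ {α' m c}, c ∈ segment (g α' m) → α' = α ∧ m = p ∧ c = Q.posT z := by
    intro α' m c hc
    by_cases h : α' = α ∧ m = p
    · obtain ⟨rfl, rfl⟩ := h
      exact ⟨rfl, rfl, (hgz c).1 hc⟩
    · exact absurd hc (hempty h c)
  have hg : ∀ α', ∀ m ∈ Finset.Icc 1 (Q.uT α'), SegmentIn (R.H α' m) (g α' m) := by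
    intro α' m _ hlt
    by_cases h : α' = α ∧ m = p
    · obtain ⟨rfl, rfl⟩ := h
      simp only [g, and_self, if_true]
      refine ⟨hz.2.1, fun j h1 h2 => ?_⟩
      rcases (show j = (Q.posT z).2 ∨ j = (Q.posT z).2 + 1 by omega) with rfl | rfl
      · exact hz.1
      · exact hz.2.2
    · simp only [g, if_neg h] at hlt
      omega
  have hg' : ∀ α', ∀ m ∈ Finset.Icc 1 (Q.uT α'), ∀ m' ∈ Finset.Icc 1 (Q.uT α'),
      ∀ c ∈ segment (g α' m), (c.1 + 1, c.2 + 1) ∈ R.H α' m' →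
        (c.1 + 1, c.2 + 1) ∈ segment (g α' m') := by
    intro α' m _ m' hm' c hc hmem
    obtain ⟨rfl, rfl, rfl⟩ := hseg hc
    rw [← hxz, ← hxα] at hmem
    rw [← hxα] at hm'
    exact absurd ⟨m', hm', hmem⟩ hx
  refine ⟨R.shiftH g hg hg', fun m hm => ?_, fun y => ⟨?_, ?_⟩, fun y hy => ?_⟩
  · show (R.H α m).map (shiftPoint (g α m)) = R.H α m
    have : shiftPoint (g α m) = id := by
      funext c
      exact if_neg (hempty (fun h => hm h.2) c)
    rw [this, List.map_id]
  · rintro ⟨m, hm, hmem⟩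
    rcases ((hg _ m hm).mem_map _).1 hmem with ⟨h1, h2⟩ | h1
    · refine Or.inl ⟨⟨m, hm, h1⟩, ?_⟩
      rintro rfl
      rw [Finset.mem_Icc] at hm
      obtain rfl := R.H_unique hm.1 hm.2 hp hp' h1 hz.1
      exact h2 ((hgz _).2 rfl)
    · obtain ⟨h3, -, h4⟩ := hseg h1
      right
      refine posT_injective (h3.trans hxα.symm) ?_
      rw [hxz, ← h4]
      simp
  · rintro (⟨⟨m, hm, hmem⟩, hne⟩ | rfl)
    · refine ⟨m, hm, ((hg _ m hm).mem_map _).2 (Or.inl ⟨hmem, fun hc => hne ?_⟩)⟩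
      obtain ⟨h3, -, h4⟩ := hseg hc
      exact posT_injective h3 h4
    · have hm : p ∈ Finset.Icc 1 (Q.uT (Q.t y.k)) := by
        rw [hxα]; exact Finset.mem_Icc.2 ⟨hp, hp'⟩
      refine ⟨p, hm, ((hg _ p hm).mem_map _).2 (Or.inr ?_)⟩
      rw [hxα, hgz, hxz]
      simp
  · obtain ⟨m, hm, hc⟩ : ∃ m ∈ Finset.Icc 1 (Q.uT (Q.t y.k)),
        IsNWCorner ((R.H (Q.t y.k) m).map (shiftPoint (g (Q.t y.k) m))) (Q.posT y) ∨
        IsSECorner ((R.H (Q.t y.k) m).map (shiftPoint (g (Q.t y.k) m))) (Q.posT y) := by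
      rcases hy with ⟨m, hm, hc⟩ | ⟨m, hm, hc⟩
      · exact ⟨m, hm, Or.inl hc⟩
      · exact ⟨m, hm, Or.inr hc⟩
    rcases (R.H_path _ m hm).corner_shift (hg _ m hm) hc with ⟨h1, h2⟩ | ⟨hlt, h1⟩
    · refine Or.inl ⟨h1.imp (fun h => ⟨m, hm, h⟩) (fun h => ⟨m, hm, h⟩), ?_⟩
      rintro rfl
      have hmem : Q.posT y ∈ R.H (Q.t y.k) m := by rcases h1 with h | h <;> exact h.1
      rw [Finset.mem_Icc] at hm
      obtain rfl := R.H_unique hm.1 hm.2 hp hp' hmem hz.1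
      exact h2 ((hgz _).2 rfl)
    · right
      by_cases h : Q.t y.k = α ∧ m = p
      · simp only [g, if_pos h] at h1
        rcases h1 with h1 | h1 | h1
        · exact Or.inr ⟨h.1, Or.inl h1⟩
        · exact Or.inr ⟨h.1, Or.inr h1⟩
        · exact Or.inl (posT_injective (h.1.trans hxα.symm) (h1.trans hxz.symm))
      · simp only [g, if_neg h] at hlt
        omega

theorem exists_flipV (R : Q.RoadMap) {z x : Q.Vertex} {q : ℕ} (hq : 1 ≤ q)
    (hq' : q ≤ Q.uS (Q.s z.k)) (hz : IsNWCorner (R.V (Q.s z.k) q) (Q.posS z))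
    (hk : x.k = z.k) (hi : x.i = z.i + 1) (hj : x.j = z.j + 1) (hx : ¬ R.OnVertical x) :
    ∃ R' : Q.RoadMap, (∀ m, m ≠ q → R'.V (Q.s z.k) m = R.V (Q.s z.k) m) ∧
      (∀ y, R'.OnVertical y ↔ R.OnVertical y ∧ y ≠ z ∨ y = x) ∧
      ∀ y, R'.IsVerticalNWCorner y ∨ R'.IsVerticalSECorner y →
        (R.IsVerticalNWCorner y ∨ R.IsVerticalSECorner y) ∧ y ≠ z ∨ y = x ∨
          Q.s y.k = Q.s z.k ∧ (Q.posS y = ((Q.posS z).1 + 1, (Q.posS z).2) ∨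
            Q.posS y = ((Q.posS z).1, (Q.posS z).2 + 1)) := by
  obtain ⟨R', h1, h2, h3⟩ := R.op.exists_flipH (z := z.op) (x := x.op) hq hq'
    (isNWCorner_map_swap.2 hz) hk hj hi (fun h => hx ((R.onHorizontal_op x).1 h))
  have h2' : ∀ y : Q.Vertex, R'.op.OnVertical y ↔ R'.OnHorizontal y.op := fun y =>
    R'.onVertical_op y.op
  refine ⟨R'.op, fun m hm => ?_, fun y => ?_, fun y hy => ?_⟩
  · have := congrArg (fun l : List (ℤ × ℤ) => l.reverse.map Prod.swap) (h1 m hm)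
    refine this.trans ?_
    simp only [op, Vertex.op, List.map_reverse, List.reverse_reverse, List.map_map,
      Prod.swap_swap_eq, List.map_id]
    rfl
  · refine (h2' y).trans ?_
    rw [h2, R.onHorizontal_op, Vertex.op_injective.ne_iff, Vertex.op_injective.eq_iff]
  · have := h3 y.op (hy.imp (R'.isVerticalNWCorner_op y.op).1 (R'.isVerticalSECorner_op y.op).1)
    rw [R.isHorizontalNWCorner_op, R.isHorizontalSECorner_op, Vertex.op_injective.ne_iff,
      Vertex.op_injective.eq_iff] at this
    refine this.imp id (Or.imp id fun h => ⟨h.1, ?_⟩)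
    have h4 := h.2
    simp only [posT_op, Prod.ext_iff, Prod.fst_swap, Prod.snd_swap] at h4 ⊢
    omega

variable {R : Q.RoadMap}

/-- Both paths through a common NW corner can be flipped, unless the point SE of it is occupied. -/
theorem exists_flip_of_not_onHorizontal (hR : R.IsStraight) {z x : Q.Vertex} {p q : ℕ} (hp : 1 ≤ p)
    (hp' : p ≤ Q.uT (Q.t z.k)) (hq : 1 ≤ q) (hq' : q ≤ Q.uS (Q.s z.k))
    (hzH : IsNWCorner (R.H (Q.t z.k) p) (Q.posT z))
    (hzV : IsNWCorner (R.V (Q.s z.k) q) (Q.posS z))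
    (hk : x.k = z.k) (hi : x.i = z.i + 1) (hj : x.j = z.j + 1)
    (hxH : ¬ R.OnHorizontal x) (hxV : ¬ R.OnVertical x) :
    ∃ R' : Q.RoadMap, R'.IsStraight ∧
      (∀ y, R'.OnHorizontal y ∧ R'.OnVertical y ↔
        (R.OnHorizontal y ∧ R.OnVertical y) ∧ y ≠ z ∨ y = x) ∧
      (∀ m, m ≠ p → R'.H (Q.t z.k) m = R.H (Q.t z.k) m) ∧
      ∀ m, m ≠ q → R'.V (Q.s z.k) m = R.V (Q.s z.k) m := by
  obtain ⟨R1, h1, h2, h3⟩ := R.exists_flipH hp hp' hzH hk hi hj hxH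
  obtain ⟨R2, h4, h5, h6⟩ := R.exists_flipV hq hq' hzV hk hi hj hxV
  have hzb := z.bounds
  have hxb := x.bounds
  rw [hk] at hxb
  -- New corners can appear south and east of `z`, at `s` and `e`; both flipped paths pass through
  -- these points, so straightness is preserved.
  obtain ⟨s, hsk, hsi, hsj⟩ : ∃ s : Q.Vertex, s.k = z.k ∧ s.i = z.i + 1 ∧ s.j = z.j :=
    ⟨⟨z.k, z.i + 1, z.j, Finset.mem_Icc.2 (by omega), z.hj⟩, rfl, rfl, rfl⟩
  obtain ⟨e, hek, hei, hej⟩ : ∃ e : Q.Vertex, e.k = z.k ∧ e.i = z.i ∧ e.j = z.j + 1 :=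
    ⟨⟨z.k, z.i, z.j + 1, z.hi, Finset.mem_Icc.2 (by omega)⟩, rfl, rfl, rfl⟩
  have hsT : Q.posT s = ((Q.posT z).1 + 1, (Q.posT z).2) := by
    simp [posT, hsk, hsi, hsj]
  have heT : Q.posT e = ((Q.posT z).1, (Q.posT z).2 + 1) := by
    simp [posT, hek, hei, hej, add_assoc]
  have hsS : Q.posS s = ((Q.posS z).1 + 1, (Q.posS z).2) := by
    simp [posS, hsk, hsi, hsj, add_assoc]
  have heS : Q.posS e = ((Q.posS z).1, (Q.posS z).2 + 1) := by
    simp [posS, hek, hei, hej]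
  have hsz : s ≠ z := fun h => by rw [h] at hsi; omega
  have hez : e ≠ z := fun h => by rw [h] at hej; omega
  have hpm : p ∈ Finset.Icc 1 (Q.uT (Q.t z.k)) := Finset.mem_Icc.2 ⟨hp, hp'⟩
  have hqm : q ∈ Finset.Icc 1 (Q.uS (Q.s z.k)) := Finset.mem_Icc.2 ⟨hq, hq'⟩
  have hsH : R1.OnHorizontal s := (h2 s).2 (Or.inl ⟨⟨p, by rwa [hsk], by
    rw [hsT, hsk]; exact hzH.2.1⟩, hsz⟩)
  have heH : R1.OnHorizontal e := (h2 e).2 (Or.inl ⟨⟨p, by rwa [hek], by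
    rw [heT, hek]; exact hzH.2.2⟩, hez⟩)
  have hsV : R2.OnVertical s := (h5 s).2 (Or.inl ⟨⟨q, by rwa [hsk], by
    rw [hsS, hsk]; exact hzV.2.1⟩, hsz⟩)
  have heV : R2.OnVertical e := (h5 e).2 (Or.inl ⟨⟨q, by rwa [hek], by
    rw [heS, hek]; exact hzV.2.2⟩, hez⟩)
  refine ⟨R1.combine R2, ⟨fun y hy => ?_, fun y hy => ?_⟩, fun y => ?_, h1, h4⟩
  · show R2.OnVertical y
    rcases h3 y hy with ⟨h, hne⟩ | rfl | ⟨ht, h | h⟩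
    · exact (h5 y).2 (Or.inl ⟨hR.1 y h, hne⟩)
    · exact (h5 y).2 (Or.inr rfl)
    · obtain rfl := posT_injective (ht.trans (by rw [hsk])) (h.trans hsT.symm)
      exact hsV
    · obtain rfl := posT_injective (ht.trans (by rw [hek])) (h.trans heT.symm)
      exact heV
  · show R1.OnHorizontal y
    have hinj : ∀ w : Q.Vertex, Q.s y.k = Q.s w.k → Q.posS y = Q.posS w → y = w := fun w hs hw =>
      Vertex.op_injective (posT_injective (Q := Q.op) hs (by rw [posT_op, posT_op, hw]))
    rcases h6 y hy with ⟨h, hne⟩ | rfl | ⟨ht, h | h⟩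
    · exact (h2 y).2 (Or.inl ⟨hR.2 y h, hne⟩)
    · exact (h2 y).2 (Or.inr rfl)
    · obtain rfl := hinj s (ht.trans (by rw [hsk])) (h.trans hsS.symm)
      exact hsH
    · obtain rfl := hinj e (ht.trans (by rw [hek])) (h.trans heS.symm)
      exact heH
  · show R1.OnHorizontal y ∧ R2.OnVertical y ↔ _
    rw [h2, h5]
    tauto

variable (hQ : Q.Admissible) (hR : R.IsStraight)
include hQ hR

/-- The number of vertical paths bounds the index of a vertical path through a NW corner. -/
theorem index_le_of_corner {z : Q.Vertex} {p n : ℕ} (hp : 1 ≤ p) (hp' : p ≤ Q.uT (Q.t z.k))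
    (hzH : IsNWCorner (R.H (Q.t z.k) p) (Q.posT z)) (hn : 1 ≤ n) (hn' : n ≤ Q.vT (Q.t z.k))
    (hth : Through (R.nu (Q.t z.k) n) (Q.posT z)) : n + Q.uT (Q.t z.k) ≤ p + Q.vT (Q.t z.k) := by
  have G := grid hQ hR (Q.t z.k)
  have hspec := (R.hRow_spec hp hp').2.1
  have hb := posT_bounds z
  have h0 := ((hspec _).1 hzH.1).1
  have h1 := ((hspec _).1 hzH.2.1).1
  -- The point south of `z` is used because its row is at least `p + 1`, as `seChain` requires; `z`
  -- is weakly NW of it.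
  have h2 := (G.seChain (Q.uT (Q.t z.k) - p) p ((Q.posT z).1 + 1, (Q.posT z).2) (by omega)
    (fun hlt => by
      have h3 := G.lt_H p (p + 1) hp (by omega) (by omega)
        ((Q.posT z).2 - ((Q.posT z).1 + 1))
      have h4 := G.row_ge p hp hp' ((Q.posT z).2 - (Q.posT z).1)
      simp only [Through] at h0 h1 ⊢
      omega) hb.2.2.1).2 n _ hn hn' hth (by simp only; omega) le_rfl
  omega

/-- If the point SE of a common NW corner lies on a horizontal path, it is a NW corner of the next
horizontal path. -/
theorem corner_succ {z x : Q.Vertex} {p q : ℕ} (hp : 1 ≤ p)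
    (hp' : p ≤ Q.uT (Q.t z.k)) (hq : 1 ≤ q) (hq' : q ≤ Q.uS (Q.s z.k))
    (hzH : IsNWCorner (R.H (Q.t z.k) p) (Q.posT z))
    (hzV : IsNWCorner (R.V (Q.s z.k) q) (Q.posS z))
    (hk : x.k = z.k) (hi : x.i = z.i + 1) (hj : x.j = z.j + 1) (hx : R.OnHorizontal x) :
    p + 1 ≤ Q.uT (Q.t z.k) ∧ IsNWCorner (R.H (Q.t z.k) (p + 1)) (Q.posT x) ∧ R.OnVertical x := by
  have G := grid hQ hR (Q.t z.k)
  have hspec := (R.hRow_spec hp hp').2.1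
  have hb := posT_bounds z
  have hxT : Q.posT x = ((Q.posT z).1 + 1, (Q.posT z).2 + 1) := by
    simp only [posT, hk, hi, hj, Prod.mk.injEq]
    push_cast
    constructor <;> ring
  obtain ⟨p', h1, h2, h3⟩ := (R.onHorizontal_iff x).1 hx
  rw [hxT, hk, through_iff (d := (Q.posT z).2 - (Q.posT z).1) (by ring)] at h3
  rw [hk] at h2
  have hρ0 := ((hspec _).1 hzH.1).1
  have hρs := ((hspec _).1 hzH.2.1).1
  have hρe := ((hspec _).1 hzH.2.2).1
  rw [through_iff (d := (Q.posT z).2 - (Q.posT z).1 - 1) (by ring)] at hρs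
  rw [through_iff (d := (Q.posT z).2 - (Q.posT z).1 + 1) (by ring)] at hρe
  simp only [Through] at hρ0
  obtain rfl := G.eq_succ_of_ρ hp hp' h1 h2 (d := (Q.posT z).2 - (Q.posT z).1) (by omega)
  have hth := (R.mem_V_iff z hq hq').1 hzV.1
  have hv := Q.vertOffset_add_le_vT z.k
  have hle := index_le_of_corner hQ hR hp hp' hzH (by omega) (by omega) hth
  have heV := (((R.vRow_spec hq hq').2.1 _).1 hzV.2.2).1
  have he : R.nuPage z.k q ((Q.posT z).2 - (Q.posT z).1 + 1) = (Q.posT z).1 := by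
    have h4 : (Q.posT z).2 - (Q.posT z).1 + 1 - Q.colOffset z.k - Q.rowOffset z.k =
        (Q.posS z).2 + 1 - (Q.posS z).1 := by simp only [posT, posS]; ring
    simp only [nuPage, h4]
    rw [Through] at heV
    rw [heV]
    simp only [posT, posS]; ring
  rw [← R.nu_eq z.k hq hq'] at he
  -- By the index bound there is one more vertical path; it shows that the point east of `x` is
  -- still in the array.
  have hlt := G.lt_V (Q.vertOffset z.k + q) (Q.vertOffset z.k + q + 1) (by omega) (by omega)
    (by omega) ((Q.posT z).2 - (Q.posT z).1 + 1)
  have hcol := G.col_le (Q.vertOffset z.k + q + 1) (by omega) (by omega)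
    ((Q.posT z).2 - (Q.posT z).1 + 1)
  have hf := G.stepH (p + 1) (by omega) h2
  have hs := G.lt_H p (p + 1) hp (by omega) h2 ((Q.posT z).2 - (Q.posT z).1 - 1)
  have he' := G.lt_H p (p + 1) hp (by omega) h2 ((Q.posT z).2 - (Q.posT z).1 + 1)
  -- `H (p + 1)` stays SE of `H p` on the two neighbouring diagonals, and this forces a NW corner at
  -- `x`.
  have hf1 := hf.pred ((Q.posT z).2 - (Q.posT z).1)
  have hf2 := hf ((Q.posT z).2 - (Q.posT z).1)
  have hspec' := (R.hRow_spec (p := p + 1) (by omega) h2).2.1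
  have hc : IsNWCorner (R.H (Q.t z.k) (p + 1)) (Q.posT x) := by
    rw [hxT]
    refine ⟨(hspec' _).2 ⟨(through_iff (by ring)).2 h3, ?_⟩,
      (hspec' _).2 ⟨(through_iff (d := (Q.posT z).2 - (Q.posT z).1 - 1) (by ring)).2 ?_, ?_⟩,
      (hspec' _).2 ⟨(through_iff (d := (Q.posT z).2 - (Q.posT z).1 + 1) (by ring)).2 ?_, ?_⟩⟩ <;>
    simp only <;> omega
  exact ⟨h2, hc, hR.1 x (Or.inl ⟨p + 1, Finset.mem_Icc.2 ⟨by omega, by rw [hk]; exact h2⟩, by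
    rw [hk]; exact hc⟩)⟩

omit hR in
theorem exists_vertex_southeast (R : Q.RoadMap) {z : Q.Vertex} {p q : ℕ}
    (hp : 1 ≤ p) (hp' : p ≤ Q.uT (Q.t z.k)) (hq : 1 ≤ q) (hq' : q ≤ Q.uS (Q.s z.k))
    (hzH : IsNWCorner (R.H (Q.t z.k) p) (Q.posT z))
    (hzV : IsNWCorner (R.V (Q.s z.k) q) (Q.posS z)) :
    ∃ x : Q.Vertex, x.k = z.k ∧ x.i = z.i + 1 ∧ x.j = z.j + 1 := by
  have hb := z.bounds
  have h1 := (((R.hRow_spec hp hp').2.1 _).1 hzH.2.1).1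
  have h2 := (R.hRow_spec hp hp').2.2.2.2.1 ((Q.posT z).2 - ((Q.posT z).1 + 1))
  have h3 := (((R.vRow_spec hq hq').2.1 _).1 hzV.2.2).1
  have h4 := (R.vRow_spec hq hq').2.2.2.2.1 ((Q.posS z).2 + 1 - (Q.posS z).1)
  have h5 := (hQ.target (Q.t z.k)).2.1
  have h6 := (hQ.source (Q.s z.k)).2.1
  simp only [Through] at h1 h3
  rw [h1] at h2
  rw [h3] at h4
  simp only [posT, posS, aT, bS] at h2 h4 h5 h6
  exact ⟨⟨z.k, z.i + 1, z.j + 1, Finset.mem_Icc.2 (by omega), Finset.mem_Icc.2 (by omega)⟩,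
    rfl, rfl, rfl⟩

omit hR in
/-- A common NW corner can be replaced by a vertex SE of it, by flipping it and the common NW
corners that follow it on the diagonal. -/
theorem exists_flip_of_both : ∀ (t : ℕ) (R : Q.RoadMap), R.IsStraight → ∀ (z : Q.Vertex) (p q : ℕ),
    p + t = Q.uT (Q.t z.k) → 1 ≤ p → 1 ≤ q → q ≤ Q.uS (Q.s z.k) →
    IsNWCorner (R.H (Q.t z.k) p) (Q.posT z) → IsNWCorner (R.V (Q.s z.k) q) (Q.posS z) →
    ∃ (x : Q.Vertex) (R' : Q.RoadMap), ¬ (R.OnHorizontal x ∧ R.OnVertical x) ∧ Later z x ∧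
      R'.IsStraight ∧ (∀ y, R'.OnHorizontal y ∧ R'.OnVertical y ↔
        (R.OnHorizontal y ∧ R.OnVertical y) ∧ y ≠ z ∨ y = x) ∧
      (∀ m, m < p → R'.H (Q.t z.k) m = R.H (Q.t z.k) m) ∧
      ∀ m, m < q → R'.V (Q.s z.k) m = R.V (Q.s z.k) m := by
  -- By `corner_succ` and its transpose, the point SE of `z` lies on paths of both kinds or of
  -- neither.
  have single : ∀ (R : Q.RoadMap), R.IsStraight → ∀ (z x : Q.Vertex) (p q : ℕ),
      1 ≤ p → p ≤ Q.uT (Q.t z.k) → 1 ≤ q → q ≤ Q.uS (Q.s z.k) →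
      IsNWCorner (R.H (Q.t z.k) p) (Q.posT z) → IsNWCorner (R.V (Q.s z.k) q) (Q.posS z) →
      x.k = z.k → x.i = z.i + 1 → x.j = z.j + 1 →
      (R.OnHorizontal x → p + 1 ≤ Q.uT (Q.t z.k) ∧ q + 1 ≤ Q.uS (Q.s z.k) ∧
        IsNWCorner (R.H (Q.t z.k) (p + 1)) (Q.posT x) ∧
        IsNWCorner (R.V (Q.s z.k) (q + 1)) (Q.posS x)) ∧ (R.OnHorizontal x ↔ R.OnVertical x) := by
    intro R hR z x p q hp hp' hq hq' hzH hzV hk hi hj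
    have h1 := fun h => corner_succ hQ hR hp hp' hq hq' hzH hzV hk hi hj h
    have h2 := fun h => corner_succ hQ.op hR.op (z := z.op) (x := x.op) hq hq' hp hp'
      (isNWCorner_map_swap.2 hzV) (isNWCorner_map_swap.2 hzH) hk hj hi h
    rw [R.onHorizontal_op, R.onVertical_op] at h2
    refine ⟨fun h => ?_, fun h => (h1 h).2.2, fun h => (h2 h).2.2⟩
    have h3 := h1 h
    have h4 := h2 h3.2.2
    exact ⟨h3.1, h4.1, h3.2.1, isNWCorner_map_swap.1 h4.2.1⟩
  have later : ∀ z x : Q.Vertex, x.k = z.k → x.i = z.i + 1 → x.j = z.j + 1 → Later z x :=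
    fun z x hk hi hj => Or.inr ⟨hk.symm, by omega, by omega⟩
  intro t
  induction t with
  | zero =>
    intro R hR z p q hpt hp hq hq' hzH hzV
    obtain ⟨x, hk, hi, hj⟩ := exists_vertex_southeast hQ R hp (by omega) hq hq' hzH hzV
    obtain ⟨h1, h2⟩ := single R hR z x p q hp (by omega) hq hq' hzH hzV hk hi hj
    have hxH : ¬ R.OnHorizontal x := fun h => by have := (h1 h).1; omega
    obtain ⟨R', h3, h4, h5, h6⟩ := exists_flip_of_not_onHorizontal hR hp (by omega) hq hq' hzH hzV
      hk hi hj hxH (fun h => hxH (h2.2 h))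
    exact ⟨x, R', fun h => hxH h.1, later z x hk hi hj, h3, h4, fun m hm => h5 m hm.ne,
      fun m hm => h6 m hm.ne⟩
  | succ t ih =>
    intro R hR z p q hpt hp hq hq' hzH hzV
    obtain ⟨x, hk, hi, hj⟩ := exists_vertex_southeast hQ R hp (by omega) hq hq' hzH hzV
    obtain ⟨h1, h2⟩ := single R hR z x p q hp (by omega) hq hq' hzH hzV hk hi hj
    by_cases hxH : R.OnHorizontal x
    -- If `x` is occupied, it is a common NW corner of the next two paths. Flipping it first, by the
    -- induction hypothesis, vacates it for the flip of `z`.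
    · obtain ⟨hp1, hq1, hxH', hxV'⟩ := h1 hxH
      obtain ⟨w, R₁, hw, hxw, hR₁, h3, h4, h5⟩ := ih R hR x (p + 1) (q + 1)
        (by rw [hk]; omega) (by omega) (by omega) (by rw [hk]; exact hq1) (by rw [hk]; exact hxH')
        (by rw [hk]; exact hxV')
      rw [hk] at h4 h5
      have hzH₁ : IsNWCorner (R₁.H (Q.t z.k) p) (Q.posT z) := by rwa [h4 p (by omega)]
      have hzV₁ : IsNWCorner (R₁.V (Q.s z.k) q) (Q.posS z) := by rwa [h5 q (by omega)]
      have hwx : w ≠ x := fun h => hw (by rw [h]; exact ⟨hxH, h2.1 hxH⟩)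
      obtain ⟨-, h6⟩ := single R₁ hR₁ z x p q hp (by omega) hq hq' hzH₁ hzV₁ hk hi hj
      have hx₁ : ¬ R₁.OnHorizontal x := fun h => by
        rcases (h3 x).1 ⟨h, h6.1 h⟩ with h | h
        · exact h.2 rfl
        · exact hwx h.symm
      obtain ⟨R₂, h7, h8, h9, h10⟩ := exists_flip_of_not_onHorizontal hR₁ hp (by omega) hq hq'
        hzH₁ hzV₁ hk hi hj hx₁ (fun h => hx₁ (h6.2 h))
      have hzw : Later z w := by
        rcases hxw with h | h
        · exact Or.inl (by rwa [hk] at h)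
        · exact Or.inr ⟨hk.symm.trans h.1, by omega, by omega⟩
      have hzC : R.OnHorizontal z ∧ R.OnVertical z :=
        ⟨⟨p, Finset.mem_Icc.2 ⟨hp, by omega⟩, hzH.1⟩, ⟨q, Finset.mem_Icc.2 ⟨hq, hq'⟩, hzV.1⟩⟩
      have hxC : R.OnHorizontal x ∧ R.OnVertical x := ⟨hxH, h2.1 hxH⟩
      have hwz : w ≠ z := fun h => hw (h ▸ hzC)
      refine ⟨w, R₂, hw, hzw, h7, fun y => ?_, fun m hm => (h9 m hm.ne).trans (h4 m (by omega)),
        fun m hm => (h10 m hm.ne).trans (h5 m (by omega))⟩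
      rw [h8, h3]
      by_cases hyx : y = x
      · subst hyx
        have : y ≠ z := fun h => by rw [h] at hi; omega
        tauto
      · by_cases hyw : y = w
        · subst hyw
          tauto
        · tauto
    · obtain ⟨R', h3, h4, h5, h6⟩ := exists_flip_of_not_onHorizontal hR hp (by omega) hq hq' hzH hzV
        hk hi hj hxH (fun h => hxH (h2.2 h))
      exact ⟨x, R', fun h => hxH h.1, later z x hk hi hj, h3, h4, fun m hm => h5 m hm.ne,
        fun m hm => h6 m hm.ne⟩

end RoadMap
end BipartiteData

/-! ### Flipping an essential NW corner. -/

namespace BipartiteData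

variable {T S : Type*} [DecidableEq T] [DecidableEq S] {Q : BipartiteData T S}

namespace RoadMap

variable {R : Q.RoadMap} (hQ : Q.Admissible) (hR : R.IsStraight)
include hQ hR

theorem segmentIn_of_slot {α : T} {m n : ℕ} {i e w : ℤ}
    (s : Slot (Q.uT α) (Q.vT α) (R.hRow α) (R.nu α) m n i e w) :
    SegmentIn (R.H α m) (i, e + i, w + i) := by
  intro _
  have G := grid hQ hR α
  have hspec := (R.hRow_spec s.one_le s.le).2.1
  have hlt := s.lt_end
  have h1 := G.col_pos n s.one_le' (by have := s.lt; omega) e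
  have h2 := G.col_le (n + 1) (by omega) s.lt w
  rw [s.start] at h1
  rw [s.finish] at h2
  refine ⟨(hspec _).2 ⟨(through_iff (d := e - 1) (by ring)).2 s.south, ?_⟩, fun j hj hj' =>
    (hspec _).2 ⟨(through_iff rfl).2 (s.flat _ ?_ ?_), ?_⟩⟩ <;> simp only at * <;> omega

/-- By `corner_shift` these are the possible new corners of a shifted path, so straightness of the
horizontal paths survives. -/
theorem exists_nu_of_slot {α : T} {m n : ℕ} {i e w : ℤ}
    (s : Slot (Q.uT α) (Q.vT α) (R.hRow α) (R.nu α) m n i e w) {c : ℤ × ℤ}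
    (hc : c = (i + 1, e + i) ∨ c = (i, w + i) ∨ c = (i + 1, w + i)) :
    SomeThrough (Q.vT α) (R.nu α) c := by
  have G := grid hQ hR α
  have hlt := s.lt
  have hn := s.one_le'
  rcases hc with rfl | rfl | rfl
  · exact ⟨n, hn, by omega, (through_iff (by ring)).2 (s.south_V G)⟩
  · exact ⟨n + 1, by omega, hlt, (through_iff (by ring)).2 s.finish⟩
  · exact ⟨n + 1, by omega, hlt, (through_iff (by ring)).2 (s.south_finish G)⟩

/-- A NW corner of `H p` at which a vertical path that is not the last possible one leaves `H p` to
the north can be replaced by a vertex SE of it, by shifting parts of horizontal paths. -/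
theorem exists_flip_of_north {z : Q.Vertex} {p n : ℕ} (hp : 1 ≤ p) (hp' : p ≤ Q.uT (Q.t z.k))
    (hz : IsNWCorner (R.H (Q.t z.k) p) (Q.posT z)) (hn : 1 ≤ n) (hn' : n ≤ Q.vT (Q.t z.k))
    (hth : Through (R.nu (Q.t z.k) n) (Q.posT z))
    (hnorth : R.nu (Q.t z.k) n ((Q.posT z).2 - (Q.posT z).1 + 1) = (Q.posT z).1 - 1)
    (hne : n + Q.uT (Q.t z.k) ≠ p + Q.vT (Q.t z.k)) :
    ∃ (x : Q.Vertex) (R' : Q.RoadMap), ¬ (R.OnHorizontal x ∧ R.OnVertical x) ∧ Later z x ∧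
      R'.IsStraight ∧ ∀ y, R'.OnHorizontal y ∧ R'.OnVertical y ↔
        (R.OnHorizontal y ∧ R.OnVertical y) ∧ y ≠ z ∨ y = x := by
  have G := grid hQ hR (Q.t z.k)
  have hspec := (R.hRow_spec hp hp').2.1
  have hle := index_le_of_corner hQ hR hp hp' hz hn hn' hth
  obtain ⟨i, hi⟩ : ∃ i, i = (Q.posT z).1 := ⟨_, rfl⟩
  obtain ⟨d, hd⟩ : ∃ d, d = (Q.posT z).2 - (Q.posT z).1 := ⟨_, rfl⟩
  have hzp : Q.posT z = (i, d + i) := Prod.ext hi.symm (by simp only; omega)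
  have hρ0 := ((hspec _).1 hz.1).1
  have hρs := ((hspec _).1 hz.2.1).1
  have hρe := ((hspec _).1 hz.2.2).1
  rw [← hd, ← hi] at hnorth
  rw [hzp] at hρ0 hρs hρe hth
  rw [through_iff (d := d) (by ring)] at hρ0
  rw [through_iff (d := d) (by ring)] at hth
  rw [through_iff (d := d - 1) (by ring)] at hρs
  rw [through_iff (d := d + 1) (by ring)] at hρe
  simp only at hρs hρe
  have hlt := G.lt_V n (n + 1) hn (by omega) (by omega) d
  -- By `hle` and `hne` the index inequality is strict, so there is a path `ν (n + 1)` to end the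
  -- slot that starts at `z`.
  obtain ⟨w, hw, s⟩ := G.exists_slot hp hp' hn (by omega) le_rfl hρs
    (fun x h1 h2 => by rcases (show x = d ∨ x = d + 1 by omega) with rfl | rfl <;> assumption)
    hth (by omega) (by omega)
  obtain ⟨g, c, hgp, hg1, hg2, hc1, hc2, hc3, hc4, hc5, hg3⟩ :=
    G.exists_isShift (Q.uT (Q.t z.k) - p) p n i d w (by omega) s (by omega)
  obtain ⟨x, hxα, hxc⟩ : ∃ x : Q.Vertex, Q.t x.k = Q.t z.k ∧ Q.posT x = c := by
    obtain ⟨l, hl, hl', hcl⟩ := hc1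
    have h1 := G.col_pos l hl hl' (c.2 - c.1)
    have h2 := G.col_le l hl hl' (c.2 - c.1)
    have h3 := G.row_bounds hp hp' d
    rw [hcl] at h1 h2
    exact exists_posT (by omega) hc3 (by omega) (by omega)
  have hxH : ¬ R.OnHorizontal x := fun h => hc2 (by
    have := (R.onHorizontal_iff x).1 h
    rwa [hxα, hxc] at this)
  let f : T → ℕ → ℤ × ℤ × ℤ := fun α k =>
    if α = Q.t z.k ∧ p ≤ k ∧ k ≤ Q.uT (Q.t z.k) then g k else (0, 0, 0)
  have hempty : ∀ c, c ∉ segment (0, 0, 0) := fun c hc => by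
    simp only [mem_segment] at hc; omega
  have hslot : ∀ α k, f α k = (0, 0, 0) ∨ ∃ n' i' e' w',
      Slot (Q.uT α) (Q.vT α) (R.hRow α) (R.nu α) k n' i' e' w' ∧ f α k = (i', e' + i', w' + i') := by
    intro α k
    by_cases h : α = Q.t z.k ∧ p ≤ k ∧ k ≤ Q.uT (Q.t z.k)
    · simp only [f, if_pos h]
      obtain ⟨rfl, h1, h2⟩ := h
      rcases h1.lt_or_eq with h3 | rfl
      · exact hg1 k h3 h2
      · exact Or.inr ⟨_, _, _, _, s, hgp⟩
    · exact Or.inl (if_neg h)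
  have hf : ∀ {α k c}, c ∈ segment (f α k) → α = Q.t z.k ∧ p ≤ k ∧ k ≤ Q.uT (Q.t z.k) ∧
      c ∈ segment (g k) := by
    intro α k c hc
    by_cases h : α = Q.t z.k ∧ p ≤ k ∧ k ≤ Q.uT (Q.t z.k)
    · simp only [f, if_pos h] at hc
      exact ⟨h.1, h.2.1, h.2.2, hc⟩
    · simp only [f, if_neg h] at hc
      exact absurd hc (hempty c)
  have hf' : ∀ {k c}, p ≤ k → k ≤ Q.uT (Q.t z.k) → c ∈ segment (g k) →
      c ∈ segment (f (Q.t z.k) k) := by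
    intro k c h1 h2 h3
    simp only [f, if_pos (⟨trivial, h1, h2⟩ : True ∧ p ≤ k ∧ k ≤ Q.uT (Q.t z.k))]
    exact h3
  have hseg : ∀ α, ∀ k ∈ Finset.Icc 1 (Q.uT α), SegmentIn (R.H α k) (f α k) := by
    intro α k _
    rcases hslot α k with h | ⟨n', i', e', w', s', h⟩
    · rw [h]
      exact fun h => absurd h (lt_irrefl _)
    · rw [h]
      exact segmentIn_of_slot hQ hR s'
  have hdisj : ∀ α, ∀ k ∈ Finset.Icc 1 (Q.uT α), ∀ l ∈ Finset.Icc 1 (Q.uT α),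
      ∀ c ∈ segment (f α k), (c.1 + 1, c.2 + 1) ∈ R.H α l →
        (c.1 + 1, c.2 + 1) ∈ segment (f α l) := by
    intro α k _ l hl c hc hmem
    obtain ⟨rfl, h1, h2, h3⟩ := hf hc
    rw [Finset.mem_Icc] at hl
    have h4 := hg2 k l c h1 h2 hl.1 hl.2 h3 (((R.hRow_spec hl.1 hl.2).2.1 _).1 hmem).1
    by_cases hpl : p ≤ l
    · exact hf' hpl hl.2 h4
    · exfalso
      have h5 := ((R.hRow_spec (by omega) h2).2.1 _).1 ((hseg _ k (Finset.mem_Icc.2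
        ⟨by omega, h2⟩)).subset hc)
      have h6 := ((R.hRow_spec hl.1 hl.2).2.1 _).1 hmem
      have h7 := G.ρ_lt_of_diag (by omega) h2 hl.1 h5.1 h6.1
        ⟨by simp only; omega, by simp only; omega⟩
      omega
  have hin : ∀ {y : Q.Vertex} {k : ℕ}, Q.posT y ∈ segment (f (Q.t y.k) k) →
      1 ≤ k ∧ k ≤ Q.uT (Q.t y.k) ∧ Q.posT y ∈ R.H (Q.t y.k) k := by
    intro y k h
    obtain ⟨h1, h2, h3, -⟩ := hf h
    have h4 : k ≤ Q.uT (Q.t y.k) := by rw [h1]; exact h3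
    exact ⟨by omega, h4, (hseg _ k (Finset.mem_Icc.2 ⟨by omega, h4⟩)).subset h⟩
  have hV : ∀ y, (R.shiftH f hseg hdisj).OnVertical y ↔ R.OnVertical y := fun y => Iff.rfl
  -- The vertical paths do not change, so only points on them matter; there `IsShift` balances gains
  -- and losses up to `z` and `x`.
  have hH : ∀ y, R.OnVertical y → ((R.shiftH f hseg hdisj).OnHorizontal y ↔
      R.OnHorizontal y ∧ y ≠ z ∨ y = x) := by
    intro y hyV
    rw [R.onVertical_iff hQ] at hyV
    constructor
    · rintro ⟨k, hk, hmem⟩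
      rcases ((hseg _ k hk).mem_map _).1 hmem with ⟨h1, h2⟩ | h1
      · refine Or.inl ⟨⟨k, hk, h1⟩, ?_⟩
        rintro rfl
        rw [Finset.mem_Icc] at hk
        obtain rfl := R.H_unique hk.1 hk.2 hp hp' h1 hz.1
        refine h2 (hf' le_rfl hp' ?_)
        rw [hgp, hzp]
        exact ⟨rfl, le_rfl, by simp only; omega⟩
      · obtain ⟨h3, h4, h5, h6⟩ := hf h1
        rw [h3] at hyV
        rcases (hg3 _ hyV).1 ⟨k, h4, h5, h6⟩ with ⟨l, hl, hl', h7⟩ | h7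
        · have h8 := hf' (k := l) (by omega) hl' h7
          rw [← h3] at h8
          obtain ⟨h9, h10, h11⟩ := hin h8
          refine Or.inl ⟨⟨l, Finset.mem_Icc.2 ⟨h9, h10⟩, h11⟩, ?_⟩
          rintro rfl
          have := R.H_unique h9 h10 hp hp' h11 hz.1
          exact hl.ne' this
        · exact Or.inr (posT_injective (h3.trans hxα.symm) (h7.trans hxc.symm))
    · rintro (⟨⟨k, hk, hmem⟩, hyz⟩ | rfl)
      · by_cases h1 : Q.posT y ∈ segment (f (Q.t y.k) k)
        · obtain ⟨h3, h4, h5, h6⟩ := hf h1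
          rw [h3] at hyV
          rcases h4.lt_or_eq with h7 | rfl
          · obtain ⟨l, hl, hl', h8⟩ := (hg3 _ hyV).2 (Or.inl ⟨k, h7, h5, h6⟩)
            have hl1 : l ∈ Finset.Icc 1 (Q.uT (Q.t y.k)) :=
              Finset.mem_Icc.2 ⟨by omega, by rw [h3]; exact hl'⟩
            have h9 := hf' hl hl' h8
            rw [← h3] at h9
            exact ⟨l, hl1, ((hseg _ l hl1).mem_map _).2 (Or.inr h9)⟩
          -- The first segment contains no point of a vertical path besides `z`: past `z`, the path
          -- `ν n` is above the row `i` while `ν (n + 1)` is still below it.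
          · exfalso
            rw [hgp] at h6
            simp only [mem_segment] at h6
            obtain ⟨l, hl, hl', h7⟩ := hyV
            simp only [Through] at h7
            have hyne : Q.posT y ≠ Q.posT z := fun h => hyz (posT_injective h3 h)
            have h8 : (Q.posT y).2 ≠ d + i := fun h => hyne (by
              rw [hzp]; exact Prod.ext h6.1 h)
            have h9 := (G.stepV n hn hn').antitone
              (show d + 1 ≤ (Q.posT y).2 - (Q.posT y).1 by omega)
            have h10 := s.below ((Q.posT y).2 - (Q.posT y).1) (by omega) (by omega)
            have h11 := G.lt_of_ν_lt (n := n) (n' := l) (d := (Q.posT y).2 - (Q.posT y).1) hn' hl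
              (by omega)
            have h12 := G.lt_of_ν_lt (n := l) (n' := n + 1) (d := (Q.posT y).2 - (Q.posT y).1) hl'
              (by omega) (by omega)
            omega
        · exact ⟨k, hk, ((hseg _ k hk).mem_map _).2 (Or.inl ⟨hmem, h1⟩)⟩
      · rw [hxα, hxc] at hyV
        obtain ⟨l, hl, hl', h8⟩ := (hg3 _ hyV).2 (Or.inr rfl)
        have hl1 : l ∈ Finset.Icc 1 (Q.uT (Q.t y.k)) :=
          Finset.mem_Icc.2 ⟨by omega, by rw [hxα]; exact hl'⟩
        have h9 := hf' hl hl' h8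
        rw [← hxα, ← hxc] at h9
        exact ⟨l, hl1, ((hseg _ l hl1).mem_map _).2 (Or.inr h9)⟩
  -- The vertical path runs straight north through `z`. So `z` is not one of its corners, and the
  -- vertical corners remain on horizontal paths after `z` is given up.
  have hzV : ¬ (R.IsVerticalNWCorner z ∨ R.IsVerticalSECorner z) := by
    have hsouth := s.south_V G
    obtain ⟨q, hq, hq', hnq, hmem⟩ := R.exists_mem_V_of_nu hQ z hn hn' (by
      rw [hzp]; exact (through_iff (by ring)).2 hth)
    have hval : ∀ c ∈ R.V (Q.s z.k) q, R.nu (Q.t z.k) n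
        (c.2 - c.1 + Q.colOffset z.k + Q.rowOffset z.k) = c.1 - Q.rowOffset z.k := by
      intro c hc
      have h1 := (((R.vRow_spec hq hq').2.1 _).1 hc).1
      rw [hnq, R.nu_eq z.k hq hq', nuPage, show c.2 - c.1 + Q.colOffset z.k + Q.rowOffset z.k -
        Q.colOffset z.k - Q.rowOffset z.k = c.2 - c.1 by ring, h1]
    have hd' : d = (Q.posS z).2 - (Q.posS z).1 + Q.colOffset z.k + Q.rowOffset z.k := by
      rw [hd]; simp only [posT, posS]; ring
    have hi' : i = (Q.posS z).1 - Q.rowOffset z.k := by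
      rw [hi]; simp only [posT, posS]; ring
    rintro (⟨q', hq1, hc⟩ | ⟨q', hq1, hc⟩)
    · rw [Finset.mem_Icc] at hq1
      obtain rfl := R.op.H_unique (c := (Q.posS z).swap) hq1.1 hq1.2 hq hq'
        ((R.mem_op_H z _).2 hc.1) ((R.mem_op_H z _).2 hmem)
      have := hval _ hc.2.2
      simp only at this
      rw [show (Q.posS z).2 + 1 - (Q.posS z).1 + Q.colOffset z.k + Q.rowOffset z.k = d + 1 by
        omega] at this
      omega
    · rw [Finset.mem_Icc] at hq1
      obtain rfl := R.op.H_unique (c := (Q.posS z).swap) hq1.1 hq1.2 hq hq'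
        ((R.mem_op_H z _).2 hc.1) ((R.mem_op_H z _).2 hmem)
      have := hval _ hc.2.2
      simp only at this
      rw [show (Q.posS z).2 - 1 - (Q.posS z).1 + Q.colOffset z.k + Q.rowOffset z.k = d - 1 by
        omega] at this
      omega
  refine ⟨x, R.shiftH f hseg hdisj, fun h => hxH h.1,
    later_of_diag hxα.symm (by rw [hxc, hzp]; exact ⟨hc4, hc5⟩), ⟨fun y hy => ?_, fun y hy => ?_⟩,
    fun y => ?_⟩
  · rw [hV]
    obtain ⟨k, hk, hc⟩ : ∃ k ∈ Finset.Icc 1 (Q.uT (Q.t y.k)),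
        IsNWCorner ((R.H (Q.t y.k) k).map (shiftPoint (f (Q.t y.k) k))) (Q.posT y) ∨
        IsSECorner ((R.H (Q.t y.k) k).map (shiftPoint (f (Q.t y.k) k))) (Q.posT y) := by
      rcases hy with ⟨m, hm, hc⟩ | ⟨m, hm, hc⟩
      · exact ⟨m, hm, Or.inl hc⟩
      · exact ⟨m, hm, Or.inr hc⟩
    rcases (R.H_path _ k hk).corner_shift (hseg _ k hk) hc with ⟨h1, -⟩ | ⟨hlt, h1⟩
    · exact hR.1 y (h1.imp (fun h => ⟨k, hk, h⟩) (fun h => ⟨k, hk, h⟩))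
    · rcases hslot (Q.t y.k) k with h | ⟨n', i', e', w', s', h⟩
      · rw [h] at hlt
        exact absurd hlt (lt_irrefl _)
      · rw [h] at h1
        exact (R.onVertical_iff hQ y).2 (exists_nu_of_slot hQ hR s' h1)
  · have hy' : R.IsVerticalNWCorner y ∨ R.IsVerticalSECorner y := hy
    have hyV : R.OnVertical y := by
      rcases hy' with ⟨q, hq, h⟩ | ⟨q, hq, h⟩
      · exact ⟨q, hq, h.1⟩
      · exact ⟨q, hq, h.1⟩
    exact (hH y hyV).2 (Or.inl ⟨hR.2 y hy', fun h => hzV (h ▸ hy')⟩)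
  · rw [hV]
    have hxV : R.OnVertical x := (R.onVertical_iff hQ x).2 (by rw [hxα, hxc]; exact hc1)
    constructor
    · rintro ⟨h1, h2⟩
      rcases (hH y h2).1 h1 with h | h
      · exact Or.inl ⟨⟨h.1, h2⟩, h.2⟩
      · exact Or.inr h
    · rintro (⟨⟨h1, h2⟩, h3⟩ | rfl)
      · exact ⟨(hH y h2).2 (Or.inl ⟨h1, h3⟩), h2⟩
      · exact ⟨(hH y hxV).2 (Or.inr rfl), hxV⟩

/-- If the vertical path leaves `z` to the east, it must have come from the south, and `z` is a
common NW corner. If it leaves to the north, `z` is the NE endpoint of the intersection, so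
essentiality excludes equality in the index bound. -/
theorem exists_flip_of_horizontal {z : Q.Vertex} (hz : R.IsEssentialHorizontalNWCorner z) :
    ∃ (x : Q.Vertex) (R' : Q.RoadMap), ¬ (R.OnHorizontal x ∧ R.OnVertical x) ∧ Later z x ∧
      R'.IsStraight ∧ ∀ y, R'.OnHorizontal y ∧ R'.OnVertical y ↔
        (R.OnHorizontal y ∧ R.OnVertical y) ∧ y ≠ z ∨ y = x := by
  obtain ⟨hzc, hess⟩ := hz
  obtain ⟨q, hq, hmem⟩ := hR.1 z (Or.inl hzc)
  obtain ⟨p, hp, hzp⟩ := hzc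
  have hp0 := hp
  have hq0 := hq
  rw [Finset.mem_Icc] at hp hq
  have G := grid hQ hR (Q.t z.k)
  have hspec := (R.hRow_spec hp.1 hp.2).2.1
  have hv := Q.vertOffset_add_le_vT z.k
  have hth := (R.mem_V_iff z hq.1 hq.2).1 hmem
  have hρ0 := ((hspec _).1 hzp.1).1
  have hρs := ((hspec _).1 hzp.2.1).1
  have hρe := ((hspec _).1 hzp.2.2).1
  rw [through_iff (d := (Q.posT z).2 - (Q.posT z).1 - 1) (by ring)] at hρs
  rw [through_iff (d := (Q.posT z).2 - (Q.posT z).1 + 1) (by ring)] at hρe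
  have hρ0' := hρ0
  have hth' := hth
  simp only [Through] at hρ0' hth'
  have hstep := G.stepV (Q.vertOffset z.k + q) (by omega) (by omega)
  rcases hstep ((Q.posT z).2 - (Q.posT z).1) with heast | hnorth
  · have hsouth : R.nu (Q.t z.k) (Q.vertOffset z.k + q) ((Q.posT z).2 - (Q.posT z).1 - 1) =
        (Q.posT z).1 + 1 := by
      rcases hstep.pred ((Q.posT z).2 - (Q.posT z).1) with h | h
      · have := G.above_of_above hp.1 hp.2 (n := Q.vertOffset z.k + q) (by omega) (by omega)
          (d := (Q.posT z).2 - (Q.posT z).1 - 1) (e := (Q.posT z).2 - (Q.posT z).1) (by omega)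
          (by omega)
        omega
      · omega
    have hb := posT_bounds z
    have hzb := z.bounds
    have ha := G.row_bounds hp.1 hp.2 ((Q.posT z).2 - (Q.posT z).1 - 1)
    rw [R.nu_eq z.k hq.1 hq.2] at heast hsouth hth'
    have hcol := R.nuPage_col hQ z.k hq.1 hq.2 ((Q.posT z).2 - (Q.posT z).1 + 1)
    have hle : z.i + 1 ≤ Q.mT (Q.t z.k) := by
      rw [hρs] at ha
      have := ha.2
      simp only [posT, aT] at this
      omega
    have hle' : z.j + 1 ≤ Q.mS (Q.s z.k) := by
      rw [heast, hth'] at hcol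
      have := hcol.2
      simp only [posT] at this
      omega
    have hzV : IsNWCorner (R.V (Q.s z.k) q) (Q.posS z) := by
      refine ⟨hmem, ?_, ?_⟩
      · have := (R.mem_V_iff_nuPage (q := q) ⟨z.k, z.i + 1, z.j, Finset.mem_Icc.2 (by omega), z.hj⟩
          hq.1 hq.2).2 (by
            simp only [posT, Through, Nat.cast_add, Nat.cast_one] at hsouth ⊢
            rw [show (Q.colOffset z.k : ℤ) + z.j - (z.i + 1) = Q.colOffset z.k + z.j - z.i - 1 by
              ring, hsouth])
        simp only [posS, Nat.cast_add, Nat.cast_one] at this ⊢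
        rwa [← add_assoc] at this
      · have := (R.mem_V_iff_nuPage (q := q) ⟨z.k, z.i, z.j + 1, z.hi, Finset.mem_Icc.2 (by omega)⟩
          hq.1 hq.2).2 (by
            rw [hth'] at heast
            simp only [posT, Through, Nat.cast_add, Nat.cast_one] at heast ⊢
            rw [show (Q.colOffset z.k : ℤ) + (z.j + 1) - z.i = Q.colOffset z.k + z.j - z.i + 1 by
              ring, heast])
        simpa only [posS, Nat.cast_add, Nat.cast_one] using this
    obtain ⟨x, R', h1, h2, h3, h4, -⟩ := exists_flip_of_both hQ (Q.uT (Q.t z.k) - p) R hR z p q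
      (by omega) hp.1 hq.1 hq.2 hzp hzV
    exact ⟨x, R', h1, h2, h3, h4⟩
  · rw [hth'] at hnorth
    refine exists_flip_of_north hQ hR hp.1 hp.2 hzp (by omega) (by omega) hth hnorth fun he =>
      hess ⟨p, hp0, q, hq0, he, ⟨hzp.1, hmem⟩, fun y hyk hy => ?_⟩
    have hyH := hy.1
    have hyV := hy.2
    have hqy : q ≤ Q.uS (Q.s y.k) := by rw [hyk]; exact hq.2
    have hpy : p ≤ Q.uT (Q.t y.k) := by rw [hyk]; exact hp.2
    rw [R.mem_H_iff y hp.1 hpy, hyk] at hyH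
    rw [R.mem_V_iff y hq.1 hqy, hyk] at hyV
    simp only [Through] at hyH hyV
    -- After the step north the vertical path is strictly NW of `H p` and stays there, so no common
    -- point lies beyond `z`.
    have hd : (Q.posT y).2 - (Q.posT y).1 ≤ (Q.posT z).2 - (Q.posT z).1 := by
      by_contra hlt
      have := G.above_of_above hp.1 hp.2 (n := Q.vertOffset z.k + q) (by omega) (by omega)
        (d := (Q.posT z).2 - (Q.posT z).1 + 1) (e := (Q.posT y).2 - (Q.posT y).1) (by omega)
        (by omega)
      omega
    have h1 := (G.stepH p hp.1 hp.2).antitone hd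
    have h2 := (G.stepH p hp.1 hp.2).col_mono hd
    rw [hyH, hρ0'] at h1 h2
    simp only [posT, hyk] at h1 h2
    omega

/-- An essential NW corner of a concurrent vertex map can be replaced by a vertex that follows it. -/
theorem exists_flip {C : Finset Q.Vertex} (hC : R.Induces C) {z : Q.Vertex}
    (hz : R.IsEssentialNWCorner z) : z ∈ C ∧ ∃ x ∉ C, z < x ∧ ∃ R' : Q.RoadMap, R'.IsStraight ∧
      R'.Induces (insert x (C.erase z)) := by
  have key : ∃ (x : Q.Vertex) (R' : Q.RoadMap), ¬ (R.OnHorizontal x ∧ R.OnVertical x) ∧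
      Later z x ∧ R'.IsStraight ∧ ∀ y, R'.OnHorizontal y ∧ R'.OnVertical y ↔
        (R.OnHorizontal y ∧ R.OnVertical y) ∧ y ≠ z ∨ y = x := by
    rcases hz with hz | hz
    · exact exists_flip_of_horizontal hQ hR hz
    · obtain ⟨x, R', h1, h2, h3, h4⟩ := exists_flip_of_horizontal hQ.op hR.op (z := z.op)
        ((R.isEssentialHorizontalNWCorner_op z).2 hz)
      obtain ⟨x, rfl⟩ : ∃ y : Q.Vertex, x = y.op := ⟨⟨x.k, x.j, x.i, x.hj, x.hi⟩, rfl⟩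
      rw [R.onHorizontal_op, R.onVertical_op] at h1
      refine ⟨x, R'.op, fun h => h1 h.symm, Or.imp id (fun h => ⟨h.1, h.2.2, h.2.1⟩) h2, h3.op,
        fun y => ?_⟩
      have := h4 y.op
      rw [R.onHorizontal_op, R.onVertical_op, Vertex.op_injective.ne_iff,
        Vertex.op_injective.eq_iff] at this
      exact ((and_congr (R'.onHorizontal_op y.op) (R'.onVertical_op y.op)).trans and_comm).trans
        (this.trans (by tauto))
  refine ⟨(hC z).2 ?_, ?_⟩
  · rcases hz with ⟨hz, -⟩ | ⟨hz, -⟩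
    · exact ⟨by obtain ⟨p, hp, h⟩ := hz; exact ⟨p, hp, h.1⟩, hR.1 z (Or.inl hz)⟩
    · exact ⟨hR.2 z (Or.inl hz), by obtain ⟨p, hp, h⟩ := hz; exact ⟨p, hp, h.1⟩⟩
  · obtain ⟨x, R', h1, h2, h3, h4⟩ := key
    refine ⟨x, fun h => h1 ((hC x).1 h), h2.lt, R', h3, fun y => ?_⟩
    rw [h4, Finset.mem_insert, Finset.mem_erase, hC]
    tauto

end RoadMap
end BipartiteData

/-! ### Rotation by 180 degrees: from NW corners to SE corners. -/

namespace BipartiteData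

variable {T S : Type*} [DecidableEq T] [DecidableEq S] {Q Q' : BipartiteData T S}

theorem sum_lt_add_sum_gt {r : ℕ} (w : Fin r → ℕ) (P : Fin r → Prop) [DecidablePred P] {k : Fin r}
    (hk : P k) : ∑ l ∈ Finset.univ.filter (fun l => l < k ∧ P l), w l + w k +
      ∑ l ∈ Finset.univ.filter (fun l => k < l ∧ P l), w l = ∑ l ∈ Finset.univ.filter P, w l := by
  have h1 : Finset.univ.filter P = insert k (Finset.univ.filter (fun l => l < k ∧ P l)) ∪
      Finset.univ.filter (fun l => k < l ∧ P l) := by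
    ext l
    simp only [Finset.mem_filter, Finset.mem_univ, true_and, Finset.mem_union, Finset.mem_insert]
    constructor
    · intro h
      rcases lt_trichotomy l k with h1 | h1 | h1
      · exact Or.inl (Or.inr ⟨h1, h⟩)
      · exact Or.inl (Or.inl h1)
      · exact Or.inr ⟨h1, h⟩
    · rintro ((rfl | h) | h)
      · exact hk
      · exact h.2
      · exact h.2
  rw [h1, Finset.sum_union, Finset.sum_insert (by simp), add_comm (w k)]
  rw [Finset.disjoint_left]
  intro l h2 h3
  simp only [Finset.mem_insert, Finset.mem_filter, Finset.mem_univ, true_and] at h2 h3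
  rcases h2 with rfl | h2
  · exact lt_irrefl _ h3.1
  · exact lt_asymm h2.1 h3.1

/-- `Q'` is `Q` with the order of the arrows reversed. -/
structure Reversal (Q Q' : BipartiteData T S) where
  e : Fin Q.r ≃ Fin Q'.r
  lt_iff : ∀ k l, e k < e l ↔ l < k
  t_eq : ∀ k, Q'.t (e k) = Q.t k
  s_eq : ∀ k, Q'.s (e k) = Q.s k
  mT_eq : ∀ α, Q'.mT α = Q.mT α
  mS_eq : ∀ β, Q'.mS β = Q.mS β
  uT_eq : ∀ α, Q'.uT α = Q.uT α
  uS_eq : ∀ β, Q'.uS β = Q.uS β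

/-- The data with the order of the arrows reversed. -/
def rev (Q : BipartiteData T S) : BipartiteData T S :=
  { Q with t := fun k => Q.t k.rev, s := fun k => Q.s k.rev }

/-- The rotation of an `a × b` array by 180 degrees. -/
def rotate (a b : ℕ) (c : ℤ × ℤ) : ℤ × ℤ := (a + 1 - c.1, b + 1 - c.2)

theorem rotate_rotate (a b : ℕ) (c : ℤ × ℤ) : rotate a b (rotate a b c) = c := by
  simp [rotate]

theorem mem_map_rotate {a b : ℕ} {l : List (ℤ × ℤ)} {c : ℤ × ℤ} :
    rotate a b c ∈ l.reverse.map (rotate a b) ↔ c ∈ l := by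
  rw [List.mem_map]
  constructor
  · rintro ⟨x, hx, h⟩
    have := congrArg (rotate a b) h
    rw [rotate_rotate, rotate_rotate] at this
    rw [← this]
    simpa using hx
  · exact fun h => ⟨c, by simpa using h, rfl⟩

theorem Step.rotate {a b : ℕ} {x y : ℤ × ℤ} (h : Step x y) :
    Step (rotate a b y) (rotate a b x) := by
  rcases h with rfl | rfl
  · exact Or.inl (Prod.ext rfl (by simp only [BipartiteData.rotate]; ring))
  · exact Or.inr (Prod.ext (by simp only [BipartiteData.rotate]; ring) rfl)

theorem isNWCorner_map_rotate {a b : ℕ} {l : List (ℤ × ℤ)} {c : ℤ × ℤ} :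
    IsNWCorner (l.reverse.map (rotate a b)) (rotate a b c) ↔ IsSECorner l c := by
  have h1 : ((rotate a b c).1 + 1, (rotate a b c).2) = rotate a b (c.1 - 1, c.2) :=
    Prod.ext (by simp only [rotate]; ring) rfl
  have h2 : ((rotate a b c).1, (rotate a b c).2 + 1) = rotate a b (c.1, c.2 - 1) :=
    Prod.ext rfl (by simp only [rotate]; ring)
  simp only [IsNWCorner, IsSECorner, h1, h2, mem_map_rotate]

theorem isSECorner_map_rotate {a b : ℕ} {l : List (ℤ × ℤ)} {c : ℤ × ℤ} :
    IsSECorner (l.reverse.map (rotate a b)) (rotate a b c) ↔ IsNWCorner l c := by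
  have h1 : ((rotate a b c).1 - 1, (rotate a b c).2) = rotate a b (c.1 + 1, c.2) :=
    Prod.ext (by simp only [rotate]; ring) rfl
  have h2 : ((rotate a b c).1, (rotate a b c).2 - 1) = rotate a b (c.1, c.2 + 1) :=
    Prod.ext rfl (by simp only [rotate]; ring)
  simp only [IsNWCorner, IsSECorner, h1, h2, mem_map_rotate]

/-- `Q` and `Q.rev` are reversals of each other. -/
def reversal (Q : BipartiteData T S) : Reversal Q Q.rev where
  e := Fin.revPerm
  lt_iff _ _ := Fin.rev_lt_rev
  t_eq k := congrArg Q.t (Fin.rev_rev k)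
  s_eq k := congrArg Q.s (Fin.rev_rev k)
  mT_eq _ := rfl
  mS_eq _ := rfl
  uT_eq _ := rfl
  uS_eq _ := rfl

namespace Reversal

variable (E : Reversal Q Q')

/-- The inverse reversal. -/
def symm : Reversal Q' Q where
  e := E.e.symm
  lt_iff k l := by rw [← E.lt_iff]; simp
  t_eq k := by rw [← E.t_eq]; simp
  s_eq k := by rw [← E.s_eq]; simp
  mT_eq α := (E.mT_eq α).symm
  mS_eq α := (E.mS_eq α).symm
  uT_eq α := (E.uT_eq α).symm
  uS_eq α := (E.uS_eq α).symm

/-- The reversal of the transposed data. -/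
def op : Reversal Q.op Q'.op where
  e := E.e
  lt_iff := E.lt_iff
  t_eq := E.s_eq
  s_eq := E.t_eq
  mT_eq := E.mS_eq
  mS_eq := E.mT_eq
  uT_eq := E.uS_eq
  uS_eq := E.uT_eq

theorem sum_eq (w : Fin Q'.r → ℕ) (w' : Fin Q.r → ℕ) (hw : ∀ k, w (E.e k) = w' k)
    (P : Fin Q'.r → Prop) [DecidablePred P] (P' : Fin Q.r → Prop) [DecidablePred P']
    (hP : ∀ k, P (E.e k) ↔ P' k) :
    ∑ l ∈ Finset.univ.filter P, w l = ∑ l ∈ Finset.univ.filter P', w' l := by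
  symm
  exact Finset.sum_equiv E.e (fun k => by simp [hP]) (fun k _ => (hw k).symm)

theorem aT_eq (E : Reversal Q Q') (α : T) : Q'.aT α = Q.aT α := E.mT_eq α

theorem bT_eq (E : Reversal Q Q') (α : T) : Q'.bT α = Q.bT α :=
  E.sum_eq _ _ (fun k => by rw [E.s_eq, E.mS_eq]) _ _ (fun k => by rw [E.t_eq])

theorem vT_eq (E : Reversal Q Q') (α : T) : Q'.vT α = Q.vT α :=
  E.sum_eq _ _ (fun k => by rw [E.s_eq, E.uS_eq]) _ _ (fun k => by rw [E.t_eq])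

theorem aS_eq (E : Reversal Q Q') (β : S) : Q'.aS β = Q.aS β := E.op.bT_eq β

theorem bS_eq (E : Reversal Q Q') (β : S) : Q'.bS β = Q.bS β := E.op.aT_eq β

theorem vS_eq (E : Reversal Q Q') (β : S) : Q'.vS β = Q.vS β := E.op.vT_eq β

theorem admissible (E : Reversal Q Q') (h : Q.Admissible) : Q'.Admissible where
  target α := by
    rw [E.uT_eq, E.aT_eq, E.bT_eq, E.vT_eq]; exact h.target α
  source β := by
    rw [E.uS_eq, E.aS_eq, E.bS_eq, E.vS_eq]; exact h.source β

theorem colOffset_add (k : Fin Q.r) :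
    Q.colOffset k + Q.mS (Q.s k) + Q'.colOffset (E.e k) = Q.bT (Q.t k) := by
  have : Q'.colOffset (E.e k) = ∑ l ∈ Finset.univ.filter (fun l => k < l ∧ Q.t l = Q.t k),
      Q.mS (Q.s l) :=
    E.sum_eq _ _ (fun k => by rw [E.s_eq, E.mS_eq]) _ _
      (fun l => by rw [E.lt_iff, E.t_eq, E.t_eq])
  rw [this]
  exact sum_lt_add_sum_gt (fun l => Q.mS (Q.s l)) (fun l => Q.t l = Q.t k) rfl

theorem vertOffset_add (k : Fin Q.r) :
    Q.vertOffset k + Q.uS (Q.s k) + Q'.vertOffset (E.e k) = Q.vT (Q.t k) := by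
  have : Q'.vertOffset (E.e k) = ∑ l ∈ Finset.univ.filter (fun l => k < l ∧ Q.t l = Q.t k),
      Q.uS (Q.s l) :=
    E.sum_eq _ _ (fun k => by rw [E.s_eq, E.uS_eq]) _ _
      (fun l => by rw [E.lt_iff, E.t_eq, E.t_eq])
  rw [this]
  exact sum_lt_add_sum_gt (fun l => Q.uS (Q.s l)) (fun l => Q.t l = Q.t k) rfl

/-- The rotation of each page by 180 degrees. -/
def vertex (x : Q.Vertex) : Q'.Vertex where
  k := E.e x.k
  i := Q.mT (Q.t x.k) + 1 - x.i
  j := Q.mS (Q.s x.k) + 1 - x.j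
  hi := by
    have := x.bounds
    rw [Finset.mem_Icc, E.t_eq, E.mT_eq]; omega
  hj := by
    have := x.bounds
    rw [Finset.mem_Icc, E.s_eq, E.mS_eq]; omega

theorem symm_vertex (x : Q.Vertex) : E.symm.vertex (E.vertex x) = x := by
  have h := x.bounds
  refine Vertex.ext ?_ ?_ ?_
  · simp [vertex, symm]
  · simp only [vertex, E.t_eq, E.mT_eq]; omega
  · simp only [vertex, E.s_eq, E.mS_eq]; omega

theorem vertex_symm (x : Q'.Vertex) : E.vertex (E.symm.vertex x) = x := E.symm.symm_vertex x

theorem vertex_injective : Function.Injective E.vertex :=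
  Function.LeftInverse.injective E.symm_vertex

/-- `Reversal.vertex` as an embedding. -/
def emb : Q.Vertex ↪ Q'.Vertex := ⟨E.vertex, E.vertex_injective⟩

theorem t_vertex (x : Q.Vertex) : Q'.t (E.vertex x).k = Q.t x.k := E.t_eq x.k

theorem s_vertex (x : Q.Vertex) : Q'.s (E.vertex x).k = Q.s x.k := E.s_eq x.k

theorem posT_vertex (x : Q.Vertex) :
    Q'.posT (E.vertex x) = rotate (Q.aT (Q.t x.k)) (Q.bT (Q.t x.k)) (Q.posT x) := by
  have h := x.bounds
  have h1 := E.colOffset_add x.k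
  refine Prod.ext ?_ ?_
  · simp only [posT, rotate, vertex, aT]; omega
  · simp only [posT, rotate, vertex]; omega

theorem posS_vertex (x : Q.Vertex) :
    Q'.posS (E.vertex x) = rotate (Q.aS (Q.s x.k)) (Q.bS (Q.s x.k)) (Q.posS x) :=
  congrArg Prod.swap (E.op.posT_vertex x.op)

/-- Rotating every page and reversing the arrows turns `<_T` around, so the two facts needed for
`cMax` yield those needed for `cMin`. -/
theorem vertex_lt {x y : Q.Vertex} (h : E.vertex x < E.vertex y) : y < x := by
  have hx := x.bounds
  have hy := y.bounds
  rw [Vertex.lt_iff] at h ⊢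
  simp only [vertex, E.lt_iff, E.e.apply_eq_iff_eq] at h
  rcases h with h | ⟨hk, h⟩ | ⟨hk, hi, h⟩
  · exact Or.inl h
  · rw [← hk] at h hy
    exact Or.inr (Or.inl ⟨hk.symm, by omega⟩)
  · rw [← hk] at h hi hy
    exact Or.inr (Or.inr ⟨hk.symm, by omega, by omega⟩)

theorem later_vertex {x y : Q.Vertex} (h : Later (E.vertex x) (E.vertex y)) : Later y x := by
  have hx := x.bounds
  have hy := y.bounds
  simp only [Later, vertex, E.lt_iff, E.e.apply_eq_iff_eq] at h
  rcases h with h | ⟨hk, h, h'⟩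
  · exact Or.inl h
  · rw [← hk] at h h' hy
    exact Or.inr ⟨hk.symm, by omega, by omega⟩

theorem chain_rotate {a b n : ℕ} {X Y : Set (ℤ × ℤ)} (hXY : ∀ c ∈ X, rotate a b c ∈ Y)
    (h : HasDiagonalChain X n) : HasDiagonalChain Y n := by
  obtain ⟨f, h1, h2⟩ := h
  refine ⟨fun i => rotate a b (f i.rev), fun i => hXY _ (h1 _), fun i j hij => ?_⟩
  have := h2 j.rev i.rev (Fin.rev_lt_rev.2 hij)
  simp only [rotate]
  omega

theorem not_chain {B : Finset Q.Vertex} (h : ∀ α, ¬ HasDiagonalChain (Q.preT B α) (Q.uT α + 1))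
    (α : T) : ¬ HasDiagonalChain (Q'.preT (B.map E.emb) α) (Q'.uT α + 1) := by
  intro hc
  rw [E.uT_eq] at hc
  refine h α (chain_rotate (a := Q.aT α) (b := Q.bT α) ?_ hc)
  rintro c ⟨y, hy, hy2, rfl⟩
  obtain ⟨x, hx, rfl⟩ := Finset.mem_map.1 hy
  have hx2 : Q.t x.k = α := (E.t_vertex x).symm.trans hy2
  refine ⟨x, hx, hx2, ?_⟩
  have := E.posT_vertex x
  rw [hx2] at this
  change Q'.posT (E.emb x) = _ at this
  rw [this, rotate_rotate]

theorem compatible {B : Finset Q.Vertex} (h : Q.Compatible B) : Q'.Compatible (B.map E.emb) := by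
  refine ⟨E.not_chain h.1, fun β hc => ?_⟩
  refine E.op.not_chain h.op.1 β (hc.of_swap ?_)
  rintro c ⟨y, hy, hy2, rfl⟩
  obtain ⟨x, hx, rfl⟩ := Finset.mem_map.1 hy
  exact ⟨(E.vertex x).op, Finset.mem_map.2 ⟨x.op, Finset.mem_map.2 ⟨x, hx, rfl⟩, rfl⟩, hy2, rfl⟩

/-- The rotated road map. -/
def roadMap (R : Q.RoadMap) : Q'.RoadMap where
  H α p := (R.H α (Q.uT α + 1 - p)).reverse.map (rotate (Q.aT α) (Q.bT α))
  V β q := (R.V β (Q.uS β + 1 - q)).reverse.map (rotate (Q.aS β) (Q.bS β))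
  H_path α p hp := by
    rw [Finset.mem_Icc, E.uT_eq] at hp
    have := (R.H_path α (Q.uT α + 1 - p) (Finset.mem_Icc.2 (by omega))).map_reverse
      (φ := rotate (Q.aT α) (Q.bT α)) (fun _ _ => Step.rotate)
    rw [E.uT_eq, E.aT_eq, E.bT_eq]
    convert this using 1 <;> refine Prod.ext ?_ ?_ <;> simp only [rotate] <;> omega
  V_path β q hq := by
    rw [Finset.mem_Icc, E.uS_eq] at hq
    have := (R.V_path β (Q.uS β + 1 - q) (Finset.mem_Icc.2 (by omega))).map_reverse
      (φ := rotate (Q.aS β) (Q.bS β)) (fun _ _ => Step.rotate)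
    rw [E.uS_eq, E.aS_eq, E.bS_eq]
    convert this using 1 <;> refine Prod.ext ?_ ?_ <;> simp only [rotate] <;> omega
  H_disjoint α p hp p' hp' hne c hc hc' := by
    rw [Finset.mem_Icc, E.uT_eq] at hp hp'
    rw [← rotate_rotate (Q.aT α) (Q.bT α) c, mem_map_rotate] at hc hc'
    exact R.H_disjoint α _ (Finset.mem_Icc.2 (by omega)) _ (Finset.mem_Icc.2 (by omega))
      (by omega) hc hc'
  V_disjoint β p hp p' hp' hne c hc hc' := by
    rw [Finset.mem_Icc, E.uS_eq] at hp hp'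
    rw [← rotate_rotate (Q.aS β) (Q.bS β) c, mem_map_rotate] at hc hc'
    exact R.V_disjoint β _ (Finset.mem_Icc.2 (by omega)) _ (Finset.mem_Icc.2 (by omega))
      (by omega) hc hc'

theorem exists_Icc_reflect {u : ℕ} {P : ℕ → Prop} :
    (∃ p ∈ Finset.Icc 1 u, P (u + 1 - p)) ↔ ∃ p ∈ Finset.Icc 1 u, P p := by
  constructor
  · rintro ⟨p, hp, h⟩
    rw [Finset.mem_Icc] at hp
    exact ⟨_, Finset.mem_Icc.2 (by omega), h⟩
  · rintro ⟨p, hp, h⟩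
    rw [Finset.mem_Icc] at hp
    exact ⟨u + 1 - p, Finset.mem_Icc.2 (by omega), by rwa [show u + 1 - (u + 1 - p) = p by omega]⟩

variable (R : Q.RoadMap) (x : Q.Vertex)

theorem mem_H (p : ℕ) : Q'.posT (E.vertex x) ∈ (E.roadMap R).H (Q'.t (E.vertex x).k) p ↔
    Q.posT x ∈ R.H (Q.t x.k) (Q.uT (Q.t x.k) + 1 - p) := by
  rw [E.posT_vertex, E.t_vertex]
  exact mem_map_rotate

theorem mem_V (q : ℕ) : Q'.posS (E.vertex x) ∈ (E.roadMap R).V (Q'.s (E.vertex x).k) q ↔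
    Q.posS x ∈ R.V (Q.s x.k) (Q.uS (Q.s x.k) + 1 - q) := by
  rw [E.posS_vertex, E.s_vertex]
  exact mem_map_rotate

theorem onHorizontal : (E.roadMap R).OnHorizontal (E.vertex x) ↔ R.OnHorizontal x := by
  simp only [RoadMap.OnHorizontal, E.mem_H]
  rw [E.t_vertex, E.uT_eq]
  exact exists_Icc_reflect (P := fun p => Q.posT x ∈ R.H (Q.t x.k) p)

theorem onVertical : (E.roadMap R).OnVertical (E.vertex x) ↔ R.OnVertical x := by
  simp only [RoadMap.OnVertical, E.mem_V]
  rw [E.s_vertex, E.uS_eq]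
  exact exists_Icc_reflect (P := fun p => Q.posS x ∈ R.V (Q.s x.k) p)

theorem isHorizontalNWCorner :
    (E.roadMap R).IsHorizontalNWCorner (E.vertex x) ↔ R.IsHorizontalSECorner x := by
  simp only [RoadMap.IsHorizontalNWCorner, E.posT_vertex]
  rw [E.t_vertex, E.uT_eq]
  simp only [roadMap, isNWCorner_map_rotate]
  exact exists_Icc_reflect (P := fun p => IsSECorner (R.H (Q.t x.k) p) (Q.posT x))

theorem isHorizontalSECorner :
    (E.roadMap R).IsHorizontalSECorner (E.vertex x) ↔ R.IsHorizontalNWCorner x := by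
  simp only [RoadMap.IsHorizontalSECorner, E.posT_vertex]
  rw [E.t_vertex, E.uT_eq]
  simp only [roadMap, isSECorner_map_rotate]
  exact exists_Icc_reflect (P := fun p => IsNWCorner (R.H (Q.t x.k) p) (Q.posT x))

theorem isVerticalNWCorner :
    (E.roadMap R).IsVerticalNWCorner (E.vertex x) ↔ R.IsVerticalSECorner x := by
  simp only [RoadMap.IsVerticalNWCorner, E.posS_vertex]
  rw [E.s_vertex, E.uS_eq]
  simp only [roadMap, isNWCorner_map_rotate]
  exact exists_Icc_reflect (P := fun p => IsSECorner (R.V (Q.s x.k) p) (Q.posS x))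

theorem isVerticalSECorner :
    (E.roadMap R).IsVerticalSECorner (E.vertex x) ↔ R.IsVerticalNWCorner x := by
  simp only [RoadMap.IsVerticalSECorner, E.posS_vertex]
  rw [E.s_vertex, E.uS_eq]
  simp only [roadMap, isSECorner_map_rotate]
  exact exists_Icc_reflect (P := fun p => IsNWCorner (R.V (Q.s x.k) p) (Q.posS x))

theorem meets (p q : ℕ) : (E.roadMap R).Meets p q (E.vertex x) ↔
    R.Meets (Q.uT (Q.t x.k) + 1 - p) (Q.uS (Q.s x.k) + 1 - q) x :=
  and_congr (E.mem_H R x p) (E.mem_V R x q)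

theorem isNEEnd (p q : ℕ) : (E.roadMap R).IsNEEnd p q (E.vertex x) ↔
    R.IsSWEnd (Q.uT (Q.t x.k) + 1 - p) (Q.uS (Q.s x.k) + 1 - q) x := by
  have hx := x.bounds
  refine and_congr (E.meets R x p q) ⟨fun h y hy hm => ?_, fun h y hy hm => ?_⟩
  · have h1 := h (E.vertex y) (congrArg E.e hy) ((E.meets R y p q).2 (by rwa [hy]))
    have hyb := y.bounds
    simp only [vertex, hy] at h1 hyb
    omega
  · obtain ⟨y, rfl⟩ : ∃ z, y = E.vertex z := ⟨_, (E.vertex_symm y).symm⟩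
    have hy : y.k = x.k := E.e.injective hy
    rw [E.meets R y p q, hy] at hm
    have h1 := h y hy hm
    have hyb := y.bounds
    simp only [vertex, hy] at hyb ⊢
    omega

theorem isSWEnd (p q : ℕ) : (E.roadMap R).IsSWEnd p q (E.vertex x) ↔
    R.IsNEEnd (Q.uT (Q.t x.k) + 1 - p) (Q.uS (Q.s x.k) + 1 - q) x := by
  have hx := x.bounds
  refine and_congr (E.meets R x p q) ⟨fun h y hy hm => ?_, fun h y hy hm => ?_⟩
  · have h1 := h (E.vertex y) (congrArg E.e hy) ((E.meets R y p q).2 (by rwa [hy]))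
    have hyb := y.bounds
    simp only [vertex, hy] at h1 hyb
    omega
  · obtain ⟨y, rfl⟩ : ∃ z, y = E.vertex z := ⟨_, (E.vertex_symm y).symm⟩
    have hy : y.k = x.k := E.e.injective hy
    rw [E.meets R y p q, hy] at hm
    have h1 := h y hy hm
    have hyb := y.bounds
    simp only [vertex, hy] at hyb ⊢
    omega

/-- The indices of paths are reflected, `p` becoming `u + 1 - p`; by `vertOffset_add` this turns the
equation that excludes `Q_{p, p + v - u}` into the one that excludes `P_{p, p}`. -/
theorem isEssentialHorizontalNWCorner : (E.roadMap R).IsEssentialHorizontalNWCorner (E.vertex x) ↔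
    R.IsEssentialHorizontalSECorner x := by
  refine and_congr (E.isHorizontalNWCorner R x) (not_congr ?_)
  have hv : Q.vertOffset x.k + Q.uS (Q.s x.k) + Q'.vertOffset (E.vertex x).k = Q.vT (Q.t x.k) :=
    E.vertOffset_add x.k
  simp only [E.isNEEnd]
  rw [E.t_vertex, E.s_vertex, E.uT_eq, E.uS_eq, E.vT_eq]
  rw [← exists_Icc_reflect (u := Q.uT (Q.t x.k))]
  refine exists_congr fun p => and_congr_right fun hp => ?_
  rw [← exists_Icc_reflect (u := Q.uS (Q.s x.k))]
  refine exists_congr fun q => and_congr_right fun hq => ?_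
  rw [Finset.mem_Icc] at hp hq
  rw [show Q.uT (Q.t x.k) + 1 - (Q.uT (Q.t x.k) + 1 - p) = p by omega,
    show Q.uS (Q.s x.k) + 1 - (Q.uS (Q.s x.k) + 1 - q) = q by omega]
  exact and_congr_left fun _ => by omega

theorem isEssentialVerticalNWCorner : (E.roadMap R).IsEssentialVerticalNWCorner (E.vertex x) ↔
    R.IsEssentialVerticalSECorner x := by
  refine and_congr (E.isVerticalNWCorner R x) (not_congr ?_)
  have hv : Q.horizOffset x.k + Q.uT (Q.t x.k) + Q'.horizOffset (E.vertex x).k = Q.vS (Q.s x.k) :=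
    E.op.vertOffset_add x.k
  simp only [E.isSWEnd]
  rw [E.t_vertex, E.s_vertex, E.uT_eq, E.uS_eq, E.vS_eq]
  rw [← exists_Icc_reflect (u := Q.uS (Q.s x.k))]
  refine exists_congr fun q => and_congr_right fun hq => ?_
  rw [← exists_Icc_reflect (u := Q.uT (Q.t x.k))]
  refine exists_congr fun p => and_congr_right fun hp => ?_
  rw [Finset.mem_Icc] at hp hq
  rw [show Q.uT (Q.t x.k) + 1 - (Q.uT (Q.t x.k) + 1 - p) = p by omega,
    show Q.uS (Q.s x.k) + 1 - (Q.uS (Q.s x.k) + 1 - q) = q by omega]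
  exact and_congr_left fun _ => by omega

variable {R}

theorem isStraight (h : R.IsStraight) : (E.roadMap R).IsStraight := by
  constructor
  · intro y hy
    obtain ⟨x, rfl⟩ : ∃ z, y = E.vertex z := ⟨_, (E.vertex_symm y).symm⟩
    rw [E.isHorizontalNWCorner, E.isHorizontalSECorner] at hy
    exact (E.onVertical R x).2 (h.1 x hy.symm)
  · intro y hy
    obtain ⟨x, rfl⟩ : ∃ z, y = E.vertex z := ⟨_, (E.vertex_symm y).symm⟩
    rw [E.isVerticalNWCorner, E.isVerticalSECorner] at hy
    exact (E.onHorizontal R x).2 (h.2 x hy.symm)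

theorem mem_map_emb {C : Finset Q.Vertex} {x : Q.Vertex} : E.vertex x ∈ C.map E.emb ↔ x ∈ C :=
  Finset.mem_map' E.emb

theorem induces {C : Finset Q.Vertex} (h : R.Induces C) :
    (E.roadMap R).Induces (C.map E.emb) := by
  intro y
  obtain ⟨x, rfl⟩ : ∃ z, y = E.vertex z := ⟨_, (E.vertex_symm y).symm⟩
  rw [E.mem_map_emb, E.onHorizontal, E.onVertical]
  exact h x

end Reversal

namespace RoadMap

/-- The essential SE corners. -/
def IsEssentialSECorner (R : Q.RoadMap) (x : Q.Vertex) : Prop :=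
  R.IsEssentialHorizontalSECorner x ∨ R.IsEssentialVerticalSECorner x

theorem isEssentialNWCorner_reversal (E : Reversal Q Q') (R : Q.RoadMap) (x : Q.Vertex) :
    (E.roadMap R).IsEssentialNWCorner (E.vertex x) ↔ R.IsEssentialSECorner x :=
  or_congr (E.isEssentialHorizontalNWCorner R x) (E.isEssentialVerticalNWCorner R x)

variable {R : Q.RoadMap} (hQ : Q.Admissible) (hR : R.IsStraight)
include hQ hR

/-- A set containing the essential SE corners, a vertex outside of the concurrent vertex map and the
vertices of the map that precede it is not `u`-compatible. -/
theorem not_compatible_of_SE {C : Finset Q.Vertex} (hC : R.Induces C) {x : Q.Vertex} (hx : x ∉ C)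
    {B : Finset Q.Vertex} (hxB : x ∈ B) (hE : ∀ y, R.IsEssentialSECorner y → y ∈ B)
    (hL : ∀ y ∈ C, Later y x → y ∈ B) : ¬ Q.Compatible B := by
  intro hcomp
  have E := Q.reversal
  refine not_compatible (E.admissible hQ) (E.isStraight hR) (E.induces hC) (x := E.vertex x)
    (fun h => hx (E.mem_map_emb.1 h)) (B := B.map E.emb) (E.mem_map_emb.2 hxB) (fun y hy => ?_)
    (fun y hy hxy => ?_) (E.compatible hcomp)
  · obtain ⟨y, rfl⟩ : ∃ z, y = E.vertex z := ⟨_, (E.vertex_symm y).symm⟩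
    exact E.mem_map_emb.2 (hE y ((isEssentialNWCorner_reversal E R y).1 hy))
  · obtain ⟨y, rfl⟩ : ∃ z, y = E.vertex z := ⟨_, (E.vertex_symm y).symm⟩
    exact E.mem_map_emb.2 (hL y (E.mem_map_emb.1 hy) (E.later_vertex hxy))

/-- An essential SE corner of a concurrent vertex map can be replaced by a vertex that precedes
it. -/
theorem exists_flip_of_SE {C : Finset Q.Vertex} (hC : R.Induces C) {z : Q.Vertex}
    (hz : R.IsEssentialSECorner z) : z ∈ C ∧ ∃ x ∉ C, x < z ∧ ∃ R' : Q.RoadMap, R'.IsStraight ∧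
      R'.Induces (insert x (C.erase z)) := by
  have E := Q.reversal
  obtain ⟨h1, x, h2, h3, R', h4, h5⟩ := exists_flip (E.admissible hQ) (E.isStraight hR)
    (E.induces hC) ((isEssentialNWCorner_reversal E R z).2 hz)
  obtain ⟨x, rfl⟩ : ∃ z, x = E.vertex z := ⟨_, (E.vertex_symm x).symm⟩
  refine ⟨E.mem_map_emb.1 h1, x, fun h => h2 (E.mem_map_emb.2 h), E.vertex_lt h3,
    E.symm.roadMap R', E.symm.isStraight h4, fun y => ?_⟩
  have h6 := h5 (E.vertex y)
  rw [← E.symm.onHorizontal, ← E.symm.onVertical, E.symm_vertex] at h6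
  rw [← h6]
  simp only [Finset.mem_insert, Finset.mem_erase, E.mem_map_emb, E.vertex_injective.eq_iff,
    E.vertex_injective.ne_iff]

end RoadMap
end BipartiteData

/-! ### The greedy algorithm and the order on concurrent vertex maps. -/

namespace BipartiteData

variable {T S : Type*} [DecidableEq T] [DecidableEq S] {Q : BipartiteData T S}

theorem Compatible.mono {B C : Finset Q.Vertex} (h : Q.Compatible C) (hBC : B ⊆ C) :
    Q.Compatible B := by
  refine ⟨fun α ⟨f, h1, h2⟩ => h.1 α ⟨f, fun a => ?_, h2⟩,
    fun β ⟨f, h1, h2⟩ => h.2 β ⟨f, fun a => ?_, h2⟩⟩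
  · obtain ⟨x, hx, hx'⟩ := h1 a
    exact ⟨x, hBC hx, hx'⟩
  · obtain ⟨x, hx, hx'⟩ := h1 a
    exact ⟨x, hBC hx, hx'⟩

section Greedy

variable {A C : Finset Q.Vertex} {l : List Q.Vertex}

theorem subset_greedyStep (A : Finset Q.Vertex) (x : Q.Vertex) : A ⊆ Q.greedyStep A x := by
  unfold greedyStep
  split_ifs
  · exact Finset.subset_insert _ _
  · exact Finset.Subset.refl _

theorem greedyStep_subset (A : Finset Q.Vertex) (x : Q.Vertex) :
    Q.greedyStep A x ⊆ insert x A := by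
  unfold greedyStep
  split_ifs
  · exact Finset.Subset.refl _
  · exact Finset.subset_insert _ _

theorem subset_foldl (l : List Q.Vertex) (A : Finset Q.Vertex) :
    A ⊆ l.foldl Q.greedyStep A := by
  induction l generalizing A with
  | nil => exact Finset.Subset.refl _
  | cons x l ih => exact (subset_greedyStep A x).trans (ih _)

theorem mem_or_mem_of_mem_foldl {y : Q.Vertex} (h : y ∈ l.foldl Q.greedyStep A) :
    y ∈ A ∨ y ∈ l := by
  induction l generalizing A with
  | nil => exact Or.inl h
  | cons x l ih =>
    rcases ih h with h | h
    · have := greedyStep_subset A x h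
      rw [Finset.mem_insert] at this
      rcases this with rfl | h
      · exact Or.inr (by simp)
      · exact Or.inl h
    · exact Or.inr (by simp [h])

/-- Throughout, the current set lies in `C` and contains the elements of `C` already visited. So
every element of `C` is accepted, `C` being compatible, and `h` rejects all others. -/
theorem foldl_greedyStep_eq {r : Q.Vertex → Q.Vertex → Prop} (hr : ∀ x y, r x y → ¬ r y x)
    (hC : Q.Compatible C) (hl : l.Pairwise r) (hA : A ⊆ C) (hlC : ∀ y ∈ C, y ∉ l → y ∈ A)
    (h : ∀ x ∉ C, ∀ B, x ∈ B → A ⊆ B → (∀ y ∈ C, r y x → y ∈ B) → ¬ Q.Compatible B) :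
    l.foldl Q.greedyStep A = C := by
  induction l generalizing A with
  | nil => exact Finset.Subset.antisymm hA fun y hy => hlC y hy (by simp)
  | cons x l ih =>
    rw [List.pairwise_cons] at hl
    rw [List.foldl_cons]
    by_cases hx : x ∈ C
    · have hins : insert x A ⊆ C := Finset.insert_subset hx hA
      rw [greedyStep, if_pos (hC.mono hins)]
      refine ih hl.2 hins (fun y hy hyl => ?_) fun w hw B hwB hB =>
        h w hw B hwB ((Finset.subset_insert _ _).trans hB)
      rw [Finset.mem_insert]
      by_cases hyx : y = x
      · exact Or.inl hyx
      · exact Or.inr (hlC y hy (by simp [hyx, hyl]))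
    · have hinc : ¬ Q.Compatible (insert x A) := by
        refine h x hx _ (Finset.mem_insert_self _ _) (Finset.subset_insert _ _) fun y hy hyx =>
          Finset.mem_insert_of_mem (hlC y hy fun hmem => ?_)
        rw [List.mem_cons] at hmem
        rcases hmem with rfl | hmem
        · exact hx hy
        · exact hr _ _ hyx (hl.1 y hmem)
      rw [greedyStep, if_neg hinc]
      refine ih hl.2 hA (fun y hy hyl => hlC y hy ?_) h
      rw [List.mem_cons, not_or]
      exact ⟨fun hyx => hx (hyx ▸ hy), hyl⟩

/-- If the result were `C`, the set present when `x` is visited would lie in `C` without `z`, as `z`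
comes later; then `x` would be accepted. -/
theorem foldl_greedyStep_ne {r : Q.Vertex → Q.Vertex → Prop} (hr : ∀ x y, r x y → ¬ r y x)
    (hl : l.Pairwise r) {x z : Q.Vertex} (hxl : x ∈ l) (hzA : z ∉ A) (hx : x ∉ C) (hxz : r x z)
    (h : Q.Compatible (insert x (C.erase z))) : l.foldl Q.greedyStep A ≠ C := by
  rintro rfl
  obtain ⟨l₁, l₂, rfl⟩ := List.append_of_mem hxl
  rw [List.pairwise_append, List.pairwise_cons] at hl
  rw [List.foldl_append, List.foldl_cons] at hx h
  have hsub : insert x (l₁.foldl Q.greedyStep A) ⊆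
      insert x ((l₂.foldl Q.greedyStep (Q.greedyStep (l₁.foldl Q.greedyStep A) x)).erase z) := by
    refine Finset.insert_subset_insert _ fun y hy => Finset.mem_erase.2 ⟨?_, ?_⟩
    · rintro rfl
      rcases mem_or_mem_of_mem_foldl hy with h1 | h1
      · exact hzA h1
      · exact hr _ _ hxz (hl.2.2 y h1 x (by simp))
    · exact subset_foldl _ _ (subset_greedyStep _ _ hy)
  apply hx
  refine subset_foldl _ _ ?_
  rw [greedyStep, if_pos (h.mono hsub)]
  exact Finset.mem_insert_self _ _

end Greedy

/-- `C` and `C'` have the same cardinality, and the largest vertex in which they differ belongs to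
`C'`. -/
def DomLT (C C' : Finset Q.Vertex) : Prop :=
  C.card = C'.card ∧ ∃ x ∈ C', x ∉ C ∧ ∀ y, x < y → (y ∈ C ↔ y ∈ C')

instance : Std.Irrefl (DomLT (Q := Q)) := ⟨fun _ ⟨_, _, h1, h2, _⟩ => h2 h1⟩

instance : IsTrans (Finset Q.Vertex) DomLT := ⟨by
  rintro A B C ⟨h1, x, hx, hx', h2⟩ ⟨h3, y, hy, hy', h4⟩
  refine ⟨h1.trans h3, ?_⟩
  rcases lt_trichotomy x y with h | rfl | h
  · exact ⟨y, hy, fun h' => hy' ((h2 y h).1 h'), fun z hz => (h2 z (h.trans hz)).trans (h4 z hz)⟩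
  · exact absurd hx hy'
  · exact ⟨x, (h4 x h).1 hx, hx', fun z hz => (h2 z hz).trans (h4 z (h.trans hz))⟩⟩

theorem DomLT.ltT {C C' : Finset Q.Vertex} (h : DomLT C C') (hC : Q.IsConcurrentVertexMap C)
    (hC' : Q.IsConcurrentVertexMap C') : Q.LtT C C' := by
  obtain ⟨hcard, x, hx, hx', h⟩ := h
  refine ⟨hC, hC', C.card, C.orderEmbOfFin rfl, C'.orderEmbOfFin hcard.symm,
    OrderEmbedding.strictMono _, OrderEmbedding.strictMono _, by simp, by simp, ?_⟩
  set P := C.orderEmbOfFin rfl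
  set P' := C'.orderEmbOfFin hcard.symm
  have hP : ∀ s, P s ∈ C := fun s => C.orderEmbOfFin_mem rfl s
  have hP' : ∀ y ∈ C', ∃ s, P' s = y := fun y hy => by
    have : y ∈ Set.range P' := by
      rw [Finset.range_orderEmbOfFin]; exact hy
    exact this
  have hne : (Finset.univ.filter fun s => P s ≠ P' s).Nonempty := by
    obtain ⟨s, hs⟩ := hP' x hx
    refine ⟨s, Finset.mem_filter.2 ⟨Finset.mem_univ _, fun he => hx' ?_⟩⟩
    rw [← hs, ← he]
    exact hP s
  obtain ⟨t, ht, hmax⟩ := Finset.exists_max_image _ id hne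
  have hgt : ∀ s, t < s → P s = P' s := fun s hs => by
    by_contra hcon
    exact absurd (hmax s (Finset.mem_filter.2 ⟨Finset.mem_univ _, hcon⟩)) (not_le.2 hs)
  refine ⟨t, ?_, hgt⟩
  rcases lt_trichotomy (P t) (P' t) with h1 | h1 | h1
  · exact h1
  · exact absurd h1 (Finset.mem_filter.1 ht).2
  -- Here `x ≤ P' t < P t`, so `P t` also belongs to `C'`, at a position after `t`. The enumerations
  -- agree there, and `P` would take this value twice.
  · exfalso
    obtain ⟨s, hs⟩ := hP' x hx
    have hst : s ≤ t := by
      by_contra hcon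
      exact hx' (by rw [← hs, ← hgt s (not_le.1 hcon)]; exact hP s)
    have hxt : x < P t := by
      rw [← hs]
      exact (P'.monotone hst).trans_lt h1
    obtain ⟨s', hs'⟩ := hP' _ ((h _ hxt).1 (hP t))
    have hts : t < s' := P'.lt_iff_lt.1 (by rw [hs']; exact h1)
    have := P.injective ((hgt s' hts).trans hs')
    exact hts.ne' this

theorem domLT_insert_erase {C : Finset Q.Vertex} {x z : Q.Vertex} (hz : z ∈ C) (hx : x ∉ C)
    (hzx : z < x) : DomLT C (insert x (C.erase z)) := by
  refine ⟨?_, x, Finset.mem_insert_self _ _, hx, fun y hy => ?_⟩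
  · rw [Finset.card_insert_of_notMem (fun h => hx (Finset.mem_of_mem_erase h)),
      Finset.card_erase_add_one hz]
  · rw [Finset.mem_insert, Finset.mem_erase]
    have h1 := hy.ne'
    have h2 := (hzx.trans hy).ne'
    tauto

theorem domLT_of_insert_erase {C : Finset Q.Vertex} {x z : Q.Vertex} (hz : z ∈ C) (hx : x ∉ C)
    (hxz : x < z) : DomLT (insert x (C.erase z)) C := by
  refine ⟨?_, z, hz, ?_, fun y hy => ?_⟩
  · rw [Finset.card_insert_of_notMem (fun h => hx (Finset.mem_of_mem_erase h)),
      Finset.card_erase_add_one hz]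
  · rw [Finset.mem_insert, Finset.mem_erase]
    have := hxz.ne'
    tauto
  · rw [Finset.mem_insert, Finset.mem_erase]
    have h1 := hy.ne'
    have h2 := (hxz.trans hy).ne'
    tauto

theorem subset_insert_erase {A C : Finset Q.Vertex} {x z : Q.Vertex} (hA : A ⊆ C) (hz : z ∉ A) :
    A ⊆ insert x (C.erase z) := fun _ hy =>
  Finset.mem_insert_of_mem (Finset.mem_erase.2 ⟨fun h => hz (h ▸ hy), hA hy⟩)

section Main

variable (hQ : Q.Admissible) {A : Finset Q.Vertex}
include hQ

/-- A missing essential corner is later exchanged for a larger vertex, which `foldl_greedyStep_ne`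
forbids if the result is `C`; the converse is `not_compatible` inserted into `foldl_greedyStep_eq`.
-/
theorem cMax_eq_iff {C : Finset Q.Vertex} {R : Q.RoadMap} (hR : R.IsStraight) (hC : R.Induces C)
    (hA : A ⊆ C) : Q.cMax A = C ↔ ∀ x, R.IsEssentialNWCorner x → x ∈ A := by
  have hpw : ((Finset.univ : Finset Q.Vertex).sort (· ≥ ·)).Pairwise (· > ·) :=
    (Finset.sortedGT_sort _).pairwise
  constructor
  · intro h z hz
    by_contra hzA
    obtain ⟨-, x, hx, hzx, R', -, hR'⟩ := RoadMap.exists_flip hQ hR hC hz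
    exact foldl_greedyStep_ne (fun _ _ => lt_asymm) hpw (by simp) hzA hx hzx hR'.compatible h
  · intro h
    exact foldl_greedyStep_eq (fun _ _ => lt_asymm) hC.compatible hpw hA (by simp)
      fun x hx B hxB hB hL => RoadMap.not_compatible hQ hR hC hx hxB (fun y hy => hB (h y hy))
        fun y hy hxy => hL y hy hxy.lt

theorem cMin_eq_iff {C : Finset Q.Vertex} {R : Q.RoadMap} (hR : R.IsStraight) (hC : R.Induces C)
    (hA : A ⊆ C) : Q.cMin A = C ↔ ∀ x, R.IsEssentialSECorner x → x ∈ A := by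
  have hpw : ((Finset.univ : Finset Q.Vertex).sort (· ≤ ·)).Pairwise (· < ·) :=
    (Finset.sortedLT_sort _).pairwise
  constructor
  · intro h z hz
    by_contra hzA
    obtain ⟨-, x, hx, hzx, R', -, hR'⟩ := RoadMap.exists_flip_of_SE hQ hR hC hz
    exact foldl_greedyStep_ne (fun _ _ => lt_asymm) hpw (by simp) hzA hx hzx hR'.compatible h
  · intro h
    exact foldl_greedyStep_eq (fun _ _ => lt_asymm) hC.compatible hpw hA (by simp)
      fun x hx B hxB hB hL => RoadMap.not_compatible_of_SE hQ hR hC hx hxB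
        (fun y hy => hB (h y hy)) fun y hy hxy => hL y hy hxy.lt

/-- Induction from larger sets to smaller ones. Flipping an essential corner missing from `A` gives
a larger concurrent vertex map that still contains `A`; if none is missing, the algorithm returns
`C`. In particular its output is a concurrent vertex map. -/
theorem domLT_cMax (C : Finset Q.Vertex) (hC : Q.IsConcurrentVertexMap C) (hA : A ⊆ C) :
    C = Q.cMax A ∨ DomLT C (Q.cMax A) ∧ Q.IsConcurrentVertexMap (Q.cMax A) := by
  induction C using (Finite.wellFounded_of_trans_of_irrefl (Function.swap (DomLT (Q := Q)))).induction
  rename_i C ih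
  obtain ⟨R, hR, hRC⟩ := hC
  by_cases hess : ∀ x, R.IsEssentialNWCorner x → x ∈ A
  · exact Or.inl ((cMax_eq_iff hQ hR hRC hA).2 hess).symm
  · push Not at hess
    obtain ⟨z, hz, hzA⟩ := hess
    obtain ⟨hzC, x, hx, hzx, R', hR', hC'⟩ := RoadMap.exists_flip hQ hR hRC hz
    have hlt := domLT_insert_erase hzC hx hzx
    right
    rcases ih _ hlt ⟨R', hR', hC'⟩ (subset_insert_erase hA hzA) with h | ⟨h, h'⟩
    · rw [← h]
      exact ⟨hlt, R', hR', hC'⟩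
    · exact ⟨_root_.trans hlt h, h'⟩

theorem domLT_cMin (C : Finset Q.Vertex) (hC : Q.IsConcurrentVertexMap C) (hA : A ⊆ C) :
    Q.cMin A = C ∨ DomLT (Q.cMin A) C ∧ Q.IsConcurrentVertexMap (Q.cMin A) := by
  induction C using (Finite.wellFounded_of_trans_of_irrefl (DomLT (Q := Q))).induction
  rename_i C ih
  obtain ⟨R, hR, hRC⟩ := hC
  by_cases hess : ∀ x, R.IsEssentialSECorner x → x ∈ A
  · exact Or.inl ((cMin_eq_iff hQ hR hRC hA).2 hess)
  · push Not at hess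
    obtain ⟨z, hz, hzA⟩ := hess
    obtain ⟨hzC, x, hx, hxz, R', hR', hC'⟩ := RoadMap.exists_flip_of_SE hQ hR hRC hz
    have hlt := domLT_of_insert_erase hzC hx hxz
    right
    rcases ih _ hlt ⟨R', hR', hC'⟩ (subset_insert_erase hA hzA) with h | ⟨h, h'⟩
    · rw [h]
      exact ⟨hlt, R', hR', hC'⟩
    · exact ⟨_root_.trans h hlt, h'⟩

end Main
end BipartiteData

theorem mainTheorem8 {T S : Type*} [DecidableEq T] [DecidableEq S]
    (Q : BipartiteData T S) (hQ : Q.Admissible)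
    (C : Finset Q.Vertex) (R : Q.RoadMap) (hR : R.IsStraight) (hC : R.Induces C)
    (A : Finset Q.Vertex) (hA : A ⊆ C) :
    (Q.LeT C (Q.cMax A) ∧
      (Q.cMax A = C ↔ ∀ x : Q.Vertex,
        R.IsEssentialHorizontalNWCorner x ∨ R.IsEssentialVerticalNWCorner x → x ∈ A)) ∧
    (Q.LeT (Q.cMin A) C ∧
      (Q.cMin A = C ↔ ∀ x : Q.Vertex,
        R.IsEssentialHorizontalSECorner x ∨ R.IsEssentialVerticalSECorner x → x ∈ A)) := by
  have hCVM : Q.IsConcurrentVertexMap C := ⟨R, hR, hC⟩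
  refine ⟨⟨?_, BipartiteData.cMax_eq_iff hQ hR hC hA⟩, ?_, BipartiteData.cMin_eq_iff hQ hR hC hA⟩
  · rcases BipartiteData.domLT_cMax hQ C hCVM hA with h | ⟨h, h'⟩
    · exact Or.inr h
    · exact Or.inl (h.ltT hCVM h')
  · rcases BipartiteData.domLT_cMin hQ C hCVM hA with h | ⟨h, h'⟩
    · exact Or.inr h
    · exact Or.inl (h.ltT h' hCVM)
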